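/- **Setting.** Let $M$ be a closed (compact, without boundary), connected $C^\infty$ manifold of dimension $n$ with a $C^\infty$ Riemannian metric, and let $\Phi=\{f_t\}$ be a $C^\infty$ Anosov flow on $M$ with infinitesimal generator $X$: $X$ vanishes nowhere, there is a $Tf_t$-invariant splitting $TM=E^{uu}\oplus E^c\oplus E^{ss}$ with $E^c=\mathbb{R}X$, and there are constants $c,c',\nu,\lambda>0$ such that $\|Tf_t v\|\le c\,e^{-\nu t}\|v\|$ and $\|Tf_t w\|\ge c'e^{\lambda t}\|w\|$ for all $t\ge 0$, $v\in E^{ss}$, $w\in E^{uu}$. Put $E^{cs}=E^c\oplus E^{ss}$. Assume that $\Phi$ is *asymmetric*: there are $C,\mu>0$ such that for every $x\in M$, every $(n-2)$-dimensional parallelepiped $\Pi\subset T_xM$ with at least one side in $E^{uu}_x$, and every $t\ge 0$, $$\mathrm{vol}(T_xf_{-t}(\Pi))\le C e^{-\mu t}\,\mathrm{vol}(\Pi).$$ For continuous $k$-forms $\eta,\xi$, the equation $L_X\eta=\xi$ means that $\frac{d}{dt}\big|_{t=0}(f_t^*\eta)_x=\xi_x$ at every $x\in M$. **Theorem (Livšic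 theorem for forms of intermediate degree).** Let $2\le k\le n-2$ and let $\xi$ be a continuous $k$-form on $M$. Then: (a) There is a unique continuous $k$-form $\eta$ such that $L_X\eta=\xi$. It is given by the absolutely convergent integrals $$\eta(v_1,\dots,v_k)=-\int_0^\infty (f_s^*\xi)(v_1,\dots,v_k)\,ds\quad\text{if } v_1,\dots,v_k\in E^{cs}_x,$$ $$\eta(v_1,\dots,v_k)=\int_0^\infty (f_{-s}^*\xi)(v_1,\dots,v_k)\,ds\quad\text{if some } v_j\in E^{uu}_x .$$ (b) If $\xi$, $E^{uu}$ and $E^{cs}$ are of class $C^1$, then there is a family $(\eta_t)_{t\ge 0}$ of $C^1$ $k$-forms such that each $L_X\eta_t$ exists and is also $C^1$, and $\eta_t\to\eta$ and $L_X\eta_t\to L_X\eta=\xi$ as $t\to\infty$, both in the $C^0$-norm $\|\omega\|_\infty=\sup_{p\in M}\max\{|\omega_p(u_1,\dots,u_k)| : u_j\in T_pM,\ \|u_j\|=1\}$. -/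

import Mathlib

open scoped Manifold ContDiff Topology

namespace AnosovForms

/-- The model space of an `n`-dimensional manifold. -/
abbrev Model (n : ℕ) : Type := EuclideanSpace ℝ (Fin n)

section Basic

variable {n : ℕ} {M : Type*} [TopologicalSpace M] [ChartedSpace (Model n) M]

/-- A (not necessarily continuous) differential form of degree `k` on `M`. -/
abbrev Form (n k : ℕ) (M : Type*) [TopologicalSpace M] [ChartedSpace (Model n) M] : Type _ :=
  (x : M) → TangentSpace (𝓡 n) x [⋀^Fin k]→L[ℝ] ℝ

/-- A (not necessarily continuous) field of linear subspaces of the tangent spaces of `M`. -/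
abbrev Distribution (n : ℕ) (M : Type*) [TopologicalSpace M] [ChartedSpace (Model n) M] : Type _ :=
  (x : M) → Submodule ℝ (TangentSpace (𝓡 n) x)

/-- The expression of the form `β` in the preferred chart at `x₀`, that is, the pullback of `β`
by the inverse of this chart. -/
noncomputable def formInChart {k : ℕ} (β : Form n k M) (x₀ : M) (y : Model n) :
    Model n [⋀^Fin k]→L[ℝ] ℝ :=
  (β ((extChartAt (𝓡 n) x₀).symm y)).compContinuousLinearMap
    ((mfderiv (𝓡 n) (𝓡 n) (extChartAt (𝓡 n) x₀).symm y).comp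
      (NormedSpace.fromTangentSpace (𝕜 := ℝ) y).symm.toContinuousLinearMap)

/-- The form `β` is of class `C^r`: so are all its expressions in charts. For `r = 0` this means
that `β` is continuous. -/
def IsFormOfClass {k : ℕ} (r : ℕ∞) (β : Form n k M) : Prop :=
  ∀ x₀ : M, ContDiffOn ℝ r (formInChart β x₀) (extChartAt (𝓡 n) x₀).target

/-- The flow `Φ` is a smooth map `ℝ × M → M`. -/
def IsSmoothFlow (n : ℕ) {M : Type*} [TopologicalSpace M] [ChartedSpace (Model n) M]
    (Φ : Flow ℝ M) : Prop :=
  ContMDiff (𝓘(ℝ, ℝ).prod (𝓡 n)) (𝓡 n) ∞ (fun p : ℝ × M => Φ p.1 p.2)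

/-- The tangent map `T_x f_t : T_x M → T_{f_t x} M` of the time `t` map of the flow. -/
noncomputable def tangentFlow (Φ : Flow ℝ M) (t : ℝ) (x : M) :
    TangentSpace (𝓡 n) x →L[ℝ] TangentSpace (𝓡 n) (Φ t x) :=
  mfderiv (𝓡 n) (𝓡 n) (fun z => Φ t z) x

/-- The pullback `f_t^* β` of a form by the time `t` map of the flow. -/
noncomputable def flowPullback {k : ℕ} (Φ : Flow ℝ M) (t : ℝ) (β : Form n k M) : Form n k M :=
  fun x => (β (Φ t x)).compContinuousLinearMap (tangentFlow Φ t x)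

/-- `X` is the infinitesimal generator of the flow `Φ`: the orbits of `Φ` are integral curves
of `X`. -/
def IsGenerator (X : (x : M) → TangentSpace (𝓡 n) x) (Φ : Flow ℝ M) : Prop :=
  ∀ x : M, IsMIntegralCurve (I := 𝓡 n) (fun t => Φ t x) X

/-- `L_X η = ξ`, where `X` is the infinitesimal generator of the flow `Φ = (f_t)`: at every point,
the derivative at `t = 0` of `f_t^* η` exists and equals `ξ`. -/
def HasLieDeriv {k : ℕ} (Φ : Flow ℝ M) (η ξ : Form n k M) : Prop :=
  ∀ (x : M) (v : Fin k → TangentSpace (𝓡 n) x),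
    HasDerivAt (fun t : ℝ => flowPullback Φ t η x v) (ξ x v) 0

/-- The center line field `E^c`, spanned by the infinitesimal generator. -/
noncomputable def centerBundle (X : (x : M) → TangentSpace (𝓡 n) x) : Distribution n M :=
  fun x => Submodule.span ℝ {X x}

/-- The center stable bundle `E^{cs} = E^c ⊕ E^{ss}`. -/
noncomputable def centerStable (X : (x : M) → TangentSpace (𝓡 n) x) (Ess : Distribution n M) :
    Distribution n M :=
  fun x => centerBundle X x ⊔ Ess x

end Basic

section Metric

variable {n : ℕ} {M : Type*} [TopologicalSpace M] [ChartedSpace (Model n) M]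
  [IsManifold (𝓡 n) ∞ M]

/-- The distribution `E` is of class `C^r`: near every point it has a frame that consists of
`C^r` vector fields. -/
def IsDistributionOfClass (r : ℕ∞) (E : Distribution n M) : Prop :=
  ∀ x₀ : M, ∃ U : Set M, IsOpen U ∧ x₀ ∈ U ∧
    ∃ (d : ℕ) (Y : Fin d → (x : M) → TangentSpace (𝓡 n) x),
      (∀ i, ContMDiffOn (𝓡 n) (𝓡 n).tangent r
        (fun x => (⟨x, Y i x⟩ : TangentBundle (𝓡 n) M)) U) ∧
      ∀ x ∈ U, LinearIndependent ℝ (fun i => Y i x) ∧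
        Submodule.span ℝ (Set.range fun i => Y i x) = E x

/-- Smooth Riemannian metrics on `M`. -/
abbrev Metric (n : ℕ) (M : Type*) [TopologicalSpace M] [ChartedSpace (Model n) M]
    [IsManifold (𝓡 n) ∞ M] : Type _ :=
  Bundle.ContMDiffRiemannianMetric (𝓡 n) ∞ (Model n) (fun x : M => TangentSpace (𝓡 n) x)

/-- The length of a tangent vector. -/
noncomputable def tangentLength (g : Metric n M) {x : M} (v : TangentSpace (𝓡 n) x) : ℝ :=
  Real.sqrt (g.inner x v v)

/-- The `m`-dimensional volume of the parallelepiped with sides `v 0, …, v (m - 1)`: the square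
root of the Gram determinant. -/
noncomputable def parallelepipedVol (g : Metric n M) {m : ℕ} {x : M}
    (v : Fin m → TangentSpace (𝓡 n) x) : ℝ :=
  Real.sqrt (Matrix.det (Matrix.of fun i j => g.inner x (v i) (v j)))

/-- The `C^0` norm of a form: the supremum over all points of its operator norm as a multilinear
map. -/
noncomputable def formSupNorm (g : Metric n M) {k : ℕ} (β : Form n k M) : ENNReal :=
  ⨆ (x : M) (v : Fin k → TangentSpace (𝓡 n) x) (_ : ∀ i, tangentLength g (v i) = 1),
    ENNReal.ofReal |β x v|

/-- The flow `Φ` with infinitesimal generator `X` is Anosov, with strong unstable bundle `Euu` and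
strong stable bundle `Ess`. -/
structure IsAnosov (g : Metric n M) (Φ : Flow ℝ M) (X : (x : M) → TangentSpace (𝓡 n) x)
    (Euu Ess : Distribution n M) : Prop where
  smooth : IsSmoothFlow n Φ
  generator : IsGenerator X Φ
  nonsingular : ∀ x, X x ≠ 0
  unstable_invariant : ∀ t x, (Euu x).map (tangentFlow (n := n) Φ t x).toLinearMap = Euu (Φ t x)
  stable_invariant : ∀ t x, (Ess x).map (tangentFlow (n := n) Φ t x).toLinearMap = Ess (Φ t x)
  splitting : ∀ x, DirectSum.IsInternal ![Euu x, centerBundle X x, Ess x]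
  stable_contracts : ∃ c > 0, ∃ ν > 0, ∀ t ≥ 0, ∀ x, ∀ v ∈ Ess x,
    tangentLength g (tangentFlow Φ t x v) ≤ c * Real.exp (-ν * t) * tangentLength g v
  unstable_expands : ∃ c > 0, ∃ lam > 0, ∀ t ≥ 0, ∀ x, ∀ w ∈ Euu x,
    c * Real.exp (lam * t) * tangentLength g w ≤ tangentLength g (tangentFlow Φ t x w)

/-- Asymmetry of an Anosov flow with strong unstable bundle `Euu`: in negative time the tangent
flow shrinks exponentially fast the volume of all `(n - 2)`-dimensional parallelepipeds with at
least one side in `Euu`. -/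
def IsAsymmetric (g : Metric n M) (Φ : Flow ℝ M) (Euu : Distribution n M) : Prop :=
  ∃ C > 0, ∃ lam > 0, ∀ t ≥ 0, ∀ x, ∀ v : Fin (n - 2) → TangentSpace (𝓡 n) x,
    (∃ i, v i ∈ Euu x) →
      parallelepipedVol g (fun i => tangentFlow Φ (-t) x (v i)) ≤ C * Real.exp (-lam * t) * parallelepipedVol g v

end Metric

end AnosovForms

/-! The equation $L_X\eta=\xi$ amounts to $\frac{d}{dt}f_t^*\eta=f_t^*\xi$ for all $t$
(`HasLieDeriv.hasDerivAt`). On tuples where $f_t^*\eta$ tends to zero as $t\to+\infty$ or as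
$t\to-\infty$, integrating gives the two formulas. Everything therefore rests on two exponential
estimates, valid for every continuous form.

Forward, on $E^{cs}$ (`IsAnosovNorm.decay_centerStable`): each image vector is a bounded multiple of
$X$ plus an exponentially small vector. An alternating form vanishes when two slots contain
multiples of $X$, so for $k\ge 2$ every surviving term has a small factor.

Backward, with a side in $E^{uu}$ (`IsAnosovNorm.decay_unstable`): the value of a form is bounded by
the volume of the parallelepiped. Asymmetry controls only volumes with $n-2$ sides, so $n-2-k$ unit
vectors of $E^{cs}$ are added. Backward time does not shrink $E^{cs}$ by more than a constant, and
the bounded invariant projection onto $E^{cs}$ keeps the image of each added side at a definite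
distance from the span of the other images; the small volume must thus come from the original sides
(`IsAnosovNorm.decay_volume`). There is room for the added sides if $\dim E^{uu}\le 3$. Asymmetry
even forces $\dim E^{uu}\le 2$ (`IsAnosovNorm.finrank_unstable_lt`): otherwise the Jacobian of
$f_{-t}$ would become uniformly small, which is impossible for diffeomorphisms of a compact
manifold.

Let $P$ be the projection onto $E^{cs}$ along $E^{uu}$. It is continuous because the bundles are
closed, and they are closed because growth rates characterize $E^{ss}$ and $E^{uu}$. Write
$\xi=\alpha+\beta$ with $\alpha=P^*\xi$. Then $\alpha$ decays forward, $\beta$ decays backward, and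
$\eta=\int_0^\infty f_{-s}^*\beta\,ds-\int_0^\infty f_s^*\alpha\,ds$ is the solution. It is unique
because the two integral formulas determine a form by multilinearity. Truncating both integrals at
$t$ gives the $C^1$ approximations; their Lie derivatives differ from $\xi$ only by the boundary
terms $f_{-t}^*\beta$ and $f_t^*\alpha$. -/

namespace AnosovForms

/-! ### Regularity of families of alternating forms. -/

section Alternating

variable {E V : Type*} [NormedAddCommGroup E] [NormedSpace ℝ E]
  [NormedAddCommGroup V] [NormedSpace ℝ V] [FiniteDimensional ℝ V] {k : ℕ}

/-- An alternating form is determined, linearly and continuously, by finitely many of its values. -/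
lemma exists_clm_leftInverse_eval (V : Type*) [NormedAddCommGroup V] [NormedSpace ℝ V]
    [FiniteDimensional ℝ V] (k : ℕ) :
    ∃ R : ((Fin k → Fin (Module.finrank ℝ V)) → ℝ) →L[ℝ] (V [⋀^Fin k]→L[ℝ] ℝ),
      ∀ β : V [⋀^Fin k]→L[ℝ] ℝ, R (fun c => β fun i => Module.finBasis ℝ V (c i)) = β := by
  let b := Module.finBasis ℝ V
  let L : (V [⋀^Fin k]→L[ℝ] ℝ) →ₗ[ℝ] ((Fin k → Fin (Module.finrank ℝ V)) → ℝ) :=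
    { toFun := fun β c => β fun i => b (c i)
      map_add' := fun _ _ => rfl
      map_smul' := fun _ _ => rfl }
  have hL : LinearMap.ker L = ⊥ := by
    rw [LinearMap.ker_eq_bot]
    intro β γ h
    apply ContinuousAlternatingMap.toAlternatingMap_injective
    apply AlternatingMap.coe_multilinearMap_injective
    refine Module.Basis.ext_multilinear (fun _ => b) fun c => ?_
    exact congrFun h c
  obtain ⟨R, hR⟩ := L.exists_leftInverse_of_injective hL
  exact ⟨LinearMap.toContinuousLinearMap R, fun β => LinearMap.congr_fun hR β⟩

/-- Finitely many values on basis tuples determine the form through a fixed continuous linear map,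
so regularity can be tested on constant tuples. -/
lemma contDiffOn_alternating {r : WithTop ℕ∞} {s : Set E} {F : E → V [⋀^Fin k]→L[ℝ] ℝ}
    (h : ∀ v, ContDiffOn ℝ r (fun y => F y v) s) : ContDiffOn ℝ r F s := by
  obtain ⟨R, hR⟩ := exists_clm_leftInverse_eval V k
  have : F = fun y => R (fun c => F y fun i => Module.finBasis ℝ V (c i)) := by
    funext y; exact (hR _).symm
  rw [this]
  exact R.contDiff.comp_contDiffOn (contDiffOn_pi.2 fun c => h _)

lemma contDiffOn_alternating_apply {r : WithTop ℕ∞} {s : Set E} {F : E → V [⋀^Fin k]→L[ℝ] ℝ}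
    (hF : ContDiffOn ℝ r F s) {w : Fin k → E → V} (hw : ∀ i, ContDiffOn ℝ r (w i) s) :
    ContDiffOn ℝ r (fun y => F y fun i => w i y) s := by
  let b := Module.finBasis ℝ V
  have key : ∀ y, F y (fun i => w i y) =
      ∑ c : Fin k → Fin (Module.finrank ℝ V),
        (∏ i, b.coord (c i) (w i y)) * F y (fun i => b (c i)) := by
    intro y
    have h1 : (fun i => w i y) = fun i => ∑ j, b.coord j (w i y) • b j := by
      funext i; exact (b.sum_repr (w i y)).symm
    conv_lhs => rw [h1]
    rw [ContinuousAlternatingMap.map_sum]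
    refine Finset.sum_congr rfl fun c _ => ?_
    rw [ContinuousAlternatingMap.map_smul_univ, smul_eq_mul]
  simp_rw [key]
  refine ContDiffOn.sum fun c _ => ContDiffOn.mul ?_ ?_
  · refine contDiffOn_prod fun i _ => ?_
    exact (LinearMap.toContinuousLinearMap (b.coord (c i))).contDiff.comp_contDiffOn (hw i)
  · exact (ContinuousAlternatingMap.apply ℝ V ℝ (fun i => b (c i))).contDiff.comp_contDiffOn hF

lemma contDiffOn_compContinuousLinearMap {W : Type*} [NormedAddCommGroup W] [NormedSpace ℝ W]
    [FiniteDimensional ℝ W] {r : WithTop ℕ∞} {s : Set E} {F : E → V [⋀^Fin k]→L[ℝ] ℝ}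
    (hF : ContDiffOn ℝ r F s) {A : E → W →L[ℝ] V} (hA : ContDiffOn ℝ r A s) :
    ContDiffOn ℝ r (fun y => (F y).compContinuousLinearMap (A y)) s :=
  contDiffOn_alternating fun v => contDiffOn_alternating_apply hF
    fun i => hA.clm_apply (contDiffOn_const (c := v i))

end Alternating

/-! ### Volumes of parallelepipeds via Gram determinants. -/

section Gram

variable {V : Type*} [NormedAddCommGroup V] [InnerProductSpace ℝ V]

/-- The volume of the parallelepiped with the given sides. -/
noncomputable def gramVol {m : ℕ} (v : Fin m → V) : ℝ := Real.sqrt (Matrix.gram ℝ v).det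

lemma gramVol_nonneg {m : ℕ} (v : Fin m → V) : 0 ≤ gramVol v := Real.sqrt_nonneg _

lemma alternating_cons_add_of_mem_span {m : ℕ} (f : V [⋀^Fin (m + 1)]→ₗ[ℝ] ℝ) (v : Fin m → V)
    {u : V} (hu : u ∈ Submodule.span ℝ (Set.range v)) (w : V) :
    f (Fin.cons (u + w) v) = f (Fin.cons w v) := by
  have h0 : f (Fin.cons u v) = 0 := by
    apply AlternatingMap.map_linearDependent
    rw [linearIndependent_finCons]
    exact fun h => h.2 hu
  have := f.toMultilinearMap.cons_add v u w
  simp only [AlternatingMap.coe_multilinearMap] at this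
  rw [this, h0, zero_add]

/-- The determinant is alternating in the rows while the columns `b` stay fixed. This permits
changing a vector on one side of the Gram matrix at a time. -/
lemma det_inner_cons_add (m : ℕ) (b : Fin (m + 1) → V) (v : Fin m → V)
    {u : V} (hu : u ∈ Submodule.span ℝ (Set.range v)) (w : V) :
    (Matrix.of fun i j => inner ℝ ((Fin.cons (u + w) v : Fin (m + 1) → V) i) (b j)).det =
    (Matrix.of fun i j => inner ℝ ((Fin.cons w v : Fin (m + 1) → V) i) (b j)).det := by
  let f : V →ₗ[ℝ] (Fin (m + 1) → ℝ) := LinearMap.pi fun j => (innerₗ V).flip (b j)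
  have := alternating_cons_add_of_mem_span (Matrix.detRowAlternating.compLinearMap f) v hu w
  exact this

/-- Take `u` to be the orthogonal projection of `w` to the span. Replacing `w` by `w - u`, in the
rows and then in the columns, preserves the determinant and makes the first row vanish off the
diagonal. -/
lemma det_gram_cons {m : ℕ} (v : Fin m → V) (w : V) :
    ∃ u ∈ Submodule.span ℝ (Set.range v), ‖w - u‖ ≤ ‖w‖ ∧
      (Matrix.gram ℝ (Fin.cons w v : Fin (m + 1) → V)).det =
        ‖w - u‖ ^ 2 * (Matrix.gram ℝ v).det := by
  set S := Submodule.span ℝ (Set.range v) with hS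
  have : FiniteDimensional ℝ S := FiniteDimensional.span_of_finite ℝ (Set.finite_range v)
  set u : V := S.starProjection w with hu
  have huS : u ∈ S := S.starProjection_apply_mem w
  set w' := w - u with hw'
  have horth : ∀ i, inner ℝ w' (v i) = 0 := by
    intro i
    have := S.sub_starProjection_mem_orthogonal w
    rw [real_inner_comm]
    exact this (v i) (Submodule.subset_span ⟨i, rfl⟩)
  have hw : w = u + w' := by simp [w']
  refine ⟨u, huS, ?_, ?_⟩
  · have h0 : inner ℝ w' u = 0 := by
      rw [real_inner_comm]; exact S.sub_starProjection_mem_orthogonal w u huS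
    have : ‖w‖ ^ 2 = ‖u‖ ^ 2 + ‖w'‖ ^ 2 := by
      rw [hw, norm_add_sq_real, real_inner_comm, h0]; ring
    have h2 := sq_nonneg ‖u‖
    exact abs_le_of_sq_le_sq' (by linarith) (norm_nonneg _) |>.2
  · have e1 : (Matrix.gram ℝ (Fin.cons w v : Fin (m + 1) → V)).det =
        (Matrix.of fun i j => inner ℝ ((Fin.cons w' v : Fin (m + 1) → V) i)
          ((Fin.cons w v : Fin (m + 1) → V) j)).det := by
      conv_lhs => rw [hw]
      rw [← det_inner_cons_add m _ v huS w', ← hw]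
      rfl
    have e2 : (Matrix.of fun i j => inner ℝ ((Fin.cons w' v : Fin (m + 1) → V) i)
          ((Fin.cons w v : Fin (m + 1) → V) j)).det =
        (Matrix.gram ℝ (Fin.cons w' v : Fin (m + 1) → V)).det := by
      have := det_inner_cons_add m (Fin.cons w' v) v huS w'
      rw [← hw] at this
      have h3 : (Matrix.gram ℝ (Fin.cons w' v : Fin (m + 1) → V)) =
        (Matrix.of fun i j => inner ℝ ((Fin.cons w' v : Fin (m + 1) → V) i)
          ((Fin.cons w' v : Fin (m + 1) → V) j)) := rfl
      rw [h3, ← this, ← Matrix.det_transpose]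
      congr 1
      ext i j
      simp [Matrix.transpose_apply, real_inner_comm]
    rw [e1, e2, Matrix.det_succ_row_zero, Fin.sum_univ_succ]
    have h4 : ∀ i : Fin m, Matrix.gram ℝ (Fin.cons w' v : Fin (m + 1) → V) 0 i.succ = 0 := by
      intro i; simp [Matrix.gram_apply, horth]
    simp only [h4]
    simp [Matrix.gram_apply]
    rfl

lemma gramVol_cons {m : ℕ} (v : Fin m → V) (w : V) :
    ∃ u ∈ Submodule.span ℝ (Set.range v), ‖w - u‖ ≤ ‖w‖ ∧
      gramVol (Fin.cons w v : Fin (m + 1) → V) = ‖w - u‖ * gramVol v := by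
  obtain ⟨u, hu, h1, h2⟩ := det_gram_cons v w
  refine ⟨u, hu, h1, ?_⟩
  rw [gramVol, h2, Real.sqrt_mul (sq_nonneg _), Real.sqrt_sq (norm_nonneg _), gramVol]

lemma gramVol_cons_le {m : ℕ} (v : Fin m → V) (w : V) :
    gramVol (Fin.cons w v : Fin (m + 1) → V) ≤ ‖w‖ * gramVol v := by
  obtain ⟨u, _, h1, h2⟩ := gramVol_cons v w
  rw [h2]
  exact mul_le_mul_of_nonneg_right h1 (gramVol_nonneg v)

lemma le_gramVol_cons {m : ℕ} (v : Fin m → V) (w : V) {c : ℝ}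
    (h : ∀ u ∈ Submodule.span ℝ (Set.range v), c ≤ ‖w - u‖) :
    c * gramVol v ≤ gramVol (Fin.cons w v : Fin (m + 1) → V) := by
  obtain ⟨u, hu, _, h2⟩ := gramVol_cons v w
  rw [h2]
  exact mul_le_mul_of_nonneg_right (h u hu) (gramVol_nonneg v)

/-- Hadamard's inequality. -/
lemma gramVol_le_prod {m : ℕ} (v : Fin m → V) : gramVol v ≤ ∏ i, ‖v i‖ := by
  induction m with
  | zero => simp [gramVol]
  | succ m ih =>
    rw [← Fin.cons_self_tail v, Fin.prod_univ_succ]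
    refine (gramVol_cons_le _ _).trans ?_
    simp only [Fin.cons_zero, Fin.cons_succ]
    exact mul_le_mul_of_nonneg_left (ih _) (norm_nonneg _)

lemma gramVol_eq_abs_det {m : ℕ} (b : OrthonormalBasis (Fin m) ℝ V) (v : Fin m → V) :
    gramVol v = |b.toBasis.det v| := by
  rw [gramVol, Matrix.gram_eq_conjTranspose_mul b v, Matrix.det_mul, Module.Basis.det_apply,
    Matrix.det_conjTranspose, ← Real.sqrt_sq_eq_abs]
  have h : (Matrix.of fun i j => (b.repr (v j)).ofLp i) = b.toBasis.toMatrix v := by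
    ext i j
    simp [Module.Basis.toMatrix_apply]
  rw [h]
  simp [sq]

/-- In dimension `m`, the pullback of the determinant under `A` is a multiple of the determinant,
and its value at an orthonormal basis is the factor. -/
lemma gramVol_map {V' : Type*} [NormedAddCommGroup V'] [InnerProductSpace ℝ V'] {m : ℕ}
    (b : OrthonormalBasis (Fin m) ℝ V) (b' : OrthonormalBasis (Fin m) ℝ V') (A : V →ₗ[ℝ] V')
    (v : Fin m → V) : gramVol (fun i => A (v i)) = gramVol (fun i => A (b i)) * gramVol v := by
  rw [gramVol_eq_abs_det b', gramVol_eq_abs_det b', gramVol_eq_abs_det b, ← abs_mul]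
  congr 1
  have := AlternatingMap.eq_smul_basis_det b.toBasis (b'.toBasis.det.compLinearMap A)
  have h2 := DFunLike.congr_fun this v
  simp only [AlternatingMap.compLinearMap_apply, AlternatingMap.smul_apply, smul_eq_mul,
    OrthonormalBasis.coe_toBasis] at h2
  exact h2

/-- On the span of independent sides, `β` equals its value at an orthonormal basis times the
determinant. The first factor is at most the operator norm, and the second is the volume up to sign.
-/
lemma abs_alternating_le_gramVol {m : ℕ} (β : V [⋀^Fin m]→L[ℝ] ℝ) (v : Fin m → V) :
    |β v| ≤ ‖β‖ * gramVol v := by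
  by_cases hv : LinearIndependent ℝ v
  swap
  · have : β v = 0 := β.toAlternatingMap.map_linearDependent v hv
    rw [this, abs_zero]
    exact mul_nonneg (norm_nonneg _) (gramVol_nonneg _)
  set S := Submodule.span ℝ (Set.range v) with hS
  have : FiniteDimensional ℝ S := FiniteDimensional.span_of_finite ℝ (Set.finite_range v)
  have hdim : Module.finrank ℝ S = m := by
    rw [hS, finrank_span_eq_card hv, Fintype.card_fin]
  let e : OrthonormalBasis (Fin m) ℝ S := (stdOrthonormalBasis ℝ S).reindex (finCongr hdim)
  let v' : Fin m → S := fun i => ⟨v i, Submodule.subset_span ⟨i, rfl⟩⟩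
  have h1 := DFunLike.congr_fun (AlternatingMap.eq_smul_basis_det e.toBasis
    (β.toAlternatingMap.compLinearMap S.subtype)) v'
  have h2 : β v = β (fun i => (e i : V)) * e.toBasis.det v' := by
    simpa [v'] using h1
  have h3 : gramVol v = gramVol v' := rfl
  rw [h2, abs_mul, h3, gramVol_eq_abs_det e]
  refine mul_le_mul_of_nonneg_right ?_ (abs_nonneg _)
  refine (β.le_opNorm _).trans ?_
  have : ∀ i, ‖(e i : V)‖ = 1 := fun i => e.norm_eq_one i
  simp [this]

variable [FiniteDimensional ℝ V]

lemma exists_unit_mem_orthogonal (H S : Submodule ℝ V)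
    (h : Module.finrank ℝ S < Module.finrank ℝ H) : ∃ w ∈ H, ‖w‖ = 1 ∧ w ∈ Sᗮ := by
  have h1 := Submodule.finrank_add_finrank_orthogonal S
  have h2 := Submodule.finrank_sup_add_finrank_inf_eq H Sᗮ
  have h3 := Submodule.finrank_le (H ⊔ Sᗮ)
  have h4 : H ⊓ Sᗮ ≠ ⊥ := by
    intro h0
    rw [h0, finrank_bot] at h2
    omega
  obtain ⟨x, hx, hx0⟩ := Submodule.exists_mem_ne_zero_of_ne_bot h4
  refine ⟨(‖x‖⁻¹ : ℝ) • x, H.smul_mem _ hx.1, ?_, Sᗮ.smul_mem _ hx.2⟩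
  rw [norm_smul, norm_inv, norm_norm, inv_mul_cancel₀ (norm_ne_zero_iff.2 hx0)]

lemma exists_orthonormalBasis_three_mem {m : ℕ} (hm : Module.finrank ℝ V = m + 3)
    (H : Submodule ℝ V) (hH : 3 ≤ Module.finrank ℝ H) :
    ∃ b : OrthonormalBasis (Fin (m + 3)) ℝ V, b 0 ∈ H ∧ b 1 ∈ H ∧ b 2 ∈ H := by
  let e := stdOrthonormalBasis ℝ H
  -- Only the indices below 3 matter; the value 0 at the others is a filler that the restriction to
  -- `s` discards.
  let c : Fin (m + 3) → Fin (Module.finrank ℝ H) := fun i =>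
    if h : (i : ℕ) < 3 then ⟨i, by omega⟩ else ⟨0, by omega⟩
  let v : Fin (m + 3) → V := fun i => (e (c i) : V)
  let s : Set (Fin (m + 3)) := {i | (i : ℕ) < 3}
  have hv : Orthonormal ℝ (s.domRestrict v) := by
    have h1 : Orthonormal ℝ (fun j => (e j : V)) := e.orthonormal.comp_linearIsometry H.subtypeₗᵢ
    refine h1.comp (fun i : s => c i) ?_
    rintro ⟨i, hi⟩ ⟨j, hj⟩ hij
    simp only [s, Set.mem_ofPred_eq] at hi hj
    simp only [c, hi, hj, dif_pos, Fin.mk.injEq] at hij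
    exact Subtype.ext (Fin.ext hij)
  obtain ⟨b, hb⟩ := hv.exists_orthonormalBasis_extension_of_card_eq (by simpa using hm)
  have hmem : ∀ i ∈ s, b i ∈ H := fun i hi => by rw [hb i hi]; exact (e (c i)).2
  refine ⟨b, hmem 0 (by simp [s]), hmem 1 ?_, hmem 2 ?_⟩
  · simp [s]
  · change ((2 : Fin (m + 3)) : ℕ) < 3
    rw [Fin.val_two]
    norm_num

end Gram

end AnosovForms

namespace AnosovForms

/-! ### Closed families of subspaces and continuity of projections. -/

section ClosedFamily

open Filter

variable {Y V : Type*} [TopologicalSpace Y] [NormedAddCommGroup V] [NormedSpace ℝ V]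

/-- The family of subspaces `A` is closed at the point `y₀` of the base. -/
def IsClosedFamilyAt (A : Y → Submodule ℝ V) (y₀ : Y) : Prop :=
  ∀ l : Ultrafilter Y, ↑l ≤ 𝓝 y₀ → ∀ (w : Y → V) (w₀ : V), (∀ᶠ y in l, w y ∈ A y) →
    Tendsto w l (𝓝 w₀) → w₀ ∈ A y₀

variable [FiniteDimensional ℝ V]

/-- Components along two transverse closed families of subspaces converge. -/
lemma IsClosedFamilyAt.tendsto_component {A B : Y → Submodule ℝ V} {y₀ : Y}
    (hA : IsClosedFamilyAt A y₀) (hB : IsClosedFamilyAt B y₀) (hd : Disjoint (A y₀) (B y₀))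
    {l : Ultrafilter Y} (hl : ↑l ≤ 𝓝 y₀) {w a : Y → V} {w₀ : V} (hw : Tendsto w l (𝓝 w₀))
    (ha : ∀ᶠ y in l, a y ∈ A y) (hb : ∀ᶠ y in l, w y - a y ∈ B y) :
    ∃ a₀ ∈ A y₀, w₀ - a₀ ∈ B y₀ ∧ Tendsto a l (𝓝 a₀) := by
  have hpos : ∀ y, 0 < 1 + ‖a y‖ := fun y => by positivity
  -- No bound on `a` is known in advance. After rescaling, `ρ` and `z = ρ a` lie in compact sets, so
  -- both converge along the ultrafilter.
  set ρ : Y → ℝ := fun y => (1 + ‖a y‖)⁻¹ with hρ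
  set z : Y → V := fun y => ρ y • a y with hz
  have hρ1 : ∀ y, ρ y ∈ Set.Icc (0 : ℝ) 1 := fun y =>
    ⟨by positivity, inv_le_one_of_one_le₀ (by linarith [norm_nonneg (a y)])⟩
  have hzn : ∀ y, ‖z y‖ = 1 - ρ y := by
    intro y
    have := (hpos y).ne'
    simp only [hz, hρ, norm_smul, norm_inv, Real.norm_of_nonneg (hpos y).le]
    field_simp
    ring
  have hz1 : ∀ y, z y ∈ Metric.closedBall (0 : V) 1 := fun y => by
    rw [mem_closedBall_zero_iff, hzn]; linarith [(hρ1 y).1]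
  obtain ⟨r, -, hr⟩ : ∃ r ∈ Set.Icc (0 : ℝ) 1, Tendsto ρ l (𝓝 r) :=
    isCompact_Icc.ultrafilter_le_nhds (l.map ρ)
      (le_principal_iff.2 (Filter.mem_map.2 (Eventually.of_forall hρ1)))
  obtain ⟨z₀, -, hz₀⟩ : ∃ z₀ ∈ Metric.closedBall (0 : V) 1, Tendsto z l (𝓝 z₀) :=
    (isCompact_closedBall (0 : V) 1).ultrafilter_le_nhds (l.map z)
      (le_principal_iff.2 (Filter.mem_map.2 (Eventually.of_forall hz1)))
  have hzA : z₀ ∈ A y₀ := hA l hl z z₀ (ha.mono fun y hy => (A y).smul_mem _ hy) hz₀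
  have hzB : r • w₀ - z₀ ∈ B y₀ := by
    refine hB l hl (fun y => ρ y • w y - z y) _ (hb.mono fun y hy => ?_) ((hr.smul hw).sub hz₀)
    simp only [hz]
    rw [← smul_sub]
    exact (B y).smul_mem _ hy
  have hsum : ‖z₀‖ = 1 - r := by
    refine tendsto_nhds_unique hz₀.norm ?_
    simp_rw [hzn]
    exact tendsto_const_nhds.sub hr
  -- If `ρ` tended to 0, the limit of `z` would be a unit vector common to `A y₀` and `B y₀`.
  have hr0 : r ≠ 0 := by
    rintro rfl
    have h1 : z₀ ∈ B y₀ := by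
      rw [zero_smul, zero_sub] at hzB
      exact (B y₀).neg_mem_iff.1 hzB
    have h2 := (Submodule.disjoint_def.1 hd) z₀ hzA h1
    rw [h2, norm_zero] at hsum
    norm_num at hsum
  refine ⟨r⁻¹ • z₀, (A y₀).smul_mem _ hzA, ?_, ?_⟩
  · have := (B y₀).smul_mem r⁻¹ hzB
    rwa [smul_sub, inv_smul_smul₀ hr0] at this
  · have : a = fun y => (ρ y)⁻¹ • z y := by
      funext y
      have := (hpos y).ne'
      simp only [hz, hρ]
      rw [inv_smul_smul₀ (inv_ne_zero this)]
    rw [this]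
    exact (hr.inv₀ hr0).smul hz₀

lemma IsClosedFamilyAt.sup {A B : Y → Submodule ℝ V} {y₀ : Y}
    (hA : IsClosedFamilyAt A y₀) (hB : IsClosedFamilyAt B y₀) (hd : Disjoint (A y₀) (B y₀)) :
    IsClosedFamilyAt (fun y => A y ⊔ B y) y₀ := by
  intro l hl w w₀ hw hlim
  have : ∀ y, ∃ a, w y ∈ A y ⊔ B y → a ∈ A y ∧ w y - a ∈ B y := by
    intro y
    by_cases h : w y ∈ A y ⊔ B y
    · obtain ⟨a, ha, b, hb, hab⟩ := Submodule.mem_sup.1 h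
      exact ⟨a, fun _ => ⟨ha, by rw [← hab]; simpa using hb⟩⟩
    · exact ⟨0, fun h' => absurd h' h⟩
  choose a ha using this
  obtain ⟨a₀, h1, h2, -⟩ := hA.tendsto_component hB hd hl hlim
    (hw.mono fun y hy => (ha y hy).1) (hw.mono fun y hy => (ha y hy).2)
  exact Submodule.mem_sup.2 ⟨a₀, h1, _, h2, by abel⟩

/-- The projections along a pair of complementary closed families of subspaces are continuous. -/
lemma continuousOn_projection {A B : Y → Submodule ℝ V} {s : Set Y} (hs : IsOpen s)
    (hA : ∀ y ∈ s, IsClosedFamilyAt A y) (hB : ∀ y ∈ s, IsClosedFamilyAt B y)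
    (hd : ∀ y ∈ s, Disjoint (A y) (B y)) {P : Y → V →L[ℝ] V}
    (hPA : ∀ y ∈ s, ∀ w, P y w ∈ A y) (hPB : ∀ y ∈ s, ∀ w, w - P y w ∈ B y) :
    ContinuousOn P s := by
  rw [continuousOn_clm_apply]
  intro w y₀ hy₀
  refine ContinuousAt.continuousWithinAt ?_
  rw [ContinuousAt, tendsto_iff_ultrafilter]
  intro l hl
  have hs' : ∀ᶠ y in l, y ∈ s := hl (hs.mem_nhds hy₀)
  obtain ⟨a₀, h1, h2, h3⟩ := (hA y₀ hy₀).tendsto_component (hB y₀ hy₀) (hd y₀ hy₀) hl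
    (tendsto_const_nhds (x := w)) (a := fun y => P y w) (hs'.mono fun y hy => hPA y hy w)
    (hs'.mono fun y hy => hPB y hy w)
  have : a₀ = P y₀ w := by
    have h4 : a₀ - P y₀ w ∈ B y₀ := by
      have := (B y₀).sub_mem (hPB y₀ hy₀ w) h2
      simpa using this
    have := (Submodule.disjoint_def.1 (hd y₀ hy₀)) _ ((A y₀).sub_mem h1 (hPA y₀ hy₀ w)) h4
    exact sub_eq_zero.1 this
  rw [← this]
  exact h3

end ClosedFamily

/-! ### Integrals over compact intervals that depend on a parameter. -/

section ParametricIntegral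

open MeasureTheory

lemma continuous_slice_of_continuousOn {Y W : Type*} [TopologicalSpace Y] [TopologicalSpace W]
    {H : ℝ × Y → W} {s : Set Y} (hH : ContinuousOn H (Set.univ ×ˢ s)) {y : Y} (hy : y ∈ s) :
    Continuous fun t => H (t, y) :=
  hH.comp_continuous (by fun_prop) fun _ => ⟨trivial, hy⟩

lemma continuousOn_parametric_integral {E G : Type*} [NormedAddCommGroup E]
    [NormedAddCommGroup G] [NormedSpace ℝ G] {F : ℝ × E → G} {s : Set E}
    (hF : ContinuousOn F (Set.univ ×ˢ s)) (a b : ℝ) :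
    ContinuousOn (fun y => ∫ t in a..b, F (t, y)) s := by
  rw [continuousOn_iff_continuous_domRestrict]
  have : Continuous (Function.uncurry fun (y : s) (t : ℝ) => F (t, (y : E))) :=
    hF.comp_continuous (by fun_prop) fun p => ⟨trivial, p.1.2⟩
  exact intervalIntegral.continuous_parametric_intervalIntegral_of_continuous' this a b

lemma contDiffOn_one_parametric_integral {E G : Type*} [NormedAddCommGroup E] [NormedSpace ℝ E]
    [FiniteDimensional ℝ E] [NormedAddCommGroup G] [NormedSpace ℝ G] {F : ℝ × E → G} {s : Set E} (hs : IsOpen s)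
    (hF : ContDiffOn ℝ 1 F (Set.univ ×ˢ s)) (a b : ℝ) :
    ContDiffOn ℝ 1 (fun y => ∫ t in a..b, F (t, y)) s := by
  have hop : IsOpen ((Set.univ : Set ℝ) ×ˢ s) := isOpen_univ.prod hs
  set F' : ℝ × E → E →L[ℝ] G := fun p => (fderiv ℝ F p).comp (ContinuousLinearMap.inr ℝ ℝ E)
  have hF' : ContinuousOn F' (Set.univ ×ˢ s) :=
    ((hF.continuousOn_fderiv_of_isOpen hop le_rfl).clm_comp continuousOn_const)
  have hder : ∀ y ∈ s, HasFDerivAt (fun y => ∫ t in a..b, F (t, y))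
      (∫ t in a..b, F' (t, y)) y := by
    intro y hy
    obtain ⟨ε, hε, hball⟩ := Metric.isOpen_iff.1 hs y hy
    have hsub : Metric.closedBall y (ε / 2) ⊆ s :=
      (Metric.closedBall_subset_ball (by linarith)).trans hball
    -- Continuity of the partial derivative on a compact product gives a constant dominating
    -- function for differentiation under the integral.
    obtain ⟨K, hK⟩ := (isCompact_uIcc.prod (isCompact_closedBall y (ε / 2))).exists_bound_of_continuousOn
      (hF'.mono (Set.prod_mono (Set.subset_univ (Set.uIcc a b)) hsub))
    refine intervalIntegral.hasFDerivAt_integral_of_dominated_of_fderiv_le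
      (F := fun y t => F (t, y)) (F' := fun y t => F' (t, y)) (bound := fun _ => K)
      (Metric.closedBall_mem_nhds y (by linarith : 0 < ε / 2)) ?_ ?_ ?_ ?_ ?_ ?_
    · filter_upwards [hs.mem_nhds hy] with z hz
      exact (continuous_slice_of_continuousOn hF.continuousOn hz).aestronglyMeasurable
    · exact (continuous_slice_of_continuousOn hF.continuousOn hy).intervalIntegrable _ _
    · exact (continuous_slice_of_continuousOn hF' hy).aestronglyMeasurable
    · refine Filter.Eventually.of_forall fun t ht z hz => ?_
      exact hK (t, z) ⟨Set.uIoc_subset_uIcc ht, hz⟩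
    · exact intervalIntegrable_const
    · refine Filter.Eventually.of_forall fun t _ z hz => ?_
      have h1 : HasFDerivAt F (fderiv ℝ F (t, z)) (t, z) :=
        ((hF.differentiableOn one_ne_zero).differentiableAt
          (hop.mem_nhds ⟨trivial, hsub hz⟩)).hasFDerivAt
      exact h1.comp z (hasFDerivAt_prodMk_right t z)
  have h1 : (1 : WithTop ℕ∞) = 0 + 1 := by norm_num
  rw [h1, contDiffOn_succ_iff_fderiv_of_isOpen hs]
  refine ⟨fun y hy => (hder y hy).differentiableAt.differentiableWithinAt, by simp, ?_⟩
  rw [contDiffOn_zero]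
  exact (continuousOn_parametric_integral hF' a b).congr fun y hy => (hder y hy).fderiv

end ParametricIntegral

end AnosovForms

namespace AnosovForms

/-! ### Frames of the tangent bundle and forms in charts. -/

section Charts

open Bundle

variable {n : ℕ} {M : Type*} [TopologicalSpace M] [ChartedSpace (Model n) M]
  [IsManifold (𝓡 n) ∞ M]

/-- The frame of `T_x M` given by the preferred chart at `x₀`. -/
noncomputable def frameAt (x₀ x : M) : Model n →L[ℝ] TangentSpace (𝓡 n) x :=
  (trivializationAt (Model n) (TangentSpace (𝓡 n) : M → Type _) x₀).symmL ℝ x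

/-- The coordinates of the vectors of `T_x M` in the frame `frameAt x₀ x`. -/
noncomputable def coordAt (x₀ x : M) : TangentSpace (𝓡 n) x →L[ℝ] Model n :=
  (trivializationAt (Model n) (TangentSpace (𝓡 n) : M → Type _) x₀).continuousLinearMapAt ℝ x

lemma coordAt_frameAt {x₀ x : M} (hx : x ∈ (extChartAt (𝓡 n) x₀).source) (w : Model n) :
    coordAt x₀ x (frameAt x₀ x w) = w :=
  Trivialization.continuousLinearMapAt_symmL _ (by simpa using hx) w

lemma frameAt_coordAt {x₀ x : M} (hx : x ∈ (extChartAt (𝓡 n) x₀).source)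
    (v : TangentSpace (𝓡 n) x) : frameAt x₀ x (coordAt x₀ x v) = v :=
  Trivialization.symmL_continuousLinearMapAt _ (by simpa using hx) v

lemma coordAt_eq_mfderiv {x₀ x : M} (hx : x ∈ (extChartAt (𝓡 n) x₀).source) :
    coordAt x₀ x = mfderiv (𝓡 n) 𝓘(ℝ, Model n) (extChartAt (𝓡 n) x₀) x :=
  TangentBundle.continuousLinearMapAt_trivializationAt (by simpa using hx)

/-- This reconciles two descriptions of the coordinate frame: the derivative of the inverse chart,
which defines `formInChart`, and the bundle trivialization, in which continuity and norm bounds are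
available. -/
lemma mfderiv_extChartAt_symm {x₀ : M} {y : Model n} (hy : y ∈ (extChartAt (𝓡 n) x₀).target)
    (w : Model n) :
    mfderiv 𝓘(ℝ, Model n) (𝓡 n) (extChartAt (𝓡 n) x₀).symm y w =
      frameAt x₀ ((extChartAt (𝓡 n) x₀).symm y) w := by
  have hx : (extChartAt (𝓡 n) x₀).symm y ∈ (extChartAt (𝓡 n) x₀).source :=
    (extChartAt (𝓡 n) x₀).map_target hy
  have h1 := mfderiv_extChartAt_comp_mfderivWithin_extChartAt_symm (I := 𝓡 n) hy
  have h2 : Set.range (𝓡 n) = Set.univ := (𝓡 n).range_eq_univ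
  rw [h2, mfderivWithin_univ] at h1
  have h3 : coordAt x₀ _ (mfderiv 𝓘(ℝ, Model n) (𝓡 n) (extChartAt (𝓡 n) x₀).symm y w) = w := by
    rw [coordAt_eq_mfderiv hx]
    exact DFunLike.congr_fun h1 w
  rw [← frameAt_coordAt hx (mfderiv 𝓘(ℝ, Model n) (𝓡 n) (extChartAt (𝓡 n) x₀).symm y w), h3]

lemma mdifferentiableAt_extChartAt_symm {x₀ : M} {y : Model n}
    (hy : y ∈ (extChartAt (𝓡 n) x₀).target) :
    MDifferentiableAt 𝓘(ℝ, Model n) (𝓡 n) (extChartAt (𝓡 n) x₀).symm y := by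
  have := mdifferentiableWithinAt_extChartAt_symm (I := 𝓡 n) hy
  rwa [(𝓡 n).range_eq_univ, mdifferentiableWithinAt_univ] at this

/-- The form `β` at `x`, in the frame `frameAt x₀ x`. -/
noncomputable def formLocal {k : ℕ} (β : Form n k M) (x₀ x : M) : Model n [⋀^Fin k]→L[ℝ] ℝ :=
  (β x).compContinuousLinearMap (frameAt x₀ x)

lemma formLocal_apply {k : ℕ} (β : Form n k M) (x₀ x : M) (w : Fin k → Model n) :
    formLocal β x₀ x w = β x (fun i => frameAt x₀ x (w i)) := rfl

lemma formInChart_eq {k : ℕ} (β : Form n k M) {x₀ : M} {y : Model n}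
    (hy : y ∈ (extChartAt (𝓡 n) x₀).target) :
    formInChart β x₀ y = formLocal β x₀ ((extChartAt (𝓡 n) x₀).symm y) := by
  ext w
  rw [formLocal_apply]
  change β _ (fun i => mfderiv 𝓘(ℝ, Model n) (𝓡 n) (extChartAt (𝓡 n) x₀).symm y (w i)) = _
  congr 1
  funext i
  exact mfderiv_extChartAt_symm hy (w i)

lemma isFormOfClass_iff {k : ℕ} (r : ℕ∞) (β : Form n k M) :
    IsFormOfClass r β ↔ ∀ x₀ : M, ContDiffOn ℝ r
      (fun y => formLocal β x₀ ((extChartAt (𝓡 n) x₀).symm y)) (extChartAt (𝓡 n) x₀).target :=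
  forall_congr' fun _ => contDiffOn_congr fun _ hy => formInChart_eq β hy

lemma apply_eq_formLocal {k : ℕ} (β : Form n k M) {x₀ x : M}
    (hx : x ∈ (extChartAt (𝓡 n) x₀).source) (v : Fin k → TangentSpace (𝓡 n) x) :
    β x v = formLocal β x₀ x (fun i => coordAt x₀ x (v i)) := by
  rw [formLocal_apply]
  congr 1
  funext i
  exact (frameAt_coordAt hx _).symm

lemma IsFormOfClass.continuousOn_formLocal {k : ℕ} {β : Form n k M} (hβ : IsFormOfClass 0 β)
    (x₀ : M) : ContinuousOn (formLocal β x₀) (extChartAt (𝓡 n) x₀).source := by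
  have h1 := ((isFormOfClass_iff 0 β).1 hβ x₀).continuousOn
  refine (h1.comp (continuousOn_extChartAt x₀) (extChartAt (𝓡 n) x₀).mapsTo).congr ?_
  intro x hx
  simp only [Function.comp_apply]
  rw [(extChartAt (𝓡 n) x₀).left_inv hx]

lemma continuousOn_mk_frameAt (x₀ : M) :
    ContinuousOn (fun p : M × Model n =>
      (⟨p.1, frameAt x₀ p.1 p.2⟩ : TangentBundle (𝓡 n) M))
      ((extChartAt (𝓡 n) x₀).source ×ˢ Set.univ) := by
  let e := trivializationAt (Model n) (TangentSpace (𝓡 n) : M → Type _) x₀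
  have hsrc : e.baseSet = (extChartAt (𝓡 n) x₀).source := by simp [e]
  have h1 := e.continuousOn_symm
  rw [hsrc] at h1
  refine h1.congr fun p hp => ?_
  have hb : p.1 ∈ e.baseSet := hsrc ▸ hp.1
  congr 1
  exact e.symmL_apply hb p.2

lemma contDiffOn_coordAt {r : ℕ∞} {Y : (x : M) → TangentSpace (𝓡 n) x} {U : Set M}
    (hU : IsOpen U) (hY : ContMDiffOn (𝓡 n) (𝓡 n).tangent r
      (fun x => (⟨x, Y x⟩ : TangentBundle (𝓡 n) M)) U) (x₀ : M) :
    ContDiffOn ℝ r (fun y => coordAt x₀ ((extChartAt (𝓡 n) x₀).symm y)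
        (Y ((extChartAt (𝓡 n) x₀).symm y)))
      ((extChartAt (𝓡 n) x₀).target ∩ (extChartAt (𝓡 n) x₀).symm ⁻¹' U) := by
  let e := trivializationAt (Model n) (TangentSpace (𝓡 n) : M → Type _) x₀
  have hsrc : e.baseSet = (extChartAt (𝓡 n) x₀).source := by simp [e]
  have h1 := (e.contMDiffOn_section_iff (IB := 𝓡 n) (n := r) (s := Y)
    (hU.inter e.open_baseSet) Set.inter_subset_right).1 (hY.mono Set.inter_subset_left)
  have h2 : ContMDiffOn 𝓘(ℝ, Model n) (𝓡 n) r (extChartAt (𝓡 n) x₀).symm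
      ((extChartAt (𝓡 n) x₀).target ∩ (extChartAt (𝓡 n) x₀).symm ⁻¹' U) :=
    (contMDiffOn_extChartAt_symm x₀).mono Set.inter_subset_left
  have h3 := h1.comp h2 (fun y hy =>
      ⟨hy.2, by rw [hsrc]; exact (extChartAt (𝓡 n) x₀).map_target hy.1⟩)
  refine (contMDiffOn_iff_contDiffOn.1 h3).congr fun y hy => ?_
  have hb : (extChartAt (𝓡 n) x₀).symm y ∈ e.baseSet := by
    rw [hsrc]
    exact (extChartAt (𝓡 n) x₀).map_target hy.1
  exact e.continuousLinearMapAt_apply_of_mem ℝ hb _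

end Charts

/-! ### The flow and its derivative in charts. -/

section Flow

open Bundle

variable {n : ℕ} {M : Type*} [TopologicalSpace M] [ChartedSpace (Model n) M] {Φ : Flow ℝ M}

/-- The flow in the preferred charts at `x₀` and `x₁`. -/
noncomputable def flowInCharts (Φ : Flow ℝ M) (x₀ x₁ : M) (p : ℝ × Model n) : Model n :=
  extChartAt (𝓡 n) x₁ (Φ p.1 ((extChartAt (𝓡 n) x₀).symm p.2))

/-- The domain of `flowInCharts`. -/
def flowInChartsDomain (Φ : Flow ℝ M) (x₀ x₁ : M) : Set (ℝ × Model n) :=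
  {p | p.2 ∈ (extChartAt (𝓡 n) x₀).target ∧
    Φ p.1 ((extChartAt (𝓡 n) x₀).symm p.2) ∈ (extChartAt (𝓡 n) x₁).source}

lemma isOpen_flowInChartsDomain (Φ : Flow ℝ M) (x₀ x₁ : M) :
    IsOpen (flowInChartsDomain (n := n) Φ x₀ x₁) := by
  have h1 : ContinuousOn (fun p : ℝ × Model n => Φ p.1 ((extChartAt (𝓡 n) x₀).symm p.2))
      (Set.univ ×ˢ (extChartAt (𝓡 n) x₀).target) := by
    have h2 : ContinuousOn (fun p : ℝ × Model n => (extChartAt (𝓡 n) x₀).symm p.2)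
        (Set.univ ×ˢ (extChartAt (𝓡 n) x₀).target) :=
      (continuousOn_extChartAt_symm x₀).comp continuousOn_snd fun p hp => hp.2
    exact Φ.cont'.comp_continuousOn (continuousOn_fst.prodMk h2)
  have h3 := h1.isOpen_inter_preimage (isOpen_univ.prod (isOpen_extChartAt_target x₀))
    (isOpen_extChartAt_source (I := 𝓡 n) x₁)
  convert h3 using 1
  ext p
  simp [flowInChartsDomain]

lemma IsSmoothFlow.mdifferentiableAt (hΦ : IsSmoothFlow n Φ) (t : ℝ) (x : M) :
    MDifferentiableAt (𝓡 n) (𝓡 n) (fun z => Φ t z) x := by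
  have h1 : ContMDiff (𝓡 n) (𝓡 n) ∞ (fun z => Φ t z) :=
    ContMDiff.comp (g := fun p : ℝ × M => Φ p.1 p.2) hΦ (contMDiff_const.prodMk contMDiff_id)
  exact h1.mdifferentiable (by simp) x

variable [IsManifold (𝓡 n) ∞ M]

lemma contDiffOn_flowInCharts (hΦ : IsSmoothFlow n Φ) (x₀ x₁ : M) :
    ContDiffOn ℝ ∞ (flowInCharts Φ x₀ x₁) (flowInChartsDomain (n := n) Φ x₀ x₁) := by
  have h1 : ContMDiffOn (𝓘(ℝ, ℝ).prod 𝓘(ℝ, Model n)) (𝓡 n) ∞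
      (fun p : ℝ × Model n => Φ p.1 ((extChartAt (𝓡 n) x₀).symm p.2))
      (flowInChartsDomain (n := n) Φ x₀ x₁) := by
    have h2 : ContMDiffOn (𝓘(ℝ, ℝ).prod 𝓘(ℝ, Model n)) (𝓡 n) ∞
        (fun p : ℝ × Model n => (extChartAt (𝓡 n) x₀).symm p.2)
        (flowInChartsDomain (n := n) Φ x₀ x₁) :=
      (contMDiffOn_extChartAt_symm x₀).comp contMDiff_snd.contMDiffOn fun p hp => hp.1
    exact hΦ.comp_contMDiffOn (contMDiff_fst.contMDiffOn.prodMk h2)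
  have h3 : ContMDiffOn (𝓘(ℝ, ℝ).prod 𝓘(ℝ, Model n)) 𝓘(ℝ, Model n) ∞ (flowInCharts Φ x₀ x₁)
      (flowInChartsDomain (n := n) Φ x₀ x₁) :=
    contMDiffOn_extChartAt.comp h1 fun p hp => by
      have := hp.2
      simpa using this
  rw [← modelWithCornersSelf_prod, chartedSpaceSelf_prod] at h3
  exact contMDiffOn_iff_contDiffOn.1 h3

/-- The derivative of the flow in charts with respect to the point. -/
noncomputable def flowDerivInCharts (Φ : Flow ℝ M) (x₀ x₁ : M) (p : ℝ × Model n) :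
    Model n →L[ℝ] Model n :=
  (fderiv ℝ (flowInCharts Φ x₀ x₁) p).comp (ContinuousLinearMap.inr ℝ ℝ (Model n))

lemma contDiffOn_flowDerivInCharts (hΦ : IsSmoothFlow n Φ) (x₀ x₁ : M) :
    ContDiffOn ℝ ∞ (flowDerivInCharts Φ x₀ x₁) (flowInChartsDomain (n := n) Φ x₀ x₁) :=
  ((contDiffOn_flowInCharts hΦ x₀ x₁).fderiv_of_isOpen (isOpen_flowInChartsDomain Φ x₀ x₁)
    (by simp)).clm_comp contDiffOn_const

lemma hasFDerivAt_flowInCharts (hΦ : IsSmoothFlow n Φ) {x₀ x₁ : M} {t : ℝ} {y : Model n}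
    (hp : (t, y) ∈ flowInChartsDomain (n := n) Φ x₀ x₁) :
    HasFDerivAt (fun z => flowInCharts Φ x₀ x₁ (t, z)) (flowDerivInCharts Φ x₀ x₁ (t, y)) y := by
  have h1 : HasFDerivAt (flowInCharts Φ x₀ x₁) (fderiv ℝ (flowInCharts Φ x₀ x₁) (t, y)) (t, y) :=
    (((contDiffOn_flowInCharts hΦ x₀ x₁).differentiableOn (by simp)).differentiableAt
      ((isOpen_flowInChartsDomain Φ x₀ x₁).mem_nhds hp)).hasFDerivAt
  exact h1.comp y (hasFDerivAt_prodMk_right t y)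

/-- By the chain rule for the second chart, the time `t` map and the inverse of the first chart, the
spatial derivative in charts is the matrix of the tangent flow. -/
lemma tangentFlow_frameAt (hΦ : IsSmoothFlow n Φ) {x₀ x₁ : M} {t : ℝ} {y : Model n}
    (hp : (t, y) ∈ flowInChartsDomain (n := n) Φ x₀ x₁) (w : Model n) :
    tangentFlow Φ t ((extChartAt (𝓡 n) x₀).symm y) (frameAt x₀ _ w) =
      frameAt x₁ _ (flowDerivInCharts Φ x₀ x₁ (t, y) w) := by
  set x := (extChartAt (𝓡 n) x₀).symm y with hx
  have h0 : Φ t x ∈ (chartAt (Model n) x₁).source := by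
    rw [← extChartAt_source (𝓡 n)]
    exact hp.2
  have h1 : HasMFDerivAt 𝓘(ℝ, Model n) 𝓘(ℝ, Model n) (fun z => flowInCharts Φ x₀ x₁ (t, z)) y _ :=
    (((mdifferentiableAt_extChartAt (I := 𝓡 n) h0).hasMFDerivAt).comp _
      (hΦ.mdifferentiableAt t x).hasMFDerivAt).comp y
      (mdifferentiableAt_extChartAt_symm hp.1).hasMFDerivAt
  have h2 := hasMFDerivAt_unique h1 (hasFDerivAt_flowInCharts hΦ hp).hasMFDerivAt
  have h3 := DFunLike.congr_fun h2 w
  have h4 : coordAt x₁ _ (tangentFlow Φ t x (frameAt x₀ x w)) =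
      flowDerivInCharts Φ x₀ x₁ (t, y) w := by
    rw [coordAt_eq_mfderiv hp.2, ← mfderiv_extChartAt_symm hp.1]
    exact h3
  rw [← h4, frameAt_coordAt hp.2]

/-- The pullbacks of a form of class `C^r` by a smooth flow are jointly of class `C^r`. -/
lemma contDiffOn_formLocal_flowPullback (hΦ : IsSmoothFlow n Φ) {k : ℕ} {r : ℕ∞}
    {β : Form n k M} (hβ : IsFormOfClass r β) (x₀ : M) :
    ContDiffOn ℝ r (fun p : ℝ × Model n =>
      formLocal (flowPullback Φ p.1 β) x₀ ((extChartAt (𝓡 n) x₀).symm p.2))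
      (Set.univ ×ˢ (extChartAt (𝓡 n) x₀).target) := by
  rintro ⟨t, y⟩ ⟨-, hy⟩
  -- The chart in the target is centered at the image of the given point; the claim is local, so it
  -- may depend on `(t, y)`.
  set x₁ := Φ t ((extChartAt (𝓡 n) x₀).symm y) with hx₁
  have hmem : (t, y) ∈ flowInChartsDomain (n := n) Φ x₀ x₁ := ⟨hy, mem_extChartAt_source x₁⟩
  have hop := isOpen_flowInChartsDomain (n := n) Φ x₀ x₁
  have hle : (r : WithTop ℕ∞) ≤ ∞ := by exact_mod_cast le_top
  have h1 : ContDiffOn ℝ r (fun p : ℝ × Model n =>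
      (formLocal β x₁ ((extChartAt (𝓡 n) x₁).symm (flowInCharts Φ x₀ x₁ p))).compContinuousLinearMap
        (flowDerivInCharts Φ x₀ x₁ p)) (flowInChartsDomain (n := n) Φ x₀ x₁) := by
    refine contDiffOn_compContinuousLinearMap ?_ ((contDiffOn_flowDerivInCharts hΦ x₀ x₁).of_le hle)
    exact ((isFormOfClass_iff r β).1 hβ x₁).comp ((contDiffOn_flowInCharts hΦ x₀ x₁).of_le hle)
      fun p hp => (extChartAt (𝓡 n) x₁).map_source hp.2
  refine ContDiffAt.contDiffWithinAt ?_
  refine (h1.contDiffAt (hop.mem_nhds hmem)).congr_of_eventuallyEq ?_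
  filter_upwards [hop.mem_nhds hmem] with p hp
  ext w
  have h3 : ∀ w, formLocal β x₁ ((extChartAt (𝓡 n) x₁).symm (flowInCharts Φ x₀ x₁ p)) w =
      formLocal β x₁ (Φ p.1 ((extChartAt (𝓡 n) x₀).symm p.2)) w := by
    intro w
    rw [flowInCharts, (extChartAt (𝓡 n) x₁).left_inv hp.2]
  rw [ContinuousAlternatingMap.compContinuousLinearMap_apply, h3, formLocal_apply, formLocal_apply]
  change β _ _ = β _ _
  congr 1
  funext i
  exact tangentFlow_frameAt hΦ (t := p.1) (y := p.2) hp (w i)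

end Flow

end AnosovForms

namespace AnosovForms

open Bundle Filter

/-! ### Group law for tangent maps and pullbacks. -/

section FlowAlgebra

variable {n : ℕ} {M : Type*} [TopologicalSpace M] [ChartedSpace (Model n) M] {Φ : Flow ℝ M}

/-- The tangent map of the time `t` map of the flow, on the total space of the tangent bundle. -/
noncomputable def tangentFlowMap (Φ : Flow ℝ M) (t : ℝ) (p : TangentBundle (𝓡 n) M) :
    TangentBundle (𝓡 n) M :=
  ⟨Φ t p.1, tangentFlow Φ t p.1 p.2⟩

lemma tangentFlowMap_eq_tangentMap (Φ : Flow ℝ M) (t : ℝ) :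
    tangentFlowMap (n := n) Φ t = tangentMap (𝓡 n) (𝓡 n) (fun z => Φ t z) := rfl

lemma tangentFlowMap_zero (Φ : Flow ℝ M) (p : TangentBundle (𝓡 n) M) :
    tangentFlowMap Φ 0 p = p := by
  have h : (fun z => Φ 0 z) = (id : M → M) := funext fun z => Φ.map_zero_apply z
  rw [tangentFlowMap_eq_tangentMap, h, tangentMap_id, id]

lemma tangentFlowMap_add (hΦ : IsSmoothFlow n Φ) (s t : ℝ) (p : TangentBundle (𝓡 n) M) :
    tangentFlowMap Φ (s + t) p = tangentFlowMap Φ s (tangentFlowMap Φ t p) := by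
  have h : (fun z => Φ (s + t) z) = (fun z => Φ s z) ∘ (fun z => Φ t z) :=
    funext fun z => Φ.map_add s t z
  rw [tangentFlowMap_eq_tangentMap, h]
  exact tangentMap_comp_at p (hΦ.mdifferentiableAt s _) (hΦ.mdifferentiableAt t _)

lemma tangentFlowMap_cancel_neg (hΦ : IsSmoothFlow n Φ) (t : ℝ) (p : TangentBundle (𝓡 n) M) :
    tangentFlowMap Φ t (tangentFlowMap Φ (-t) p) = p := by
  rw [← tangentFlowMap_add hΦ, add_neg_cancel, tangentFlowMap_zero]

lemma compContinuousLinearMap_mfderiv_congr {k : ℕ} {f g : M → M} (h : f = g) (β : Form n k M)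
    (x : M) : (β (f x)).compContinuousLinearMap (mfderiv (𝓡 n) (𝓡 n) f x) =
      (β (g x)).compContinuousLinearMap (mfderiv (𝓡 n) (𝓡 n) g x) := by
  subst h; rfl

lemma flowPullback_zero {k : ℕ} (Φ : Flow ℝ M) (β : Form n k M) : flowPullback Φ 0 β = β := by
  have h : (fun z => Φ 0 z) = (id : M → M) := funext fun z => Φ.map_zero_apply z
  funext x
  refine (compContinuousLinearMap_mfderiv_congr h β x).trans ?_
  rw [mfderiv_id]
  rfl

lemma flowPullback_add (hΦ : IsSmoothFlow n Φ) {k : ℕ} (s t : ℝ) (β : Form n k M) :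
    flowPullback Φ (s + t) β = flowPullback Φ t (flowPullback Φ s β) := by
  have h : (fun z => Φ (s + t) z) = (fun z => Φ s z) ∘ (fun z => Φ t z) :=
    funext fun z => Φ.map_add s t z
  funext x
  refine (compContinuousLinearMap_mfderiv_congr h β x).trans ?_
  rw [mfderiv_comp x (hΦ.mdifferentiableAt s _) (hΦ.mdifferentiableAt t _)]
  rfl

lemma flowPullback_apply {k : ℕ} (Φ : Flow ℝ M) (t : ℝ) (β : Form n k M) (x : M)
    (v : Fin k → TangentSpace (𝓡 n) x) :
    flowPullback Φ t β x v = β (Φ t x) (fun i => tangentFlow Φ t x (v i)) := rfl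

/-- The generator of the flow is invariant. -/
lemma tangentFlow_generator (hΦ : IsSmoothFlow n Φ) {X : (x : M) → TangentSpace (𝓡 n) x}
    (hX : IsGenerator X Φ) (t : ℝ) (x : M) : tangentFlow Φ t x (X x) = X (Φ t x) := by
  have h1 := hX x 0
  have h2 : HasMFDerivAt 𝓘(ℝ, ℝ) (𝓡 n) (fun s => Φ s (Φ t x)) 0 _ := hX (Φ t x) 0
  -- Differentiate $f_t f_s x=f_s f_t x$ with respect to $s$ at $s=0$ in two ways.
  have h3 : HasMFDerivAt 𝓘(ℝ, ℝ) (𝓡 n) ((fun z => Φ t z) ∘ fun s => Φ s x) 0 _ :=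
    (hΦ.mdifferentiableAt t (Φ 0 x)).hasMFDerivAt.comp 0 h1
  have h4 : ((fun z => Φ t z) ∘ fun s => Φ s x) = fun s => Φ s (Φ t x) := by
    funext s
    simp only [Function.comp_apply]
    rw [← Φ.map_add, ← Φ.map_add, add_comm]
  rw [h4] at h3
  have h5 := DFunLike.congr_fun (hasMFDerivAt_unique h3 h2) (1 : ℝ)
  let X' : M → Model n := fun z => X z
  let T' : M → Model n := fun z => mfderiv (𝓡 n) (𝓡 n) (fun z => Φ t z) z (X z)
  have h6 : T' (Φ 0 x) = X' (Φ 0 (Φ t x)) := by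
    have e1 : T' (Φ 0 x) = mfderiv (𝓡 n) (𝓡 n) (fun z => Φ t z) (Φ 0 x)
        ((1 : ℝ) • (X (Φ 0 x))) := by rw [one_smul]
    have e2 : X' (Φ 0 (Φ t x)) = (1 : ℝ) • X' (Φ 0 (Φ t x)) := by rw [one_smul]
    rw [e1, e2]
    exact h5
  rw [Φ.map_zero_apply, Φ.map_zero_apply] at h6
  exact h6

end FlowAlgebra

/-! ### Norms on the tangent spaces and uniform bounds on a compact manifold. -/

section Riemannian

variable {n : ℕ} {M : Type*} [TopologicalSpace M] [ChartedSpace (Model n) M]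

instance finiteDimensional_tangentSpace (x : M) :
    FiniteDimensional ℝ (TangentSpace (𝓡 n) x) :=
  inferInstanceAs (FiniteDimensional ℝ (Model n))

lemma finrank_tangentSpace (x : M) : Module.finrank ℝ (TangentSpace (𝓡 n) x) = n :=
  finrank_euclideanSpace_fin (𝕜 := ℝ) (n := n)

/-- Monotonicity in the constant allows taking the maximum over a finite cover, so bounds proved in
single charts become global. -/
lemma exists_uniform_constant [CompactSpace M] {p : M → ℝ → Prop}
    (hmono : ∀ x K K', K ≤ K' → p x K → p x K')
    (h : ∀ x₀, ∃ K, ∀ᶠ x in 𝓝 x₀, p x K) : ∃ K > 0, ∀ x, p x K := by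
  have : ∃ K > 0, ∀ x ∈ (Set.univ : Set M), p x K := by
    refine isCompact_univ.induction_on (p := fun s => ∃ K > 0, ∀ x ∈ s, p x K) ?_ ?_ ?_ ?_
    · exact ⟨1, one_pos, by simp⟩
    · rintro s t hst ⟨K, hK, h⟩
      exact ⟨K, hK, fun x hx => h x (hst hx)⟩
    · rintro s t ⟨K, hK, h⟩ ⟨K', hK', h'⟩
      refine ⟨max K K', lt_max_of_lt_left hK, ?_⟩
      rintro x (hx | hx)
      · exact hmono x _ _ (le_max_left _ _) (h x hx)
      · exact hmono x _ _ (le_max_right _ _) (h' x hx)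
    · intro x _
      obtain ⟨K, hK⟩ := h x
      refine ⟨{y | p y K}, mem_nhdsWithin_of_mem_nhds hK, max K 1, by positivity, ?_⟩
      exact fun y hy => hmono y _ _ (le_max_left _ _) hy
  obtain ⟨K, hK, h⟩ := this
  exact ⟨K, hK, fun x => h x trivial⟩

variable [IsManifold (𝓡 n) ∞ M]

/-- A field of subspaces, in the frame given by the preferred chart at `x₀`. -/
noncomputable def localFamily (E : Distribution n M) (x₀ x : M) : Submodule ℝ (Model n) :=
  (E x).comap (frameAt x₀ x).toLinearMap

lemma isClosedFamilyAt_localFamily {E : Distribution n M}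
    (hE : IsClosed {p : TangentBundle (𝓡 n) M | p.2 ∈ E p.1}) {x₀ x : M}
    (hx : x ∈ (extChartAt (𝓡 n) x₀).source) : IsClosedFamilyAt (localFamily E x₀) x := by
  intro l hl w w₀ hw hlim
  have hs : ∀ᶠ y in (l : Filter M), y ∈ (extChartAt (𝓡 n) x₀).source :=
    hl ((isOpen_extChartAt_source x₀).mem_nhds hx)
  have h1 : Tendsto (fun y => (y, w y)) l
      (𝓝[(extChartAt (𝓡 n) x₀).source ×ˢ Set.univ] (x, w₀)) :=
    tendsto_nhdsWithin_iff.2 ⟨(show Tendsto id (l : Filter M) (𝓝 x) from hl).prodMk_nhds hlim,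
      hs.mono fun y hy => ⟨hy, trivial⟩⟩
  exact hE.mem_of_tendsto ((continuousOn_mk_frameAt x₀ (x, w₀) ⟨hx, trivial⟩).tendsto.comp h1) hw

variable [RiemannianBundle (fun x : M => TangentSpace (𝓡 n) x)]
  [IsContinuousRiemannianBundle (Model n) (fun x : M => TangentSpace (𝓡 n) x)]

lemma eventually_norm_frameAt_le (x₀ : M) :
    ∃ C > 0, ∀ᶠ x in 𝓝 x₀, ∀ w : Model n, ‖frameAt x₀ x w‖ ≤ C * ‖w‖ := by
  obtain ⟨C, hC, h⟩ := eventually_norm_symmL_trivializationAt_lt (Model n)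
    (fun x : M => TangentSpace (𝓡 n) x) x₀
  exact ⟨C, hC, h.mono fun x hx w => ContinuousLinearMap.le_of_opNorm_le _ hx.le w⟩

lemma eventually_norm_coordAt_le (x₀ : M) :
    ∃ C > 0, ∀ᶠ x in 𝓝 x₀, ∀ v : TangentSpace (𝓡 n) x,
      ‖coordAt x₀ x v‖ ≤ C * ‖v‖ := by
  obtain ⟨C, hC, h⟩ := eventually_norm_trivializationAt_lt (Model n)
    (fun x : M => TangentSpace (𝓡 n) x) x₀
  exact ⟨C, hC, h.mono fun x hx w => ContinuousLinearMap.le_of_opNorm_le _ hx.le w⟩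

lemma continuous_norm_tangentBundle :
    Continuous (fun p : TangentBundle (𝓡 n) M => ‖p.2‖) := by
  have h : Continuous (fun p : TangentBundle (𝓡 n) M => inner ℝ p.2 p.2) :=
    Continuous.inner_bundle (F := Model n) (E := fun x : M => TangentSpace (𝓡 n) x)
      (b := fun p : TangentBundle (𝓡 n) M => p.1) continuous_id continuous_id
  simp_rw [real_inner_self_eq_norm_sq] at h
  simpa using h.sqrt

lemma continuous_norm_tangentFlowMap {Φ : Flow ℝ M} (hΦ : IsSmoothFlow n Φ) (t : ℝ) :
    Continuous (fun p : TangentBundle (𝓡 n) M => ‖tangentFlow Φ t p.1 p.2‖) := by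
  have h1 : ContMDiff (𝓡 n) (𝓡 n) ∞ (fun z => Φ t z) :=
    ContMDiff.comp (g := fun p : ℝ × M => Φ p.1 p.2) hΦ (contMDiff_const.prodMk contMDiff_id)
  have h2 : Continuous (tangentFlowMap (n := n) Φ t) := h1.continuous_tangentMap (by simp)
  exact continuous_norm_tangentBundle.comp h2

lemma exists_norm_form_le [CompactSpace M] {k : ℕ} {β : Form n k M} (hβ : IsFormOfClass 0 β) :
    ∃ K > 0, ∀ x v, |β x v| ≤ K * ∏ i, ‖v i‖ := by
  refine exists_uniform_constant (p := fun x K => ∀ v, |β x v| ≤ K * ∏ i, ‖v i‖) ?_ ?_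
  · intro x K K' h h1 v
    exact (h1 v).trans (mul_le_mul_of_nonneg_right h (Finset.prod_nonneg fun _ _ => norm_nonneg _))
  · intro x₀
    obtain ⟨C, hC, h⟩ := eventually_norm_coordAt_le (n := n) x₀
    have hs := extChartAt_source_mem_nhds (I := 𝓡 n) x₀
    have hc : ContinuousAt (fun x => ‖formLocal β x₀ x‖) x₀ :=
      ((hβ.continuousOn_formLocal x₀).continuousAt hs).norm
    have hb := hc.eventually_lt continuousAt_const (lt_add_one ‖formLocal β x₀ x₀‖)
    refine ⟨(‖formLocal β x₀ x₀‖ + 1) * C ^ k, ?_⟩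
    filter_upwards [h, hs, hb] with x hx hxs hxb v
    rw [apply_eq_formLocal β hxs]
    refine ((formLocal β x₀ x).le_opNorm _).trans ?_
    rw [mul_assoc]
    refine mul_le_mul hxb.le ?_ (Finset.prod_nonneg fun _ _ => norm_nonneg _) (by positivity)
    calc ∏ i, ‖coordAt x₀ x (v i)‖ ≤ ∏ i, C * ‖v i‖ :=
          Finset.prod_le_prod (fun _ _ => norm_nonneg _) fun i _ => hx _
      _ = C ^ k * ∏ i, ‖v i‖ := by simp [Finset.prod_mul_distrib]

end Riemannian

end AnosovForms

namespace AnosovForms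

open Bundle Filter

/-! ### Splittings of the tangent bundle and their projections. -/

section Bundles

variable {n : ℕ} {M : Type*} [TopologicalSpace M] [ChartedSpace (Model n) M]

instance t2Space_tangentSpace (x : M) : T2Space (TangentSpace (𝓡 n) x) :=
  inferInstanceAs (T2Space (Model n))

lemma exists_projection {A B : Distribution n M} (h : ∀ x, IsCompl (A x) (B x)) :
    ∃ P : (x : M) → TangentSpace (𝓡 n) x →L[ℝ] TangentSpace (𝓡 n) x,
      (∀ x v, P x v ∈ A x) ∧ ∀ x v, v - P x v ∈ B x := by
  refine ⟨fun x => LinearMap.toContinuousLinearMap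
    ((A x).subtype.comp ((A x).projectionOnto (B x) (h x))), fun x v => ?_, fun x v => ?_⟩
  · exact Submodule.coe_mem _
  · have h1 : ((A x).projectionOnto (B x) (h x))
        (v - (A x).projectionOnto (B x) (h x) v) = 0 := by
      rw [map_sub, Submodule.projectionOnto_apply_left, sub_self]
    exact (Submodule.projectionOnto_apply_eq_zero_iff _).1 h1

lemma projection_apply_eq {A B : Distribution n M} (h : ∀ x, Disjoint (A x) (B x))
    {P : (x : M) → TangentSpace (𝓡 n) x →L[ℝ] TangentSpace (𝓡 n) x}
    (hPA : ∀ x v, P x v ∈ A x) (hPB : ∀ x v, v - P x v ∈ B x) {x : M}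
    {v a : TangentSpace (𝓡 n) x} (ha : a ∈ A x) (hb : v - a ∈ B x) : P x v = a := by
  have h1 : P x v - a ∈ B x := by
    have := (B x).sub_mem hb (hPB x v)
    rwa [sub_sub_sub_cancel_left] at this
  exact sub_eq_zero.1 ((Submodule.disjoint_def.1 (h x)) _ ((A x).sub_mem (hPA x v) ha) h1)

variable [IsManifold (𝓡 n) ∞ M]

/-- A field of endomorphisms, in the frame given by the preferred chart at `x₀`. -/
noncomputable def localEnd (P : (x : M) → TangentSpace (𝓡 n) x →L[ℝ] TangentSpace (𝓡 n) x)
    (x₀ x : M) : Model n →L[ℝ] Model n :=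
  (coordAt x₀ x).comp ((P x).comp (frameAt x₀ x))

lemma frameAt_localEnd (P : (x : M) → TangentSpace (𝓡 n) x →L[ℝ] TangentSpace (𝓡 n) x)
    {x₀ x : M} (hx : x ∈ (extChartAt (𝓡 n) x₀).source) (w : Model n) :
    frameAt x₀ x (localEnd P x₀ x w) = P x (frameAt x₀ x w) := frameAt_coordAt hx _

lemma disjoint_localFamily {A B : Distribution n M} {x₀ x : M}
    (hx : x ∈ (extChartAt (𝓡 n) x₀).source) (h : Disjoint (A x) (B x)) :
    Disjoint (localFamily A x₀ x) (localFamily B x₀ x) := by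
  rw [Submodule.disjoint_def] at h ⊢
  intro w hA hB
  have h0 : frameAt x₀ x w = 0 := h _ hA hB
  rw [← coordAt_frameAt hx w, h0, map_zero]

/-- The field of subspaces `E` is closed. -/
def IsClosedField (E : Distribution n M) : Prop :=
  ∀ x₀, ∀ x ∈ (extChartAt (𝓡 n) x₀).source, IsClosedFamilyAt (localFamily E x₀) x

lemma IsClosedFamilyAt.congr {Y V : Type*} [TopologicalSpace Y] [NormedAddCommGroup V]
    [NormedSpace ℝ V] {A B : Y → Submodule ℝ V} {y₀ : Y} (hA : IsClosedFamilyAt A y₀)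
    (h : ∀ᶠ y in 𝓝 y₀, A y = B y) : IsClosedFamilyAt B y₀ := by
  intro l hl w w₀ hw hlim
  rw [← h.self_of_nhds]
  refine hA l hl w w₀ ?_ hlim
  filter_upwards [hw, hl h] with y h1 h2
  exact h2 ▸ h1

lemma localFamily_sup (A B : Distribution n M) {x₀ x : M}
    (hx : x ∈ (extChartAt (𝓡 n) x₀).source) :
    localFamily A x₀ x ⊔ localFamily B x₀ x = localFamily (fun x => A x ⊔ B x) x₀ x := by
  refine le_antisymm (sup_le (Submodule.comap_mono le_sup_left)
    (Submodule.comap_mono le_sup_right)) fun w hw => ?_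
  obtain ⟨a, ha, b, hb, hab⟩ := Submodule.mem_sup.1 (show frameAt x₀ x w ∈ A x ⊔ B x from hw)
  refine Submodule.mem_sup.2 ⟨coordAt x₀ x a, ?_, coordAt x₀ x b, ?_, ?_⟩
  · change frameAt x₀ x _ ∈ A x
    rwa [frameAt_coordAt hx]
  · change frameAt x₀ x _ ∈ B x
    rwa [frameAt_coordAt hx]
  · rw [← map_add, hab, coordAt_frameAt hx]

lemma IsClosedField.sup {A B : Distribution n M} (hA : IsClosedField A) (hB : IsClosedField B)
    (h : ∀ x, Disjoint (A x) (B x)) : IsClosedField (fun x => A x ⊔ B x) := by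
  intro x₀ x hx
  refine ((hA x₀ x hx).sup (hB x₀ x hx) (disjoint_localFamily hx (h x))).congr ?_
  filter_upwards [(isOpen_extChartAt_source x₀).mem_nhds hx] with y hy
  exact localFamily_sup A B hy

lemma continuousOn_localEnd {A B : Distribution n M}
    (hA : IsClosedField A) (hB : IsClosedField B)
    (h : ∀ x, Disjoint (A x) (B x))
    {P : (x : M) → TangentSpace (𝓡 n) x →L[ℝ] TangentSpace (𝓡 n) x}
    (hPA : ∀ x v, P x v ∈ A x) (hPB : ∀ x v, v - P x v ∈ B x) (x₀ : M) :
    ContinuousOn (localEnd P x₀) (extChartAt (𝓡 n) x₀).source := by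
  refine continuousOn_projection (isOpen_extChartAt_source x₀) (hA x₀) (hB x₀)
    (fun x hx => disjoint_localFamily hx (h x)) (fun x hx w => ?_) (fun x hx w => ?_)
  · change frameAt x₀ x _ ∈ A x
    rw [frameAt_localEnd P hx]
    exact hPA x _
  · change frameAt x₀ x _ ∈ B x
    rw [map_sub, frameAt_localEnd P hx]
    exact hPB x _

/-- The rank of a continuous field of projections is constant. -/
lemma finrank_eq_of_continuous_projection [ConnectedSpace M] {A : Distribution n M}
    {P : (x : M) → TangentSpace (𝓡 n) x →L[ℝ] TangentSpace (𝓡 n) x}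
    (hP : ∀ x₀, ContinuousOn (localEnd P x₀) (extChartAt (𝓡 n) x₀).source)
    (hPA : ∀ x v, P x v ∈ A x) (hPid : ∀ x, ∀ v ∈ A x, P x v = v) (x y : M) :
    Module.finrank ℝ (A x) = Module.finrank ℝ (A y) := by
  -- The trace of a projection is its rank. It is thus both continuous and integer valued, hence
  -- constant on a connected space.
  have htr : ∀ x₀ x, x ∈ (extChartAt (𝓡 n) x₀).source →
      LinearMap.trace ℝ (Model n) (localEnd P x₀ x).toLinearMap = Module.finrank ℝ (A x) := by
    intro x₀ x hx
    have h1 : LinearMap.IsProj (localFamily A x₀ x) (localEnd P x₀ x).toLinearMap := by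
      constructor
      · intro w
        change frameAt x₀ x (localEnd P x₀ x w) ∈ A x
        rw [frameAt_localEnd P hx]
        exact hPA x _
      · intro w hw
        change coordAt x₀ x (P x (frameAt x₀ x w)) = w
        rw [hPid x (frameAt x₀ x w) hw, coordAt_frameAt hx]
    rw [h1.trace]
    let e : Model n ≃ₗ[ℝ] TangentSpace (𝓡 n) x := LinearEquiv.ofLinearMap
      (frameAt x₀ x).toLinearMap (coordAt x₀ x).toLinearMap
      (LinearMap.ext fun v => frameAt_coordAt hx v) (LinearMap.ext fun w => coordAt_frameAt hx w)
    have h2 : (localFamily A x₀ x).map e.toLinearMap = A x :=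
      Submodule.map_comap_eq_of_surjective e.surjective _
    rw [← h2]
    exact_mod_cast (LinearEquiv.finrank_map_eq e (localFamily A x₀ x)).symm
  have hcont : Continuous fun x => ((Module.finrank ℝ (A x) : ℕ) : ℝ) := by
    rw [continuous_iff_continuousAt]
    intro x₀
    have hs := extChartAt_source_mem_nhds (I := 𝓡 n) x₀
    let T : (Model n →L[ℝ] Model n) →ₗ[ℝ] ℝ :=
      (LinearMap.trace ℝ (Model n)).comp (ContinuousLinearMap.coeLM ℝ)
    have h1 : ContinuousAt (fun x => T (localEnd P x₀ x)) x₀ :=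
      (LinearMap.continuous_of_finiteDimensional T).continuousAt.comp
        ((hP x₀).continuousAt hs)
    refine h1.congr ?_
    filter_upwards [hs] with x hx using htr x₀ x hx
  have hcont' : Continuous fun x => Module.finrank ℝ (A x) :=
    Nat.isClosedEmbedding_coe_real.isEmbedding.continuous_iff.2 hcont
  exact PreconnectedSpace.constant inferInstance hcont'

variable [RiemannianBundle (fun x : M => TangentSpace (𝓡 n) x)]
  [IsContinuousRiemannianBundle (Model n) (fun x : M => TangentSpace (𝓡 n) x)]

lemma exists_norm_endomorphism_le [CompactSpace M]
    {P : (x : M) → TangentSpace (𝓡 n) x →L[ℝ] TangentSpace (𝓡 n) x}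
    (hP : ∀ x₀, ContinuousOn (localEnd P x₀) (extChartAt (𝓡 n) x₀).source) :
    ∃ K > 0, ∀ x v, ‖P x v‖ ≤ K * ‖v‖ := by
  refine exists_uniform_constant (p := fun x K => ∀ v, ‖P x v‖ ≤ K * ‖v‖) ?_ ?_
  · exact fun x K K' h h1 v => (h1 v).trans (mul_le_mul_of_nonneg_right h (norm_nonneg _))
  · intro x₀
    obtain ⟨C, hC, h⟩ := eventually_norm_coordAt_le (n := n) x₀
    obtain ⟨C', hC', h'⟩ := eventually_norm_frameAt_le (n := n) x₀
    have hs := extChartAt_source_mem_nhds (I := 𝓡 n) x₀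
    have hc : ContinuousAt (fun x => ‖localEnd P x₀ x‖) x₀ :=
      ((hP x₀).continuousAt hs).norm
    have hb := hc.eventually_lt continuousAt_const (lt_add_one ‖localEnd P x₀ x₀‖)
    refine ⟨C' * ((‖localEnd P x₀ x₀‖ + 1) * C), ?_⟩
    filter_upwards [h, h', hs, hb] with x hx hx' hxs hxb v
    have e : P x v = frameAt x₀ x (localEnd P x₀ x (coordAt x₀ x v)) := by
      rw [frameAt_localEnd P hxs, frameAt_coordAt hxs]
    rw [e, mul_assoc, mul_assoc]
    refine (hx' _).trans (mul_le_mul_of_nonneg_left ?_ hC'.le)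
    refine ((localEnd P x₀ x).le_opNorm _).trans ?_
    exact mul_le_mul hxb.le (hx v) (norm_nonneg _) (by positivity)

end Bundles

end AnosovForms

namespace AnosovForms

open Bundle Filter

/-! ### Closedness of the invariant bundles of an Anosov flow. -/

section Anosov

lemma tendsto_const_mul_exp_neg (c : ℝ) {lam : ℝ} (hlam : 0 < lam) (d : ℝ) :
    Tendsto (fun t : ℝ => c * Real.exp (-lam * t) * d) atTop (𝓝 0) := by
  have h : Tendsto (fun t : ℝ => Real.exp (-lam * t)) atTop (𝓝 0) :=
    Real.tendsto_exp_atBot.comp (tendsto_id.const_mul_atTop_of_neg (by linarith))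
  simpa using (h.const_mul c).mul_const d

/-- Two components of a vector vanish if the vector and its other component are contracted, and
if these two components are preserved and expanded, respectively. -/
lemma components_eq_zero {fv fp fq fr g : ℝ → ℝ} {a r d : ℝ} (ha : 0 ≤ a) (hr : 0 ≤ r)
    (hv : Tendsto fv atTop (𝓝 0)) (hp : Tendsto fp atTop (𝓝 0)) (hg : Tendsto g atTop (𝓝 0))
    (hq : ∀ t ≥ 0, a ≤ fq t) (hq' : ∀ t ≥ 0, fq t ≤ d) (hfr : ∀ t ≥ 0, 0 ≤ fr t)
    (hrt : ∀ t ≥ 0, r ≤ g t * fr t) (hr0 : r = 0 → ∀ t ≥ 0, fr t = 0)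
    (htri : ∀ t ≥ 0, fr t ≤ fv t + fp t + fq t) (htri' : ∀ t ≥ 0, fq t ≤ fv t + fp t + fr t) :
    a = 0 ∧ r = 0 := by
  -- The triangle inequality bounds the expanded component `fr`, so its product with `g`, which
  -- dominates `r`, tends to zero.
  have hr1 : r = 0 := by
    refine le_antisymm ?_ hr
    have h1 : Tendsto (fun t => |g t| * (fv t + fp t + d)) atTop (𝓝 (|0| * (0 + 0 + d))) :=
      hg.abs.mul ((hv.add hp).add_const d)
    rw [abs_zero, zero_mul] at h1
    refine ge_of_tendsto h1 ?_
    filter_upwards [eventually_ge_atTop 0] with t ht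
    calc r ≤ g t * fr t := hrt t ht
      _ ≤ |g t| * fr t := mul_le_mul_of_nonneg_right (le_abs_self _) (hfr t ht)
      _ ≤ |g t| * (fv t + fp t + d) :=
        mul_le_mul_of_nonneg_left (by linarith [htri t ht, hq' t ht]) (abs_nonneg _)
  refine ⟨le_antisymm ?_ ha, hr1⟩
  have h1 : Tendsto (fun t => fv t + fp t) atTop (𝓝 (0 + 0)) := hv.add hp
  rw [add_zero] at h1
  refine ge_of_tendsto h1 ?_
  filter_upwards [eventually_ge_atTop 0] with t ht
  linarith [hq t ht, htri' t ht, hr0 hr1 t ht]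

variable {n : ℕ} {M : Type*} [TopologicalSpace M] [ChartedSpace (Model n) M]
  {Φ : Flow ℝ M} {X : (x : M) → TangentSpace (𝓡 n) x} {Euu Ess : Distribution n M}

lemma mem_centerStable_iff {x : M} {v : TangentSpace (𝓡 n) x} :
    v ∈ centerStable X Ess x ↔ ∃ a : ℝ, ∃ s ∈ Ess x, v = a • X x + s := by
  constructor
  · intro h
    obtain ⟨y, hy, s, hs, rfl⟩ := Submodule.mem_sup.1 h
    obtain ⟨a, rfl⟩ := Submodule.mem_span_singleton.1 hy
    exact ⟨a, s, hs, rfl⟩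
  · rintro ⟨a, s, hs, rfl⟩
    exact Submodule.mem_sup.2 ⟨_, Submodule.mem_span_singleton.2 ⟨a, rfl⟩, s, hs, rfl⟩

/-- No regularity of `X` is assumed. In a chart it is the time derivative at 0 of the smooth flow,
and this depends continuously on the point. -/
lemma continuous_generator [IsManifold (𝓡 n) ∞ M] (hΦ : IsSmoothFlow n Φ) (hX : IsGenerator X Φ) :
    Continuous fun x => (⟨x, X x⟩ : TangentBundle (𝓡 n) M) := by
  rw [continuous_iff_continuousAt]
  intro x₀
  have hs := extChartAt_source_mem_nhds (I := 𝓡 n) x₀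
  have hdom : ∀ x ∈ (extChartAt (𝓡 n) x₀).source,
      (0, extChartAt (𝓡 n) x₀ x) ∈ flowInChartsDomain (n := n) Φ x₀ x₀ := by
    intro x hx
    refine ⟨(extChartAt (𝓡 n) x₀).map_source hx, ?_⟩
    rw [(extChartAt (𝓡 n) x₀).left_inv hx, Φ.map_zero_apply]
    exact hx
  have hcoord : ∀ x ∈ (extChartAt (𝓡 n) x₀).source, coordAt x₀ x (X x) =
      fderiv ℝ (flowInCharts Φ x₀ x₀) (0, extChartAt (𝓡 n) x₀ x) (1, 0) := by
    intro x hx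
    have h1 : HasFDerivAt (flowInCharts Φ x₀ x₀)
        (fderiv ℝ (flowInCharts Φ x₀ x₀) (0, extChartAt (𝓡 n) x₀ x))
        (0, extChartAt (𝓡 n) x₀ x) :=
      (((contDiffOn_flowInCharts hΦ x₀ x₀).differentiableOn (by simp)).differentiableAt
        ((isOpen_flowInChartsDomain Φ x₀ x₀).mem_nhds (hdom x hx))).hasFDerivAt
    have h2 := h1.comp (0 : ℝ)
      (hasFDerivAt_prodMk_left (𝕜 := ℝ) (0 : ℝ) (extChartAt (𝓡 n) x₀ x))
    have h0 : Φ 0 x ∈ (chartAt (Model n) x₀).source := by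
      rw [← extChartAt_source (𝓡 n), Φ.map_zero_apply]
      exact hx
    have h3 : HasMFDerivAt 𝓘(ℝ, ℝ) 𝓘(ℝ, Model n) (extChartAt (𝓡 n) x₀ ∘ fun t => Φ t x) 0 _ :=
      (mdifferentiableAt_extChartAt (I := 𝓡 n) h0).hasMFDerivAt.comp 0 (hX x 0)
    have h4 : (flowInCharts Φ x₀ x₀ ∘ fun t : ℝ => (t, extChartAt (𝓡 n) x₀ x)) =
        extChartAt (𝓡 n) x₀ ∘ fun t => Φ t x := by
      funext t
      simp only [Function.comp_apply, flowInCharts]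
      rw [(extChartAt (𝓡 n) x₀).left_inv hx]
    rw [h4] at h2
    have h5 := DFunLike.congr_fun (hasMFDerivAt_unique h2.hasMFDerivAt h3) (1 : ℝ)
    let T' : M → Model n := fun z => mfderiv (𝓡 n) 𝓘(ℝ, Model n) (extChartAt (𝓡 n) x₀) z (X z)
    have h6 : fderiv ℝ (flowInCharts Φ x₀ x₀) (0, extChartAt (𝓡 n) x₀ x) (1, 0) = T' (Φ 0 x) := by
      have e1 : T' (Φ 0 x) = mfderiv (𝓡 n) 𝓘(ℝ, Model n) (extChartAt (𝓡 n) x₀) (Φ 0 x)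
          ((1 : ℝ) • (X (Φ 0 x))) := by rw [one_smul]
      rw [e1]
      exact h5
    rw [h6, Φ.map_zero_apply, coordAt_eq_mfderiv hx]
    rfl
  have hc : ContinuousAt (fun x => coordAt x₀ x (X x)) x₀ := by
    have h1 : ContinuousOn (fun x => fderiv ℝ (flowInCharts Φ x₀ x₀) (0, extChartAt (𝓡 n) x₀ x))
        (extChartAt (𝓡 n) x₀).source :=
      ((contDiffOn_flowInCharts hΦ x₀ x₀).continuousOn_fderiv_of_isOpen
        (isOpen_flowInChartsDomain Φ x₀ x₀) (by simp)).comp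
        (continuousOn_const.prodMk (continuousOn_extChartAt x₀)) hdom
    refine ((h1.continuousAt hs).clm_apply (continuousAt_const (y := ((1 : ℝ), (0 : Model n))))).congr ?_
    filter_upwards [hs] with x hx using (hcoord x hx).symm
  have h7 : Tendsto (fun x => (x, coordAt x₀ x (X x))) (𝓝 x₀)
      (𝓝[(extChartAt (𝓡 n) x₀).source ×ˢ Set.univ] (x₀, coordAt x₀ x₀ (X x₀))) :=
    tendsto_nhdsWithin_iff.2 ⟨tendsto_id.prodMk_nhds hc,
      by filter_upwards [hs] with x hx using ⟨hx, trivial⟩⟩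
  have h8 := (continuousOn_mk_frameAt x₀ (x₀, coordAt x₀ x₀ (X x₀))
    ⟨mem_extChartAt_source x₀, trivial⟩).tendsto.comp h7
  have h9 : ∀ x ∈ (extChartAt (𝓡 n) x₀).source,
      (⟨x, frameAt x₀ x (coordAt x₀ x (X x))⟩ : TangentBundle (𝓡 n) M) = ⟨x, X x⟩ := by
    intro x hx
    rw [frameAt_coordAt hx]
  rw [ContinuousAt, ← h9 x₀ (mem_extChartAt_source x₀)]
  refine h8.congr' ?_
  filter_upwards [hs] with x hx using h9 x hx

variable [RiemannianBundle (fun x : M => TangentSpace (𝓡 n) x)]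

/-- Anosov flows on a manifold whose tangent spaces carry a norm. -/
structure IsAnosovNorm (Φ : Flow ℝ M) (X : (x : M) → TangentSpace (𝓡 n) x)
    (Euu Ess : Distribution n M) : Prop where
  smooth : IsSmoothFlow n Φ
  generator : IsGenerator X Φ
  nonsingular : ∀ x, X x ≠ 0
  unstable_invariant : ∀ t x, ∀ v ∈ Euu x, tangentFlow (n := n) Φ t x v ∈ Euu (Φ t x)
  stable_invariant : ∀ t x, ∀ v ∈ Ess x, tangentFlow (n := n) Φ t x v ∈ Ess (Φ t x)
  disjoint_center_stable : ∀ x, Disjoint (centerBundle X x) (Ess x)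
  disjoint_unstable_center : ∀ x, Disjoint (Euu x) (centerBundle X x)
  isCompl_unstable : ∀ x, IsCompl (Euu x) (centerStable X Ess x)
  isCompl_stable : ∀ x, IsCompl (Ess x) (Euu x ⊔ centerBundle X x)
  stable_contracts : ∃ c > 0, ∃ ν > 0, ∀ t ≥ 0, ∀ x, ∀ v ∈ Ess x,
    ‖tangentFlow Φ t x v‖ ≤ c * Real.exp (-ν * t) * ‖v‖
  unstable_expands : ∃ c > 0, ∃ lam > 0, ∀ t ≥ 0, ∀ x, ∀ w ∈ Euu x,
    c * Real.exp (lam * t) * ‖w‖ ≤ ‖tangentFlow Φ t x w‖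

lemma norm_tangentFlow_neg_cancel (hΦ : IsSmoothFlow n Φ) (t : ℝ) (x : M)
    (v : TangentSpace (𝓡 n) x) :
    ‖tangentFlow Φ t (Φ (-t) x) (tangentFlow Φ (-t) x v)‖ = ‖v‖ :=
  congrArg (fun p : TangentBundle (𝓡 n) M => ‖p.2‖) (tangentFlowMap_cancel_neg hΦ t ⟨x, v⟩)

/-- Apply the expansion estimate at $f_{-t}x$ to the vector $Tf_{-t}v$. -/
lemma IsAnosovNorm.unstable_contracts (h : IsAnosovNorm Φ X Euu Ess) :
    ∃ c > 0, ∃ lam > 0, ∀ t ≥ 0, ∀ x, ∀ v ∈ Euu x,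
      ‖tangentFlow Φ (-t) x v‖ ≤ c * Real.exp (-lam * t) * ‖v‖ := by
  obtain ⟨c, hc, lam, hlam, H⟩ := h.unstable_expands
  refine ⟨c⁻¹, inv_pos.2 hc, lam, hlam, fun t ht x v hv => ?_⟩
  have h1 := H t ht (Φ (-t) x) _ (h.unstable_invariant (-t) x v hv)
  rw [norm_tangentFlow_neg_cancel h.smooth] at h1
  have h2 : Real.exp (-lam * t) * Real.exp (lam * t) = 1 := by
    rw [← Real.exp_add]; simp
  calc ‖tangentFlow Φ (-t) x v‖
      = c⁻¹ * Real.exp (-lam * t) * (c * Real.exp (lam * t) * ‖tangentFlow Φ (-t) x v‖) := by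
        rw [show c⁻¹ * Real.exp (-lam * t) * (c * Real.exp (lam * t) * ‖tangentFlow Φ (-t) x v‖)
          = (c⁻¹ * c) * (Real.exp (-lam * t) * Real.exp (lam * t)) * ‖tangentFlow Φ (-t) x v‖ by
          ring, h2, inv_mul_cancel₀ hc.ne', one_mul, one_mul]
    _ ≤ c⁻¹ * Real.exp (-lam * t) * ‖v‖ :=
        mul_le_mul_of_nonneg_left h1 (by positivity)

lemma norm_tangentFlow_center (hΦ : IsSmoothFlow n Φ) (hX : IsGenerator X Φ) (t : ℝ) (x : M)
    (a : ℝ) : ‖tangentFlow Φ t x (a • X x)‖ = |a| * ‖X (Φ t x)‖ := by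
  rw [map_smul, tangentFlow_generator hΦ hX, norm_smul, Real.norm_eq_abs]

lemma IsAnosovNorm.exists_decomposition (h : IsAnosovNorm Φ X Euu Ess) {x : M}
    (v : TangentSpace (𝓡 n) x) :
    ∃ u ∈ Euu x, ∃ a : ℝ, ∃ s ∈ Ess x, v = u + (a • X x + s) := by
  have hv : v ∈ Euu x ⊔ centerStable X Ess x := by
    rw [(h.isCompl_unstable x).sup_eq_top]; trivial
  obtain ⟨u, hu, w, hw, rfl⟩ := Submodule.mem_sup.1 hv
  obtain ⟨a, s, hs, rfl⟩ := mem_centerStable_iff.1 hw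
  exact ⟨u, hu, a, s, hs, rfl⟩

lemma IsAnosovNorm.centerStable_invariant (h : IsAnosovNorm Φ X Euu Ess) (t : ℝ) (x : M)
    (v : TangentSpace (𝓡 n) x) (hv : v ∈ centerStable X Ess x) :
    tangentFlow Φ t x v ∈ centerStable X Ess (Φ t x) := by
  obtain ⟨a, s, hs, rfl⟩ := mem_centerStable_iff.1 hv
  rw [map_add, map_smul, tangentFlow_generator h.smooth h.generator]
  exact mem_centerStable_iff.2 ⟨a, _, h.stable_invariant t x s hs, rfl⟩

variable [IsManifold (𝓡 n) ∞ M]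
  [IsContinuousRiemannianBundle (Model n) (fun x : M => TangentSpace (𝓡 n) x)]

lemma IsAnosovNorm.norm_generator_bounds [CompactSpace M] [Nonempty M]
    (h : IsAnosovNorm Φ X Euu Ess) : ∃ b > 0, ∃ B > 0, ∀ x, b ≤ ‖X x‖ ∧ ‖X x‖ ≤ B := by
  have hc : Continuous fun x => ‖X x‖ :=
    continuous_norm_tangentBundle.comp (continuous_generator h.smooth h.generator)
  obtain ⟨x₀, -, h₀⟩ := isCompact_univ.exists_isMinOn Set.univ_nonempty hc.continuousOn
  obtain ⟨x₁, -, h₁⟩ := isCompact_univ.exists_isMaxOn Set.univ_nonempty hc.continuousOn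
  exact ⟨‖X x₀‖, norm_pos_iff.2 (h.nonsingular x₀), ‖X x₁‖, norm_pos_iff.2 (h.nonsingular x₁),
    fun x => ⟨h₀ (Set.mem_univ x), h₁ (Set.mem_univ x)⟩⟩

/-- A field of subspaces that consists of the vectors that decay along a flow is closed. -/
lemma isClosedField_of_decay {E : Distribution n M} (hΦ : IsSmoothFlow n Φ) (σ : ℝ → ℝ)
    (θ : ℝ → ℝ) (hE : ∀ x v, v ∈ E x ↔ ∀ t ≥ 0, ‖tangentFlow Φ (σ t) x v‖ ≤ θ t * ‖v‖) :
    IsClosedField E := by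
  intro x₀ x hx
  refine isClosedFamilyAt_localFamily ?_ hx
  have : {p : TangentBundle (𝓡 n) M | p.2 ∈ E p.1} =
      ⋂ t ≥ (0 : ℝ), {p | ‖tangentFlow Φ (σ t) p.1 p.2‖ ≤ θ t * ‖p.2‖} := by
    ext p
    simp only [Set.mem_ofPred_eq, Set.mem_iInter]
    exact hE p.1 p.2
  rw [this]
  exact isClosed_biInter fun t _ => isClosed_le (continuous_norm_tangentFlowMap hΦ _)
    (continuous_const.mul continuous_norm_tangentBundle)

/-- The contraction inequality with its fixed constants characterizes $E^{ss}$: an unstable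
component would grow, and a center component stays bounded away from zero. Each inequality is a
closed condition. -/
lemma IsAnosovNorm.isClosedField_stable [CompactSpace M] [Nonempty M]
    (h : IsAnosovNorm Φ X Euu Ess) : IsClosedField Ess := by
  obtain ⟨c, hc, ν, hν, H⟩ := h.stable_contracts
  obtain ⟨c', hc', lam, hlam, H'⟩ := h.unstable_expands
  obtain ⟨b, hb, B, hB, hbB⟩ := h.norm_generator_bounds
  refine isClosedField_of_decay h.smooth (fun t => t) (fun t => c * Real.exp (-ν * t))
    fun x v => ⟨fun hv t ht => H t ht x v hv, fun hv => ?_⟩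
  obtain ⟨u, hu, a, s, hs, hvd⟩ := h.exists_decomposition v
  have hT : ∀ t, tangentFlow Φ t x v =
      tangentFlow Φ t x u + (tangentFlow Φ t x (a • X x) + tangentFlow Φ t x s) := by
    intro t; rw [hvd, map_add, map_add]
  have key := components_eq_zero (fv := fun t => ‖tangentFlow Φ t x v‖)
    (fp := fun t => ‖tangentFlow Φ t x s‖) (fq := fun t => ‖tangentFlow Φ t x (a • X x)‖)
    (fr := fun t => ‖tangentFlow Φ t x u‖) (g := fun t => c'⁻¹ * Real.exp (-lam * t) * 1)
    (a := |a| * b) (r := ‖u‖) (d := |a| * B) (by positivity) (norm_nonneg _)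
    (squeeze_zero' (Eventually.of_forall fun _ => norm_nonneg _)
      ((eventually_ge_atTop 0).mono hv) (tendsto_const_mul_exp_neg c hν ‖v‖))
    (squeeze_zero' (Eventually.of_forall fun _ => norm_nonneg _)
      ((eventually_ge_atTop 0).mono fun t ht => H t ht x s hs)
      (tendsto_const_mul_exp_neg c hν ‖s‖))
    (tendsto_const_mul_exp_neg _ hlam _)
    (fun t _ => by
      rw [norm_tangentFlow_center h.smooth h.generator]
      exact mul_le_mul_of_nonneg_left (hbB _).1 (abs_nonneg _))
    (fun t _ => by
      rw [norm_tangentFlow_center h.smooth h.generator]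
      exact mul_le_mul_of_nonneg_left (hbB _).2 (abs_nonneg _))
    (fun t _ => norm_nonneg _)
    (fun t ht => by
      have h1 := H' t ht x u hu
      have h2 : Real.exp (-lam * t) * Real.exp (lam * t) = 1 := by
        rw [← Real.exp_add]; simp
      have h3 : ‖u‖ = c'⁻¹ * Real.exp (-lam * t) * (c' * Real.exp (lam * t) * ‖u‖) := by
        rw [show c'⁻¹ * Real.exp (-lam * t) * (c' * Real.exp (lam * t) * ‖u‖)
          = (c'⁻¹ * c') * (Real.exp (-lam * t) * Real.exp (lam * t)) * ‖u‖ by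
          ring, h2, inv_mul_cancel₀ hc'.ne', one_mul, one_mul]
      rw [mul_one, h3]
      exact mul_le_mul_of_nonneg_left h1 (by positivity))
    (fun h0 t _ => by
      have : u = 0 := norm_eq_zero.1 h0
      rw [this, map_zero, norm_zero])
    (fun t _ => by
      have : tangentFlow Φ t x u = tangentFlow Φ t x v - tangentFlow Φ t x s -
        tangentFlow Φ t x (a • X x) := by rw [hT]; abel
      rw [this]
      exact (norm_sub_le _ _).trans (by gcongr; exact norm_sub_le _ _))
    (fun t _ => by
      have : tangentFlow Φ t x (a • X x) = tangentFlow Φ t x v - tangentFlow Φ t x s -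
        tangentFlow Φ t x u := by rw [hT]; abel
      rw [this]
      exact (norm_sub_le _ _).trans (by gcongr; exact norm_sub_le _ _))
  have ha : a = 0 := by
    rcases mul_eq_zero.1 key.1 with h0 | h0
    · exact abs_eq_zero.1 h0
    · exact absurd h0 hb.ne'
  have hu0 : u = 0 := norm_eq_zero.1 key.2
  rw [hvd, hu0, ha, zero_smul, zero_add, zero_add]
  exact hs

/-- The same characterization in negative time, where forward contraction of $E^{ss}$ supplies the
expanded component. -/
lemma IsAnosovNorm.isClosedField_unstable [CompactSpace M] [Nonempty M]
    (h : IsAnosovNorm Φ X Euu Ess) : IsClosedField Euu := by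
  obtain ⟨c, hc, ν, hν, H⟩ := h.stable_contracts
  obtain ⟨c', hc', lam, hlam, H'⟩ := h.unstable_contracts
  obtain ⟨b, hb, B, hB, hbB⟩ := h.norm_generator_bounds
  refine isClosedField_of_decay h.smooth (fun t => -t) (fun t => c' * Real.exp (-lam * t))
    fun x v => ⟨fun hv t ht => H' t ht x v hv, fun hv => ?_⟩
  obtain ⟨u, hu, a, s, hs, hvd⟩ := h.exists_decomposition v
  have hT : ∀ t, tangentFlow Φ (-t) x v =
      tangentFlow Φ (-t) x u + (tangentFlow Φ (-t) x (a • X x) + tangentFlow Φ (-t) x s) := by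
    intro t; rw [hvd, map_add, map_add]
  have key := components_eq_zero (fv := fun t => ‖tangentFlow Φ (-t) x v‖)
    (fp := fun t => ‖tangentFlow Φ (-t) x u‖) (fq := fun t => ‖tangentFlow Φ (-t) x (a • X x)‖)
    (fr := fun t => ‖tangentFlow Φ (-t) x s‖) (g := fun t => c * Real.exp (-ν * t) * 1)
    (a := |a| * b) (r := ‖s‖) (d := |a| * B) (by positivity) (norm_nonneg _)
    (squeeze_zero' (Eventually.of_forall fun _ => norm_nonneg _)
      ((eventually_ge_atTop 0).mono hv) (tendsto_const_mul_exp_neg c' hlam ‖v‖))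
    (squeeze_zero' (Eventually.of_forall fun _ => norm_nonneg _)
      ((eventually_ge_atTop 0).mono fun t ht => H' t ht x u hu)
      (tendsto_const_mul_exp_neg c' hlam ‖u‖))
    (tendsto_const_mul_exp_neg _ hν _)
    (fun t _ => by
      rw [norm_tangentFlow_center h.smooth h.generator]
      exact mul_le_mul_of_nonneg_left (hbB _).1 (abs_nonneg _))
    (fun t _ => by
      rw [norm_tangentFlow_center h.smooth h.generator]
      exact mul_le_mul_of_nonneg_left (hbB _).2 (abs_nonneg _))
    (fun t _ => norm_nonneg _)
    (fun t ht => by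
      have h1 := H t ht (Φ (-t) x) _ (h.stable_invariant (-t) x s hs)
      rw [norm_tangentFlow_neg_cancel h.smooth] at h1
      rwa [mul_one])
    (fun h0 t _ => by
      have : s = 0 := norm_eq_zero.1 h0
      rw [this, map_zero, norm_zero])
    (fun t _ => by
      have : tangentFlow Φ (-t) x s = tangentFlow Φ (-t) x v - tangentFlow Φ (-t) x u -
        tangentFlow Φ (-t) x (a • X x) := by rw [hT]; abel
      rw [this]
      exact (norm_sub_le _ _).trans (by gcongr; exact norm_sub_le _ _))
    (fun t _ => by
      have : tangentFlow Φ (-t) x (a • X x) = tangentFlow Φ (-t) x v - tangentFlow Φ (-t) x u -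
        tangentFlow Φ (-t) x s := by rw [hT]; abel
      rw [this]
      exact (norm_sub_le _ _).trans (by gcongr; exact norm_sub_le _ _))
  have ha : a = 0 := by
    rcases mul_eq_zero.1 key.1 with h0 | h0
    · exact abs_eq_zero.1 h0
    · exact absurd h0 hb.ne'
  have hs0 : s = 0 := norm_eq_zero.1 key.2
  rw [hvd, hs0, ha, zero_smul, zero_add, add_zero]
  exact hu

/-- Since `X` has no zeros, its line is the locus of equality in the Cauchy–Schwarz inequality,
which is closed. -/
lemma IsAnosovNorm.isClosedField_center (h : IsAnosovNorm Φ X Euu Ess) :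
    IsClosedField (centerBundle X) := by
  intro x₀ x hx
  refine isClosedFamilyAt_localFamily ?_ hx
  have hX : Continuous fun p : TangentBundle (𝓡 n) M => (⟨p.1, X p.1⟩ : TangentBundle (𝓡 n) M) :=
    (continuous_generator h.smooth h.generator).comp
      (FiberBundle.continuous_proj (Model n) (TangentSpace (𝓡 n) : M → Type _))
  have hin : Continuous fun p : TangentBundle (𝓡 n) M => inner ℝ (X p.1) p.2 :=
    Continuous.inner_bundle (F := Model n) (E := fun x : M => TangentSpace (𝓡 n) x)
      (b := fun p : TangentBundle (𝓡 n) M => p.1) hX continuous_id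
  have : {p : TangentBundle (𝓡 n) M | p.2 ∈ centerBundle X p.1} =
      {p | |inner ℝ (X p.1) p.2| = ‖X p.1‖ * ‖p.2‖} := by
    ext p
    simp only [Set.mem_ofPred_eq]
    constructor
    · intro hp
      obtain ⟨a, ha⟩ := Submodule.mem_span_singleton.1 hp
      rw [← ha, inner_smul_right, real_inner_self_eq_norm_sq, norm_smul, abs_mul, Real.norm_eq_abs,
        abs_of_nonneg (sq_nonneg ‖X p.1‖)]
      ring
    · intro hp
      by_cases h0 : p.2 = 0
      · rw [h0]; exact Submodule.zero_mem _
      · have h1 := (norm_inner_eq_norm_iff (𝕜 := ℝ) (h.nonsingular p.1) h0).1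
          (by rw [Real.norm_eq_abs]; exact hp)
        obtain ⟨r, -, hr⟩ := h1
        exact Submodule.mem_span_singleton.2 ⟨r, hr.symm⟩
  rw [this]
  exact isClosed_eq hin.abs ((continuous_norm_tangentBundle.comp hX).mul
    continuous_norm_tangentBundle)

end Anosov

end AnosovForms

namespace AnosovForms

open Bundle Filter

/-! ### Exponential decay of pullbacks. -/

section Estimates

variable {n : ℕ} {M : Type*} [TopologicalSpace M] [ChartedSpace (Model n) M]
  [IsManifold (𝓡 n) ∞ M] [RiemannianBundle (fun x : M => TangentSpace (𝓡 n) x)]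
  [IsContinuousRiemannianBundle (Model n) (fun x : M => TangentSpace (𝓡 n) x)]
  {Φ : Flow ℝ M} {X : (x : M) → TangentSpace (𝓡 n) x} {Euu Ess : Distribution n M}

lemma IsAnosovNorm.isClosedField_centerStable [CompactSpace M] [Nonempty M]
    (h : IsAnosovNorm Φ X Euu Ess) : IsClosedField (centerStable X Ess) :=
  h.isClosedField_center.sup h.isClosedField_stable h.disjoint_center_stable

/-- The tangent flow is bounded in positive time on the center stable bundle, and the stable
components of its vectors decay. -/
lemma IsAnosovNorm.centerStable_bounds [CompactSpace M] [Nonempty M]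
    (h : IsAnosovNorm Φ X Euu Ess) :
    ∃ C > 0, ∃ ν > 0, ∀ t ≥ 0, ∀ x, ∀ v ∈ centerStable X Ess x, ‖tangentFlow Φ t x v‖ ≤ C * ‖v‖ ∧
      ∃ a : ℝ, ∃ y, tangentFlow Φ t x v = a • X (Φ t x) + Real.exp (-ν * t) • y ∧
        ‖a • X (Φ t x)‖ ≤ C * ‖v‖ ∧ ‖y‖ ≤ C * ‖v‖ := by
  obtain ⟨c, hc, ν, hν, H⟩ := h.stable_contracts
  obtain ⟨b, hb, B, hB, hbB⟩ := h.norm_generator_bounds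
  -- This projection is onto $E^{ss}$ along $E^{uu}\oplus E^c$; its norm bound controls the stable
  -- component by the whole vector.
  obtain ⟨P, hP1, hP2⟩ := exists_projection h.isCompl_stable
  obtain ⟨K, hK, hPK⟩ := exists_norm_endomorphism_le (continuousOn_localEnd
    h.isClosedField_stable (h.isClosedField_unstable.sup h.isClosedField_center
      h.disjoint_unstable_center) (fun x => (h.isCompl_stable x).disjoint) hP1 hP2)
  -- The first summand bounds the center part, whose coefficient is constant in time while the
  -- length of `X` stays between `b` and `B`; the second bounds the stable part.
  refine ⟨B / b * (1 + K) + c * K, by positivity, ν, hν, fun t ht x v hv => ?_⟩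
  obtain ⟨a, s, hs, hvd⟩ := mem_centerStable_iff.1 hv
  have hPs : P x v = s := projection_apply_eq (fun x => (h.isCompl_stable x).disjoint) hP1 hP2 hs (by
    rw [hvd, add_sub_cancel_right]
    exact Submodule.mem_sup_right (Submodule.mem_span_singleton.2 ⟨a, rfl⟩))
  have hs1 : ‖s‖ ≤ K * ‖v‖ := hPs ▸ hPK x v
  have ha1 : ‖a • X x‖ ≤ (1 + K) * ‖v‖ := by
    have : a • X x = v - s := by rw [hvd, add_sub_cancel_right]
    rw [this]
    linarith [norm_sub_le v s]
  have ha2 : ‖a • X (Φ t x)‖ ≤ B / b * (1 + K) * ‖v‖ := by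
    rw [norm_smul] at ha1 ⊢
    have h1 : ‖X (Φ t x)‖ ≤ B / b * ‖X x‖ := by
      rw [div_mul_eq_mul_div, le_div_iff₀ hb]
      exact mul_le_mul (hbB _).2 (hbB x).1 hb.le hB.le
    calc ‖a‖ * ‖X (Φ t x)‖ ≤ ‖a‖ * (B / b * ‖X x‖) :=
          mul_le_mul_of_nonneg_left h1 (norm_nonneg _)
      _ = B / b * (‖a‖ * ‖X x‖) := by ring
      _ ≤ B / b * ((1 + K) * ‖v‖) := mul_le_mul_of_nonneg_left ha1 (by positivity)
      _ = _ := by ring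
  have hs2 : ‖tangentFlow Φ t x s‖ ≤ Real.exp (-ν * t) * (c * K * ‖v‖) := by
    calc ‖tangentFlow Φ t x s‖ ≤ c * Real.exp (-ν * t) * ‖s‖ := H t ht x s hs
      _ ≤ c * Real.exp (-ν * t) * (K * ‖v‖) := mul_le_mul_of_nonneg_left hs1 (by positivity)
      _ = _ := by ring
  have hexp : Real.exp (-ν * t) ≤ 1 := by
    rw [Real.exp_le_one_iff]
    nlinarith
  have hT : tangentFlow Φ t x v = a • X (Φ t x) + tangentFlow Φ t x s := by
    rw [hvd, map_add, map_smul, tangentFlow_generator h.smooth h.generator]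
  have hvn := norm_nonneg v
  have hcK : 0 ≤ c * K * ‖v‖ := by positivity
  have hBK : 0 ≤ B / b * (1 + K) * ‖v‖ := by positivity
  refine ⟨?_, a, Real.exp (ν * t) • tangentFlow Φ t x s, ?_, ?_, ?_⟩
  · rw [hT]
    refine (norm_add_le _ _).trans ?_
    have : Real.exp (-ν * t) * (c * K * ‖v‖) ≤ 1 * (c * K * ‖v‖) :=
      mul_le_mul_of_nonneg_right hexp hcK
    linarith
  · rw [smul_smul, ← Real.exp_add, hT]
    simp
  · linarith
  · rw [norm_smul, Real.norm_of_nonneg (Real.exp_pos _).le]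
    have h2 : Real.exp (ν * t) * Real.exp (-ν * t) = 1 := by
      rw [← Real.exp_add]; simp
    have h3 : Real.exp (ν * t) * ‖tangentFlow Φ t x s‖ ≤
        Real.exp (ν * t) * (Real.exp (-ν * t) * (c * K * ‖v‖)) :=
      mul_le_mul_of_nonneg_left hs2 (Real.exp_pos _).le
    rw [← mul_assoc, h2, one_mul] at h3
    linarith

/-- In positive time, the pullbacks of a form decay on the center stable bundle. -/
lemma IsAnosovNorm.decay_centerStable [CompactSpace M] [Nonempty M]
    (h : IsAnosovNorm Φ X Euu Ess) {k : ℕ} (hk : 2 ≤ k) {ξ : Form n k M}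
    (hξ : IsFormOfClass 0 ξ) :
    ∃ C > 0, ∃ ν > 0, ∀ t ≥ 0, ∀ x, ∀ v : Fin k → TangentSpace (𝓡 n) x,
      (∀ i, v i ∈ centerStable X Ess x) →
      |flowPullback Φ t ξ x v| ≤ C * Real.exp (-ν * t) * ∏ i, ‖v i‖ := by
  obtain ⟨K, hK, hξK⟩ := exists_norm_form_le hξ
  obtain ⟨C, hC, ν, hν, H⟩ := h.centerStable_bounds
  refine ⟨2 * (K * C ^ k), by positivity, ν, hν, fun t ht x v hv => ?_⟩
  have hbound : ∀ w : Fin k → TangentSpace (𝓡 n) (Φ t x), (∀ i, ‖w i‖ ≤ C * ‖v i‖) →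
      |ξ (Φ t x) w| ≤ K * C ^ k * ∏ i, ‖v i‖ := by
    intro w hw
    refine (hξK _ w).trans ?_
    rw [mul_assoc]
    refine mul_le_mul_of_nonneg_left ?_ hK.le
    calc ∏ i, ‖w i‖ ≤ ∏ i, C * ‖v i‖ :=
          Finset.prod_le_prod (fun _ _ => norm_nonneg _) fun i _ => hw i
      _ = C ^ k * ∏ i, ‖v i‖ := by simp [Finset.prod_mul_distrib]
  set w : Fin k → TangentSpace (𝓡 n) (Φ t x) := fun i => tangentFlow Φ t x (v i) with hw
  have hwb : ∀ i, ‖w i‖ ≤ C * ‖v i‖ := fun i => (H t ht x _ (hv i)).1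
  let i : Fin k := ⟨0, by omega⟩
  let j : Fin k := ⟨1, by omega⟩
  have hij : i ≠ j := by simp [i, j, Fin.ext_iff]
  obtain ⟨-, a, y, hy, ha1, hy1⟩ := H t ht x _ (hv i)
  obtain ⟨-, a', y', hy', ha1', hy1'⟩ := H t ht x _ (hv j)
  set e := Real.exp (-ν * t)
  set Y := X (Φ t x)
  set w₁ := Function.update w i (a • Y)
  -- Split the slots `i` and `j` in turn into generator and stable parts; every term but the one
  -- with the generator in both carries a factor `e`.
  have e1 : ξ (Φ t x) w = ξ (Φ t x) w₁ + e * ξ (Φ t x) (Function.update w i y) := by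
    have : w = Function.update w i (a • Y + e • y) := by
      rw [← hy]
      exact (Function.update_eq_self i w).symm
    conv_lhs => rw [this]
    rw [ContinuousAlternatingMap.map_update_add,
      ContinuousAlternatingMap.map_update_smul _ _ _ e, smul_eq_mul]
  have e2 : ξ (Φ t x) w₁ = e * ξ (Φ t x) (Function.update w₁ j y') := by
    have : w₁ = Function.update w₁ j (a' • Y + e • y') := by
      rw [← hy']
      have : tangentFlow Φ t x (v j) = w₁ j := by
        simp [w₁, Function.update_of_ne hij.symm, hw]
      rw [this]
      exact (Function.update_eq_self j w₁).symm
    conv_lhs => rw [this]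
    rw [ContinuousAlternatingMap.map_update_add, ContinuousAlternatingMap.map_update_smul,
      ContinuousAlternatingMap.map_update_smul]
    -- Two slots hold multiples of the same vector. This is where degree at least 2 is needed.
    have h0 : ξ (Φ t x) (Function.update w₁ j Y) = 0 := by
      have h1 : Function.update w₁ j Y = Function.update (Function.update w j Y) i (a • Y) := by
        rw [Function.update_comm hij]
      rw [h1, ContinuousAlternatingMap.map_update_smul,
        ContinuousAlternatingMap.map_eq_zero_of_eq _ _ (i := i) (j := j) _ hij, smul_zero]
      rw [Function.update_self, Function.update_of_ne hij.symm, Function.update_self]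
    rw [h0, smul_zero, zero_add, smul_eq_mul]
  have hub : ∀ (u : Fin k → TangentSpace (𝓡 n) (Φ t x)) (l : Fin k) (z), (∀ m, ‖u m‖ ≤ C * ‖v m‖) →
      ‖z‖ ≤ C * ‖v l‖ → ∀ m, ‖Function.update u l z m‖ ≤ C * ‖v m‖ := by
    intro u l z hu hz m
    by_cases hml : m = l
    · subst hml; rwa [Function.update_self]
    · rw [Function.update_of_ne hml]; exact hu m
  have b1 := hbound _ (hub w i y hwb hy1)
  have b2 := hbound _ (hub w₁ j y' (hub w i (a • Y) hwb ha1) hy1')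
  have he : 0 ≤ e := (Real.exp_pos _).le
  rw [flowPullback_apply]
  change |ξ (Φ t x) w| ≤ _
  rw [e1, e2]
  refine (abs_add_le _ _).trans ?_
  rw [abs_mul, abs_mul, abs_of_nonneg he]
  calc e * |ξ (Φ t x) (Function.update w₁ j y')| + e * |ξ (Φ t x) (Function.update w i y)|
      ≤ e * (K * C ^ k * ∏ i, ‖v i‖) + e * (K * C ^ k * ∏ i, ‖v i‖) := by gcongr
    _ = _ := by ring

/-- Asymmetry of the flow, for a manifold whose tangent spaces carry a norm. -/
def IsAsymmetricNorm (Φ : Flow ℝ M) (Euu : Distribution n M) : Prop :=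
  ∃ C > 0, ∃ lam > 0, ∀ m, m + 2 = n → ∀ t ≥ 0, ∀ x, ∀ v : Fin m → TangentSpace (𝓡 n) x,
    (∃ i, v i ∈ Euu x) →
      gramVol (fun i => tangentFlow Φ (-t) x (v i)) ≤ C * Real.exp (-lam * t) * gramVol v

/-- The projection is onto $E^{cs}$ along $E^{uu}$. It commutes with the tangent flow since both
bundles are invariant, and is bounded since closedness of the bundles makes it continuous on a
compact manifold. -/
lemma IsAnosovNorm.exists_unstable_projection [CompactSpace M] [Nonempty M]
    (h : IsAnosovNorm Φ X Euu Ess) :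
    ∃ P : (x : M) → TangentSpace (𝓡 n) x →L[ℝ] TangentSpace (𝓡 n) x,
      (∀ x v, P x v ∈ centerStable X Ess x) ∧ (∀ x v, v - P x v ∈ Euu x) ∧
      (∀ x₀, ContinuousOn (localEnd P x₀) (extChartAt (𝓡 n) x₀).source) ∧
      (∀ x v, v ∈ centerStable X Ess x → P x v = v) ∧ (∀ x v, v ∈ Euu x → P x v = 0) ∧
      (∀ t x v, P (Φ t x) (tangentFlow Φ t x v) = tangentFlow Φ t x (P x v)) ∧
      ∃ K > 0, ∀ x v, ‖P x v‖ ≤ K * ‖v‖ := by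
  have hd : ∀ x, Disjoint (centerStable X Ess x) (Euu x) :=
    fun x => (h.isCompl_unstable x).disjoint.symm
  obtain ⟨P, hP1, hP2⟩ := exists_projection fun x => (h.isCompl_unstable x).symm
  have hc := continuousOn_localEnd h.isClosedField_centerStable h.isClosedField_unstable hd hP1 hP2
  refine ⟨P, hP1, hP2, hc, fun x v hv => ?_, fun x v hv => ?_, fun t x v => ?_,
    exists_norm_endomorphism_le hc⟩
  · exact projection_apply_eq hd hP1 hP2 hv (by rw [sub_self]; exact Submodule.zero_mem _)
  · exact projection_apply_eq hd hP1 hP2 (Submodule.zero_mem _) (by rwa [sub_zero])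
  · refine projection_apply_eq hd hP1 hP2 (h.centerStable_invariant t x _ (hP1 x v)) ?_
    rw [← map_sub]
    exact h.unstable_invariant t x _ (hP2 x v)

/-- In negative time, volumes of parallelepipeds with a side in the unstable bundle decay. -/
lemma IsAnosovNorm.decay_volume [CompactSpace M] [Nonempty M]
    (h : IsAnosovNorm Φ X Euu Ess) (ha : IsAsymmetricNorm Φ Euu)
    (P : (x : M) → TangentSpace (𝓡 n) x →L[ℝ] TangentSpace (𝓡 n) x)
    (hP1 : ∀ x v, P x v ∈ centerStable X Ess x)
    (hPT : ∀ t x v, P (Φ t x) (tangentFlow Φ t x v) = tangentFlow Φ t x (P x v))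
    (hPid : ∀ x v, v ∈ centerStable X Ess x → P x v = v)
    {K : ℝ} (hK : 0 < K) (hPK : ∀ x v, ‖P x v‖ ≤ K * ‖v‖) :
    ∃ c > 0, ∃ C > 0, ∃ μ > 0, ∀ r m, m + r + 2 = n → ∀ x, ∀ z : Fin m → TangentSpace (𝓡 n) x,
      (∃ i, z i ∈ Euu x) → (∀ i, ‖z i‖ ≤ 1) →
      Module.finrank ℝ (Submodule.span ℝ (Set.range fun i => P x (z i))) + r ≤
        Module.finrank ℝ (centerStable X Ess x) →
      ∀ t ≥ 0, c ^ r * gramVol (fun i => tangentFlow Φ (-t) x (z i)) ≤ C * Real.exp (-μ * t) := by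
  obtain ⟨C, hC, μ, hμ, H⟩ := ha
  obtain ⟨D, hD, _, _, HD⟩ := h.centerStable_bounds
  -- Vectors of $E^{cs}$ grow at most by the factor `D` forward, so they shrink at most by that
  -- factor backward.
  have hback : ∀ t ≥ 0, ∀ x, ∀ v ∈ centerStable X Ess x, ‖v‖ ≤ D * ‖tangentFlow Φ (-t) x v‖ := by
    intro t ht x v hv
    have h1 := (HD t ht (Φ (-t) x) _ (h.centerStable_invariant (-t) x v hv)).1
    rwa [norm_tangentFlow_neg_cancel h.smooth] at h1
  -- Each added side costs one such factor: `D` comes from `hback` and `K` from the projection.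
  refine ⟨(K * D)⁻¹, by positivity, C, hC, μ, hμ, fun r => ?_⟩
  induction r with
  | zero =>
    intro m hm x z hz hz1 _ t ht
    rw [pow_zero, one_mul]
    refine (H m (by omega) t ht x z hz).trans ?_
    have h1 : gramVol z ≤ 1 := (gramVol_le_prod z).trans
      (Finset.prod_le_one (fun _ _ => norm_nonneg _) fun i _ => hz1 i)
    exact mul_le_of_le_one_right (by positivity) h1
  | succ r ih =>
    intro m hm x z hz hz1 hdim t ht
    -- The rank hypothesis leaves a direction in $E^{cs}$ orthogonal to all projected sides. Adding
    -- it raises the rank by at most 1, while `r` drops by 1.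
    obtain ⟨w, hwE, hw1, hwo⟩ := exists_unit_mem_orthogonal (centerStable X Ess x)
      (Submodule.span ℝ (Set.range fun i => P x (z i))) (by omega)
    have hih := ih (m + 1) (by omega) x (Fin.cons w z) (by
        obtain ⟨i, hi⟩ := hz
        exact ⟨i.succ, by simpa using hi⟩) (by
        intro i
        refine Fin.cases ?_ (fun i => ?_) i
        · simpa using hw1.le
        · simpa using hz1 i) (by
        have hr : (Set.range fun i => P x ((Fin.cons w z : Fin (m + 1) → TangentSpace (𝓡 n) x) i)) =
            insert (P x w) (Set.range fun i => P x (z i)) := by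
          ext y
          simp [Fin.exists_fin_succ, eq_comm]
        rw [hr, Submodule.span_insert]
        have h1 := Submodule.finrank_add_le_finrank_add_finrank
          (Submodule.span ℝ {P x w}) (Submodule.span ℝ (Set.range fun i => P x (z i)))
        have h2 := finrank_span_le_card (R := ℝ) ({P x w} : Set (TangentSpace (𝓡 n) x))
        simp at h2
        omega) t ht
    have hcons : (fun i => tangentFlow Φ (-t) x
        ((Fin.cons w z : Fin (m + 1) → TangentSpace (𝓡 n) x) i)) =
        Fin.cons (tangentFlow Φ (-t) x w) (fun i => tangentFlow Φ (-t) x (z i)) := by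
      funext i
      refine Fin.cases ?_ (fun i => ?_) i <;> simp
    rw [hcons] at hih
    refine le_trans ?_ hih
    rw [pow_succ, mul_assoc]
    refine mul_le_mul_of_nonneg_left ?_ (by positivity)
    -- It suffices to bound the distance of the new image side from the span of the old ones.
    -- Applying `P` to a difference gives the image of `w - P x z'`, a vector of $E^{cs}$ of norm at
    -- least 1 by orthogonality.
    refine le_gramVol_cons _ _ fun u hu => ?_
    have hu' : u ∈ (Submodule.span ℝ (Set.range z)).map (tangentFlow Φ (-t) x).toLinearMap := by
      rw [Submodule.map_span, ← Set.range_comp]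
      exact hu
    obtain ⟨z', hz', rfl⟩ := hu'
    have hPz : P x z' ∈ Submodule.span ℝ (Set.range fun i => P x (z i)) := by
      have : P x z' ∈ (Submodule.span ℝ (Set.range z)).map (P x).toLinearMap := ⟨z', hz', rfl⟩
      rw [Submodule.map_span, ← Set.range_comp] at this
      exact this
    have h1 : (1 : ℝ) ≤ ‖w - P x z'‖ := by
      have h2 : inner ℝ w (P x z') = 0 := by
        rw [real_inner_comm]; exact hwo _ hPz
      have h3 : ‖w - P x z'‖ ^ 2 = 1 + ‖P x z'‖ ^ 2 := by
        rw [norm_sub_sq_real, h2, hw1]; ring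
      have h4 : (1 : ℝ) ^ 2 ≤ ‖w - P x z'‖ ^ 2 := by
        rw [h3]; nlinarith [sq_nonneg ‖P x z'‖]
      exact abs_le_of_sq_le_sq' h4 (norm_nonneg _) |>.2
    have h2 := hback t ht x _ ((centerStable X Ess x).sub_mem hwE (hP1 x z'))
    have h3 : tangentFlow Φ (-t) x (w - P x z') =
        P (Φ (-t) x) (tangentFlow Φ (-t) x w - tangentFlow Φ (-t) x z') := by
      rw [← map_sub, hPT, map_sub (P x), hPid x w hwE]
    rw [h3] at h2
    have h5 := hPK (Φ (-t) x) (tangentFlow Φ (-t) x w - tangentFlow Φ (-t) x z')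
    have h6 : 1 ≤ K * D * ‖tangentFlow Φ (-t) x w - tangentFlow Φ (-t) x z'‖ := by
      calc (1 : ℝ) ≤ _ := h1.trans h2
        _ ≤ D * (K * ‖tangentFlow Φ (-t) x w - tangentFlow Φ (-t) x z'‖) :=
          mul_le_mul_of_nonneg_left h5 hD.le
        _ = _ := by ring
    have hKD : 0 < K * D := by positivity
    rw [inv_le_iff_one_le_mul₀' hKD]
    exact h6

/-- In negative time, the pullbacks of a form decay on families of vectors one of which belongs to
the unstable bundle. -/
lemma IsAnosovNorm.decay_unstable [CompactSpace M] [Nonempty M]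
    (h : IsAnosovNorm Φ X Euu Ess) (ha : IsAsymmetricNorm Φ Euu)
    (hdim : ∀ x, Module.finrank ℝ (Euu x) ≤ 3) {k : ℕ} (hkn : k + 2 ≤ n) {ξ : Form n k M}
    (hξ : IsFormOfClass 0 ξ) :
    ∃ C > 0, ∃ μ > 0, ∀ t ≥ 0, ∀ x, ∀ v : Fin k → TangentSpace (𝓡 n) x, (∃ i, v i ∈ Euu x) →
      |flowPullback Φ (-t) ξ x v| ≤ C * Real.exp (-μ * t) * ∏ i, ‖v i‖ := by
  obtain ⟨P, hP1, -, -, hPid, hP0, hPT, K, hK, hPK⟩ := h.exists_unstable_projection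
  obtain ⟨c, hc, C, hC, μ, hμ, H⟩ := h.decay_volume ha P hP1 hPT hPid hK hPK
  obtain ⟨B, hB, hξB⟩ := exists_norm_form_le hξ
  obtain ⟨r, hr⟩ : ∃ r, k + r + 2 = n := ⟨n - 2 - k, by omega⟩
  refine ⟨B * ((c ^ r)⁻¹ * C), by positivity, μ, hμ, fun t ht x v hv => ?_⟩
  have hunit : ∀ z : Fin k → TangentSpace (𝓡 n) x, (∃ i, z i ∈ Euu x) → (∀ i, ‖z i‖ ≤ 1) →
      |flowPullback Φ (-t) ξ x z| ≤ B * ((c ^ r)⁻¹ * C) * Real.exp (-μ * t) := by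
    intro z hz hz1
    have h1 : ‖ξ (Φ (-t) x)‖ ≤ B :=
      ContinuousAlternatingMap.opNorm_le_bound _ hB.le fun m => hξB _ m
    -- The side in $E^{uu}$ is killed by `P`, so the projected sides have rank at most `k - 1`.
    have hrank : Module.finrank ℝ (Submodule.span ℝ (Set.range fun i => P x (z i))) + 1 ≤ k := by
      have h2 : Module.finrank ℝ (Submodule.span ℝ (Set.range fun i => P x (z i))) ≤ k := by
        have := finrank_range_le_card (R := ℝ) (fun i => P x (z i))
        simpa [Set.finrank] using this
      have h3 : Module.finrank ℝ (Submodule.span ℝ (Set.range fun i => P x (z i))) ≠ k := by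
        intro h4
        have h5 : LinearIndependent ℝ fun i => P x (z i) := by
          rw [linearIndependent_iff_card_eq_finrank_span, Fintype.card_fin]
          exact h4.symm
        obtain ⟨i, hi⟩ := hz
        exact h5.ne_zero i (hP0 x _ hi)
      omega
    have hsum := Submodule.finrank_add_eq_of_isCompl (h.isCompl_unstable x)
    rw [finrank_tangentSpace] at hsum
    have hd := hdim x
    -- The arithmetic is $(k-1)+r=n-3\le\dim E^{cs}$, which uses $\dim E^{uu}\le 3$.
    have h2 := H r k hr x z hz hz1 (by omega) t ht
    have h3 : gramVol (fun i => tangentFlow Φ (-t) x (z i)) ≤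
        (c ^ r)⁻¹ * C * Real.exp (-μ * t) := by
      rw [mul_assoc, ← div_eq_inv_mul, le_div_iff₀' (by positivity)]
      exact h2
    rw [flowPullback_apply]
    refine (abs_alternating_le_gramVol _ _).trans ?_
    calc ‖ξ (Φ (-t) x)‖ * gramVol (fun i => tangentFlow Φ (-t) x (z i))
        ≤ B * ((c ^ r)⁻¹ * C * Real.exp (-μ * t)) :=
          mul_le_mul h1 h3 (gramVol_nonneg _) hB.le
      _ = _ := by ring
  -- Zero vectors need no separate treatment, as both sides vanish with the convention $0^{-1}=0$.
  have hscale : v = fun i => ‖v i‖ • (‖v i‖⁻¹ • v i) := by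
    funext i
    by_cases h0 : v i = 0
    · rw [h0]; simp
    · rw [smul_inv_smul₀ (norm_ne_zero_iff.2 h0)]
  have h1 : flowPullback Φ (-t) ξ x v =
      (∏ i, ‖v i‖) * flowPullback Φ (-t) ξ x (fun i => ‖v i‖⁻¹ • v i) := by
    conv_lhs => rw [hscale]
    rw [ContinuousAlternatingMap.map_smul_univ, smul_eq_mul]
  rw [h1, abs_mul, abs_of_nonneg (Finset.prod_nonneg fun _ _ => norm_nonneg _), mul_comm]
  refine mul_le_mul_of_nonneg_right (hunit _ ?_ fun i => ?_)
    (Finset.prod_nonneg fun _ _ => norm_nonneg _)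
  · obtain ⟨i, hi⟩ := hv
    exact ⟨i, (Euu x).smul_mem _ hi⟩
  · rw [norm_smul, norm_inv, norm_norm]
    exact inv_mul_le_one

end Estimates

end AnosovForms

namespace AnosovForms

open Bundle Filter MeasureTheory

/-! ### Total volume and the dimension of the unstable bundle. -/

section Volume

/-- By Hadamard's inequality the image of an orthonormal basis has volume at most `C ^ m`, and all
volumes scale by that same factor. -/
lemma gramVol_map_le {V V' : Type*} [NormedAddCommGroup V] [InnerProductSpace ℝ V]
    [FiniteDimensional ℝ V] [NormedAddCommGroup V'] [InnerProductSpace ℝ V']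
    [FiniteDimensional ℝ V'] {m : ℕ} (hV : Module.finrank ℝ V = m) (hV' : Module.finrank ℝ V' = m)
    (A : V →ₗ[ℝ] V') {C : ℝ} (hA : ∀ v, ‖A v‖ ≤ C * ‖v‖) (v : Fin m → V) :
    gramVol (fun i => A (v i)) ≤ C ^ m * gramVol v := by
  let b := (stdOrthonormalBasis ℝ V).reindex (finCongr hV)
  let b' := (stdOrthonormalBasis ℝ V').reindex (finCongr hV')
  rw [gramVol_map b b' A v]
  refine mul_le_mul_of_nonneg_right ((gramVol_le_prod _).trans ?_) (gramVol_nonneg v)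
  calc ∏ i, ‖A (b i)‖ ≤ ∏ _i : Fin m, C := Finset.prod_le_prod (fun _ _ => norm_nonneg _)
        fun i _ => by simpa using hA (b i)
    _ = C ^ m := by simp

lemma abs_det_eq_gramVol {n : ℕ} (A : Model n →ₗ[ℝ] Model n) :
    |LinearMap.det A| = gramVol (fun i => A (EuclideanSpace.basisFun (Fin n) ℝ i)) := by
  rw [gramVol_eq_abs_det (EuclideanSpace.basisFun (Fin n) ℝ)]
  congr 1
  have := (EuclideanSpace.basisFun (Fin n) ℝ).toBasis.det_comp A
    (EuclideanSpace.basisFun (Fin n) ℝ).toBasis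
  rw [Module.Basis.det_self, mul_one] at this
  rw [← this]
  congr 1

lemma gramVol_le_mul_gramVol {V : Type*} [NormedAddCommGroup V] [InnerProductSpace ℝ V] {m : ℕ}
    (v : Fin (m + 2) → V) :
    gramVol v ≤ ‖v 0‖ * (‖v 1‖ * gramVol fun i : Fin m => v i.succ.succ) := by
  have h1 := gramVol_cons_le (Fin.tail v) (v 0)
  have h2 := gramVol_cons_le (Fin.tail (Fin.tail v)) (Fin.tail v 0)
  rw [Fin.cons_self_tail] at h1 h2
  exact h1.trans (mul_le_mul_of_nonneg_left h2 (norm_nonneg _))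

variable {n : ℕ} {M : Type*} [TopologicalSpace M] [ChartedSpace (Model n) M]
  [RiemannianBundle (fun x : M => TangentSpace (𝓡 n) x)] {Φ : Flow ℝ M}

lemma gramVol_tangentFlow (t : ℝ) (x : M)
    (b : OrthonormalBasis (Fin n) ℝ (TangentSpace (𝓡 n) x)) (v : Fin n → TangentSpace (𝓡 n) x) :
    gramVol (fun i => tangentFlow Φ t x (v i)) =
      gramVol (fun i => tangentFlow Φ t x (b i)) * gramVol v :=
  gramVol_map (V := TangentSpace (𝓡 n) x) (V' := TangentSpace (𝓡 n) (Φ t x)) b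
    ((stdOrthonormalBasis ℝ (TangentSpace (𝓡 n) (Φ t x))).reindex
      (finCongr (finrank_tangentSpace (Φ t x)))) (tangentFlow Φ t x).toLinearMap v

variable [IsManifold (𝓡 n) ∞ M]

lemma gramVol_frameAt_le {x₀ x : M} {D : ℝ} (h : ∀ w : Model n, ‖frameAt x₀ x w‖ ≤ D * ‖w‖)
    (w : Fin n → Model n) : gramVol (fun i => frameAt x₀ x (w i)) ≤ D ^ n * gramVol w :=
  gramVol_map_le (V := Model n) (V' := TangentSpace (𝓡 n) x)
    (finrank_euclideanSpace_fin (𝕜 := ℝ) (n := n)) (finrank_tangentSpace x)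
    (frameAt x₀ x).toLinearMap h w

lemma gramVol_coordAt_le {x₀ x : M} {D : ℝ}
    (h : ∀ v : TangentSpace (𝓡 n) x, ‖coordAt x₀ x v‖ ≤ D * ‖v‖)
    (v : Fin n → TangentSpace (𝓡 n) x) :
    gramVol (fun i => coordAt x₀ x (v i)) ≤ D ^ n * gramVol v :=
  gramVol_map_le (V := TangentSpace (𝓡 n) x) (V' := Model n) (finrank_tangentSpace x)
    (finrank_euclideanSpace_fin (𝕜 := ℝ) (n := n)) (coordAt x₀ x).toLinearMap h v

/-- A bound for the Jacobian of the flow in charts in terms of the change of volumes. -/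
lemma abs_det_flowDerivInCharts_le (hΦ : IsSmoothFlow n Φ) {x₀ x₁ x : M} {t D ε : ℝ} (hD : 0 ≤ D)
    (hε : 0 ≤ ε) (hx₀ : x ∈ (extChartAt (𝓡 n) x₀).source)
    (hx₁ : Φ t x ∈ (extChartAt (𝓡 n) x₁).source)
    (h₀ : ∀ w : Model n, ‖frameAt x₀ x w‖ ≤ D * ‖w‖)
    (h₁ : ∀ v : TangentSpace (𝓡 n) (Φ t x), ‖coordAt x₁ (Φ t x) v‖ ≤ D * ‖v‖)
    (h : ∀ v : Fin n → TangentSpace (𝓡 n) x,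
      gramVol (fun i => tangentFlow Φ t x (v i)) ≤ ε * gramVol v) :
    |(flowDerivInCharts Φ x₀ x₁ (t, extChartAt (𝓡 n) x₀ x)).det| ≤ D ^ n * D ^ n * ε := by
  obtain ⟨y, hy, hxy⟩ : ∃ y ∈ (extChartAt (𝓡 n) x₀).target, (extChartAt (𝓡 n) x₀).symm y = x :=
    ⟨_, (extChartAt (𝓡 n) x₀).map_source hx₀, (extChartAt (𝓡 n) x₀).left_inv hx₀⟩
  subst hxy
  rw [(extChartAt (𝓡 n) x₀).right_inv hy]
  set L := flowDerivInCharts Φ x₀ x₁ (t, y)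
  set e := EuclideanSpace.basisFun (Fin n) ℝ
  set z := (extChartAt (𝓡 n) x₀).symm y
  have h1 : gramVol (fun i => L (e i)) ≤
      D ^ n * gramVol (fun i => frameAt x₁ (Φ t z) (L (e i))) := by
    refine le_trans (le_of_eq ?_)
      (gramVol_coordAt_le h₁ (fun i => frameAt x₁ (Φ t z) (L (e i))))
    congr 1
    funext i
    exact (coordAt_frameAt hx₁ _).symm
  have h2 : gramVol (fun i => frameAt x₁ (Φ t z) (L (e i))) ≤
      ε * gramVol (fun i => frameAt x₀ z (e i)) := by
    refine le_trans (le_of_eq ?_) (h fun i => frameAt x₀ z (e i))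
    congr 1
    funext i
    exact (tangentFlow_frameAt hΦ ⟨hy, hx₁⟩ (e i)).symm
  have h3 : gramVol (fun i => frameAt x₀ z (e i)) ≤ D ^ n * 1 := by
    refine (gramVol_frameAt_le h₀ (fun i => e i)).trans
      (mul_le_mul_of_nonneg_left ((gramVol_le_prod _).trans (le_of_eq ?_)) (by positivity))
    simp [e]
  have h5 : |L.det| = gramVol (fun i => L (e i)) := abs_det_eq_gramVol L.toLinearMap
  rw [h5]
  calc gramVol (fun i => L (e i)) ≤ D ^ n * (ε * (D ^ n * 1)) :=
        h1.trans (mul_le_mul_of_nonneg_left (h2.trans (mul_le_mul_of_nonneg_left h3 hε))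
          (by positivity))
    _ = _ := by ring

variable [IsContinuousRiemannianBundle (Model n) (fun x : M => TangentSpace (𝓡 n) x)]

/-- The maps of a smooth flow on a compact manifold cannot shrink all volumes by arbitrarily small
factors. -/
lemma exists_lt_gramVol_tangentFlow [CompactSpace M] [T2Space M] [Nonempty M]
    (hΦ : IsSmoothFlow n Φ) :
    ∃ ε > 0, ∀ t, ∃ x, ∃ v : Fin n → TangentSpace (𝓡 n) x,
      ε * gramVol v < gramVol (fun i => tangentFlow Φ t x (v i)) := by
  have hloc : ∀ x₀ : M, ∃ K ∈ 𝓝 x₀, IsCompact K ∧ K ⊆ (extChartAt (𝓡 n) x₀).source ∧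
      ∃ C > 0, ∀ x ∈ K, (∀ w : Model n, ‖frameAt x₀ x w‖ ≤ C * ‖w‖) ∧
        ∀ v : TangentSpace (𝓡 n) x, ‖coordAt x₀ x v‖ ≤ C * ‖v‖ := by
    intro x₀
    obtain ⟨C, hC, h⟩ := eventually_norm_coordAt_le (n := n) x₀
    obtain ⟨C', hC', h'⟩ := eventually_norm_frameAt_le (n := n) x₀
    obtain ⟨K, hK, hKs, hKc⟩ := local_compact_nhds
      (inter_mem (inter_mem h h') (extChartAt_source_mem_nhds (I := 𝓡 n) x₀))
    refine ⟨K, hK, hKc, fun x hx => (hKs hx).2, max C C', lt_max_of_lt_left hC, fun x hx =>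
      ⟨fun w => ((hKs hx).1.2 w).trans ?_, fun v => ((hKs hx).1.1 v).trans ?_⟩⟩
    · exact mul_le_mul_of_nonneg_right (le_max_right _ _) (norm_nonneg _)
    · exact mul_le_mul_of_nonneg_right (le_max_left _ _) (norm_nonneg _)
  choose K hKn hKc hKs C hC hCK using hloc
  obtain ⟨s, hs⟩ := CompactSpace.elim_nhds_subcover K hKn
  obtain ⟨D, hD, hCD⟩ : ∃ D > 0, ∀ x₀ ∈ s, C x₀ ≤ D :=
    ⟨1 + ∑ x ∈ s, C x, by have := Finset.sum_nonneg fun x (_ : x ∈ s) => (hC x).le; linarith,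
      fun x₀ hx₀ => by
        have := Finset.single_le_sum (fun x _ => (hC x).le) hx₀
        linarith⟩
  let A : M → Set (Model n) := fun x₀ => extChartAt (𝓡 n) x₀ '' K x₀
  have hAfin : ∀ x₀, volume (A x₀) ≠ ⊤ := fun x₀ =>
    ((hKc x₀).image_of_continuousOn ((continuousOn_extChartAt x₀).mono
      (hKs x₀))).measure_lt_top.ne
  have hcover : ∀ x, ∃ x₀ ∈ s, x ∈ K x₀ := by
    intro x
    have : x ∈ ⋃ x₀ ∈ s, K x₀ := hs ▸ Set.mem_univ x
    simpa using this
  have hApos : ∀ x₀, volume (A x₀) ≠ 0 := by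
    intro x₀
    have h1 : A x₀ ∈ 𝓝 (extChartAt (𝓡 n) x₀ x₀) := by
      rw [← map_extChartAt_nhds_of_boundaryless (I := 𝓡 n) x₀]
      exact image_mem_map (hKn x₀)
    exact (Measure.measure_pos_of_mem_nhds volume h1).ne'
  -- Lebesgue measures of compact chart pieces replace a Riemannian volume. Overlaps are counted
  -- repeatedly, which is harmless: a contraction factor below 1 contradicts $0<V<\infty$.
  set V := ∑ x₀ ∈ s, volume (A x₀) with hV
  have hVfin : V ≠ ⊤ := ENNReal.sum_ne_top.2 fun x₀ _ => hAfin x₀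
  have hVpos : V ≠ 0 := by
    obtain ⟨x₀, hx₀, -⟩ := hcover (Classical.arbitrary M)
    intro h0
    exact hApos x₀ (Finset.sum_eq_zero_iff.1 h0 x₀ hx₀)
  obtain ⟨ε, hε, hsmall⟩ : ∃ ε > 0, s.card * (D ^ n * D ^ n * ε) < 1 := by
    -- Here `D ^ n` is the price of passing between chart volume and Riemannian volume, paid twice,
    -- and the number of pieces accounts for the overlaps.
    refine ⟨((s.card + 1) * (D ^ n * D ^ n))⁻¹, by positivity, ?_⟩
    have h1 : (s.card : ℝ) * (D ^ n * D ^ n * ((s.card + 1) * (D ^ n * D ^ n))⁻¹) =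
        s.card / (s.card + 1) := by
      field_simp
    rw [h1, div_lt_one (by positivity)]
    linarith
  refine ⟨ε, hε, fun t => ?_⟩
  by_contra! hcon
  set f : M → M := fun x => Φ t x with hf
  have hfc : Continuous f := Φ.continuous continuous_const continuous_id
  have hfs : ∀ x, f (Φ (-t) x) = x := fun x => by
    simp only [hf]
    rw [← Φ.map_add, add_neg_cancel, Φ.map_zero_apply]
  let S : M → M → Set (Model n) := fun x₀ x₁ => extChartAt (𝓡 n) x₀ '' (K x₀ ∩ f ⁻¹' K x₁)
  have hSc : ∀ x₀ x₁, IsCompact (S x₀ x₁) := fun x₀ x₁ =>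
    ((hKc x₀).inter_right ((hKc x₁).isClosed.preimage hfc)).image_of_continuousOn
      ((continuousOn_extChartAt x₀).mono fun x hx => hKs x₀ hx.1)
  have hS : ∀ x₀ ∈ s, ∀ x₁ ∈ s, volume ((fun y => flowInCharts Φ x₀ x₁ (t, y)) '' S x₀ x₁) ≤
      ENNReal.ofReal (D ^ n * D ^ n * ε) * volume (A x₀) := by
    intro x₀ hx₀ x₁ hx₁
    have hdom : ∀ y ∈ S x₀ x₁, (t, y) ∈ flowInChartsDomain (n := n) Φ x₀ x₁ := by
      rintro _ ⟨x, hx, rfl⟩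
      refine ⟨(extChartAt (𝓡 n) x₀).map_source (hKs x₀ hx.1), ?_⟩
      rw [(extChartAt (𝓡 n) x₀).left_inv (hKs x₀ hx.1)]
      exact hKs x₁ hx.2
    refine (addHaar_image_le_lintegral_abs_det_fderiv volume (hSc x₀ x₁).measurableSet
      fun y hy => (hasFDerivAt_flowInCharts hΦ (hdom y hy)).hasFDerivWithinAt).trans ?_
    have hdet : ∀ y ∈ S x₀ x₁, ENNReal.ofReal |(flowDerivInCharts Φ x₀ x₁ (t, y)).det| ≤
        ENNReal.ofReal (D ^ n * D ^ n * ε) := by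
      intro y hy
      refine ENNReal.ofReal_le_ofReal ?_
      obtain ⟨x, hx, rfl⟩ := hy
      exact abs_det_flowDerivInCharts_le hΦ hD.le hε.le (hKs x₀ hx.1) (hKs x₁ hx.2)
        (fun w => ((hCK x₀ _ hx.1).1 w).trans
          (mul_le_mul_of_nonneg_right (hCD x₀ hx₀) (norm_nonneg _)))
        (fun v => ((hCK x₁ _ hx.2).2 v).trans
          (mul_le_mul_of_nonneg_right (hCD x₁ hx₁) (norm_nonneg _))) (hcon x)
    calc ∫⁻ y in S x₀ x₁, ENNReal.ofReal |(flowDerivInCharts Φ x₀ x₁ (t, y)).det|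
        ≤ ∫⁻ y in S x₀ x₁, ENNReal.ofReal (D ^ n * D ^ n * ε) :=
          setLIntegral_mono_ae measurable_const.aemeasurable (Eventually.of_forall hdet)
      _ = ENNReal.ofReal (D ^ n * D ^ n * ε) * volume (S x₀ x₁) := setLIntegral_const _ _
      _ ≤ _ := mul_le_mul_right (measure_mono (Set.image_mono Set.inter_subset_left)) _
  -- The time `t` map is onto: each point of a piece is the image of a point that lies in some piece
  -- of the cover.
  have hA : ∀ x₁, volume (A x₁) ≤
      ∑ x₀ ∈ s, volume ((fun y => flowInCharts Φ x₀ x₁ (t, y)) '' S x₀ x₁) := by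
    intro x₁
    refine le_trans (measure_mono ?_) (measure_biUnion_finset_le s _)
    rintro _ ⟨x, hx, rfl⟩
    obtain ⟨x₀, hx₀, hx'⟩ := hcover (Φ (-t) x)
    refine Set.mem_iUnion₂.2 ⟨x₀, hx₀, extChartAt (𝓡 n) x₀ (Φ (-t) x), ⟨_, ⟨hx', ?_⟩, rfl⟩, ?_⟩
    · change f (Φ (-t) x) ∈ K x₁
      rwa [hfs]
    · simp only [flowInCharts]
      rw [(extChartAt (𝓡 n) x₀).left_inv (hKs x₀ hx')]
      exact congrArg _ (hfs x)
  have hfinal : V ≤ ENNReal.ofReal (s.card * (D ^ n * D ^ n * ε)) * V := by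
    calc V ≤ ∑ x₁ ∈ s, ∑ x₀ ∈ s, ENNReal.ofReal (D ^ n * D ^ n * ε) * volume (A x₀) :=
          Finset.sum_le_sum fun x₁ hx₁ => (hA x₁).trans
            (Finset.sum_le_sum fun x₀ hx₀ => hS x₀ hx₀ x₁ hx₁)
      _ = _ := by
        rw [Finset.sum_const, ← Finset.mul_sum, nsmul_eq_mul, ← mul_assoc,
          ENNReal.ofReal_mul (by positivity : (0 : ℝ) ≤ s.card), ENNReal.ofReal_natCast]
  have hlt : ENNReal.ofReal (s.card * (D ^ n * D ^ n * ε)) * V < 1 * V :=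
    ENNReal.mul_lt_mul_left hVpos hVfin (by
      rw [← ENNReal.ofReal_one]
      exact (ENNReal.ofReal_lt_ofReal_iff one_pos).2 hsmall)
  rw [one_mul] at hlt
  exact absurd hfinal (not_le.2 hlt)

variable {X : (x : M) → TangentSpace (𝓡 n) x} {Euu Ess : Distribution n M}

/-- The unstable bundle of an asymmetric flow has dimension at most two. -/
lemma IsAnosovNorm.finrank_unstable_lt [CompactSpace M] [T2Space M] [ConnectedSpace M]
    (h : IsAnosovNorm Φ X Euu Ess) (ha : IsAsymmetricNorm Φ Euu) (x : M) :
    Module.finrank ℝ (Euu x) < 3 := by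
  by_contra! hx
  obtain ⟨P, hP1, hP2⟩ := exists_projection h.isCompl_unstable
  -- The volume argument needs a small Jacobian at every point, so constancy of the rank is
  -- essential.
  have hall : ∀ y, 3 ≤ Module.finrank ℝ (Euu y) := fun y => hx.trans_eq
    (finrank_eq_of_continuous_projection (continuousOn_localEnd h.isClosedField_unstable
      h.isClosedField_centerStable (fun x => (h.isCompl_unstable x).disjoint) hP1 hP2) hP1
      (fun x v hv => projection_apply_eq (fun x => (h.isCompl_unstable x).disjoint) hP1 hP2 hv
        (by rw [sub_self]; exact Submodule.zero_mem _)) x y)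
  obtain ⟨m, hm⟩ : ∃ m, n = m + 3 := by
    have := (Euu x).finrank_le
    rw [finrank_tangentSpace] at this
    exact ⟨n - 3, by omega⟩
  obtain ⟨ε, hε, hεt⟩ := exists_lt_gramVol_tangentFlow h.smooth
  obtain ⟨c, hc, lam, hlam, H⟩ := h.unstable_contracts
  obtain ⟨C, hC, μ, hμ, H'⟩ := ha
  have hlim := tendsto_const_mul_exp_neg (c ^ 2 * C) hμ 1
  obtain ⟨t, ht, ht'⟩ := ((hlim.eventually_lt_const hε).and (eventually_ge_atTop 0)).exists
  obtain ⟨z, v, hzv⟩ := hεt (-t)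
  subst hm
  -- Splitting off `b 0` and `b 1` costs at most `c ^ 2`. The other $n-2$ sides still include the
  -- unstable vector `b 2`, so asymmetry applies to them.
  obtain ⟨b, hb0, hb1, hb2⟩ := exists_orthonormalBasis_three_mem
    (V := TangentSpace (𝓡 (m + 3)) z) (finrank_tangentSpace z) (Euu z) (hall z)
  have hmap := gramVol_tangentFlow (Φ := Φ) (-t) z b v
  have hexp : Real.exp (-lam * t) ≤ 1 := by
    rw [Real.exp_le_one_iff]
    nlinarith
  have hunit : ∀ i, b i ∈ Euu z → ‖tangentFlow Φ (-t) z (b i)‖ ≤ c := by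
    intro i hi
    refine (H t ht' z _ hi).trans ?_
    rw [b.norm_eq_one, mul_one]
    exact mul_le_of_le_one_right hc.le hexp
  have htail : gramVol (fun i : Fin (m + 1) => tangentFlow Φ (-t) z (b i.succ.succ)) ≤
      C * Real.exp (-μ * t) := by
    refine (H' (m + 1) (by ring) t ht' z (fun i => b i.succ.succ) ⟨0, hb2⟩).trans ?_
    have : gramVol (fun i : Fin (m + 1) => b i.succ.succ) ≤ 1 := by
      refine (gramVol_le_prod _).trans (le_of_eq ?_)
      simp
    exact mul_le_of_le_one_right (by positivity) this
  have hb : gramVol (fun i => tangentFlow Φ (-t) z (b i)) ≤ c * (c * (C * Real.exp (-μ * t))) := by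
    refine (gramVol_le_mul_gramVol (m := m + 1) _).trans
      (mul_le_mul (hunit 0 hb0) ?_ (mul_nonneg (norm_nonneg _) (gramVol_nonneg _)) hc.le)
    exact mul_le_mul (hunit 1 hb1) htail (gramVol_nonneg _) hc.le
  rw [hmap] at hzv
  have : gramVol (fun i => tangentFlow Φ (-t) z (b i)) ≤ ε := by
    refine hb.trans (le_trans (le_of_eq ?_) ht.le)
    ring
  exact absurd hzv (not_lt.2 (mul_le_mul_of_nonneg_right this (gramVol_nonneg _)))

end Volume

end AnosovForms

namespace AnosovForms

open Bundle Filter MeasureTheory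

/-! ### Derivatives and continuity of improper integrals. -/

section Integrals

lemma setIntegral_Ioi_comp_add (h : ℝ → ℝ) (t : ℝ) :
    ∫ s in Set.Ioi 0, h (s + t) = ∫ s in Set.Ioi t, h s := by
  have h1 := (measurePreserving_add_right (volume : Measure ℝ) t).setIntegral_preimage_emb
    (measurableEmbedding_addRight t) h (Set.Ioi t)
  rw [← h1]
  simp

lemma hasDerivAt_intervalIntegral_zero {h : ℝ → ℝ} (hc : Continuous h) (b : ℝ) :
    HasDerivAt (fun t => ∫ s in (0 : ℝ)..t, h s) (h b) b :=
  intervalIntegral.integral_hasDerivAt_right (hc.intervalIntegrable _ _)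
    hc.aestronglyMeasurable.stronglyMeasurableAtFilter hc.continuousAt

lemma hasDerivAt_integral_Ioi_comp_add {h : ℝ → ℝ} (hc : Continuous h)
    (hint : IntegrableOn h (Set.Ioi 0)) :
    HasDerivAt (fun t => ∫ s in Set.Ioi 0, h (s + t)) (-h 0) 0 := by
  have h1 : (fun t => ∫ s in Set.Ioi 0, h (s + t)) =
      fun t => (∫ s in Set.Ioi 0, h s) - ∫ s in (0 : ℝ)..t, h s := by
    funext t
    have hint' : IntegrableOn h (Set.Ioi t) := by
      refine ((hc.integrableOn_Icc (a := t) (b := 0)).union hint).mono_set fun s hs => ?_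
      rcases le_or_gt s 0 with h0 | h0
      · exact Or.inl ⟨le_of_lt hs, h0⟩
      · exact Or.inr h0
    rw [setIntegral_Ioi_comp_add, ← intervalIntegral.integral_Ioi_sub_Ioi' hint hint',
      sub_sub_cancel]
  rw [h1]
  exact (hasDerivAt_intervalIntegral_zero hc 0).const_sub _

/-- The sign `σ` serves both time directions: $\sigma s+t=\sigma(s+\sigma t)$ reduces the claim to a
shift of $s$. -/
lemma hasDerivAt_integral_Ioi_comp_mul_add {h : ℝ → ℝ} (hc : Continuous h) {σ : ℝ}
    (hσ : σ = 1 ∨ σ = -1) (hint : IntegrableOn (fun s => h (σ * s)) (Set.Ioi 0)) :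
    HasDerivAt (fun t => ∫ s in Set.Ioi 0, h (σ * s + t)) (-σ * h 0) 0 := by
  have h1 := hasDerivAt_integral_Ioi_comp_add (hc.comp (continuous_const.mul continuous_id)) hint
  have h2 : HasDerivAt (fun t : ℝ => σ * t) (σ * 1) 0 := (hasDerivAt_id 0).const_mul σ
  have h3 : HasDerivAt (fun t => ∫ s in Set.Ioi 0, h (σ * (s + t))) (-h (σ * 0)) (σ * 0) := by
    rw [mul_zero]
    simpa using h1
  have h4 := h3.comp (0 : ℝ) h2
  have hσσ : σ * σ = 1 := by rcases hσ with rfl | rfl <;> norm_num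
  have h5 : (fun t => ∫ s in Set.Ioi 0, h (σ * (s + t))) ∘ (fun t => σ * t) =
      fun t => ∫ s in Set.Ioi 0, h (σ * s + t) := by
    funext t
    simp only [Function.comp_apply, mul_add, ← mul_assoc, hσσ, one_mul]
  rw [h5, mul_zero] at h4
  have h6 : -σ * h 0 = -h 0 * (σ * 1) := by ring
  rw [h6]
  exact h4

/-- Substituting $u=\sigma s+t$ turns the shift into the moving endpoints $t$ and $\sigma T+t$. -/
lemma hasDerivAt_integral_Ioc_comp_mul_add {h : ℝ → ℝ} (hc : Continuous h) {σ : ℝ}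
    (hσ : σ = 1 ∨ σ = -1) {T : ℝ} (hT : 0 ≤ T) :
    HasDerivAt (fun t => ∫ s in Set.Ioc 0 T, h (σ * s + t)) (σ * (h (σ * T) - h 0)) 0 := by
  have hσσ : σ * σ = 1 := by rcases hσ with rfl | rfl <;> norm_num
  have h1 : (fun t => ∫ s in Set.Ioc 0 T, h (σ * s + t)) =
      fun t => σ * ((∫ s in (0 : ℝ)..(σ * T + t), h s) - ∫ s in (0 : ℝ)..t, h s) := by
    funext t
    rw [← intervalIntegral.integral_of_le hT,
      intervalIntegral.integral_interval_sub_left (hc.intervalIntegrable _ _)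
        (hc.intervalIntegrable _ _)]
    have := intervalIntegral.smul_integral_comp_mul_add (a := 0) (b := T) h σ t
    rw [mul_zero, zero_add, smul_eq_mul] at this
    rw [← this, ← mul_assoc, hσσ, one_mul]
  rw [h1]
  have h2 : HasDerivAt (fun t : ℝ => ∫ s in (0 : ℝ)..(σ * T + t), h s) (h (σ * T)) 0 := by
    have h3 : HasDerivAt (fun t : ℝ => σ * T + t) 1 0 := (hasDerivAt_id 0).const_add _
    have h4 : HasDerivAt (fun t => ∫ s in (0 : ℝ)..t, h s) (h (σ * T)) (σ * T + 0) := by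
      rw [add_zero]
      exact hasDerivAt_intervalIntegral_zero hc (σ * T)
    have h5 := h4.comp (0 : ℝ) h3
    rw [mul_one] at h5
    exact h5
  exact (h2.sub (hasDerivAt_intervalIntegral_zero hc 0)).const_mul σ

lemma integrable_alternating {V Y : Type*} [NormedAddCommGroup V] [NormedSpace ℝ V]
    [FiniteDimensional ℝ V] [MeasurableSpace Y] {μ : Measure Y} {k : ℕ}
    {F : Y → V [⋀^Fin k]→L[ℝ] ℝ} (h : ∀ v, Integrable (fun y => F y v) μ) : Integrable F μ := by
  obtain ⟨R, hR⟩ := exists_clm_leftInverse_eval V k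
  have : F = fun y => R (fun c => F y fun i => Module.finBasis ℝ V (c i)) := by
    funext y; exact (hR _).symm
  rw [this]
  exact R.integrable_comp (integrable_pi_iff.2 fun c => h _)

/-- The factor `g` is locally bounded, so the `F T` converge to `f` locally uniformly. -/
lemma continuousOn_of_abs_sub_le {E : Type*} [TopologicalSpace E] {f g : E → ℝ} {F : ℝ → E → ℝ}
    {a : ℝ → ℝ} {s : Set E} (hF : ∀ T ≥ 0, ContinuousOn (F T) s) (hg : ContinuousOn g s)
    (ha : Tendsto a atTop (𝓝 0)) (h : ∀ T ≥ 0, ∀ y ∈ s, |f y - F T y| ≤ a T * g y) :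
    ContinuousOn f s := by
  have hlim : TendstoLocallyUniformlyOn F f atTop s := by
    rw [Metric.tendstoLocallyUniformlyOn_iff]
    intro ε hε x hx
    have h1 : ∀ᶠ y in 𝓝[s] x, |g y| < |g x| + 1 :=
      (hg x hx).abs.eventually_lt_const (by linarith)
    refine ⟨_, inter_mem h1 self_mem_nhdsWithin, ?_⟩
    have h2 : Tendsto (fun T => |a T| * (|g x| + 1)) atTop (𝓝 (|0| * (|g x| + 1))) :=
      ha.abs.mul_const _
    rw [abs_zero, zero_mul] at h2
    filter_upwards [h2.eventually_lt_const hε, eventually_ge_atTop 0] with T hT hT0 y hy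
    rw [Real.dist_eq]
    calc |f y - F T y| ≤ a T * g y := h T hT0 y hy.2
      _ ≤ |a T| * |g y| := by rw [← abs_mul]; exact le_abs_self _
      _ ≤ |a T| * (|g x| + 1) := mul_le_mul_of_nonneg_left (le_of_lt hy.1) (abs_nonneg _)
      _ < ε := hT
  exact hlim.continuousOn
    ((eventually_ge_atTop 0).mono fun T hT => hF T hT).frequently

end Integrals

/-! ### Regularity and Lie derivatives of integrated pullbacks. -/

section FormClass

variable {n : ℕ} {M : Type*} [TopologicalSpace M] [ChartedSpace (Model n) M]
  {Φ : Flow ℝ M} {k : ℕ}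

lemma IsFormOfClass.of_le {r r' : ℕ∞} {β : Form n k M} (hβ : IsFormOfClass r β) (h : r' ≤ r) :
    IsFormOfClass r' β := fun x₀ => (hβ x₀).of_le (by exact_mod_cast h)

lemma HasLieDeriv.sub {η ξ η' ξ' : Form n k M} (h : HasLieDeriv Φ η ξ) (h' : HasLieDeriv Φ η' ξ') :
    HasLieDeriv Φ (η - η') (ξ - ξ') := fun x v => (h x v).sub (h' x v)

/-- The identity $f_s^*=f_t^*f_{s-t}^*$ carries the derivative at time 0 to time $t$. -/
lemma HasLieDeriv.hasDerivAt (hΦ : IsSmoothFlow n Φ) {η ξ : Form n k M} (h : HasLieDeriv Φ η ξ)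
    (t : ℝ) (x : M) (v : Fin k → TangentSpace (𝓡 n) x) :
    HasDerivAt (fun s => flowPullback Φ s η x v) (flowPullback Φ t ξ x v) t := by
  have h1 := h (Φ t x) (fun i => tangentFlow Φ t x (v i))
  have h2 : (fun s => flowPullback Φ s η x v) = fun s =>
      flowPullback Φ (s - t) η (Φ t x) (fun i => tangentFlow Φ t x (v i)) := by
    funext s
    have := flowPullback_add hΦ (s - t) t η
    rw [sub_add_cancel] at this
    rw [this]
    rfl
  rw [h2]
  have h3 : HasDerivAt (fun s : ℝ => flowPullback Φ s η (Φ t x)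
      (fun i => tangentFlow Φ t x (v i))) (flowPullback Φ t ξ x v) (t - t) := by
    rw [sub_self]; exact h1
  exact h3.comp_sub_const t t

/-- The form `(v₁, …, v_k) ↦ β (P v₁, …, P v_k)`. -/
noncomputable def formComp (P : (x : M) → TangentSpace (𝓡 n) x →L[ℝ] TangentSpace (𝓡 n) x)
    (β : Form n k M) : Form n k M :=
  fun x => (β x).compContinuousLinearMap (P x)

lemma flowPullback_formComp
    {P : (x : M) → TangentSpace (𝓡 n) x →L[ℝ] TangentSpace (𝓡 n) x}
    (hPT : ∀ t x v, P (Φ t x) (tangentFlow Φ t x v) = tangentFlow Φ t x (P x v)) (t : ℝ)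
    (β : Form n k M) (x : M) (v : Fin k → TangentSpace (𝓡 n) x) :
    flowPullback Φ t (formComp P β) x v = flowPullback Φ t β x (fun i => P x (v i)) := by
  change β _ (fun i => P _ (tangentFlow Φ t x (v i))) = β _ (fun i => tangentFlow Φ t x (P x (v i)))
  congr 1
  funext i
  exact hPT t x (v i)

variable [IsManifold (𝓡 n) ∞ M]

lemma isFormOfClass_iff_apply (r : ℕ∞) (β : Form n k M) :
    IsFormOfClass r β ↔ ∀ (x₀ : M) (w : Fin k → Model n), ContDiffOn ℝ r
      (fun y => formLocal β x₀ ((extChartAt (𝓡 n) x₀).symm y) w) (extChartAt (𝓡 n) x₀).target := by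
  rw [isFormOfClass_iff]
  exact forall_congr' fun x₀ => ⟨fun h w => contDiffOn_alternating_apply h
    fun i => contDiffOn_const (c := w i), fun h => contDiffOn_alternating h⟩

lemma IsFormOfClass.sub {r : ℕ∞} {β γ : Form n k M} (hβ : IsFormOfClass r β)
    (hγ : IsFormOfClass r γ) : IsFormOfClass r (β - γ) := by
  rw [isFormOfClass_iff_apply] at *
  exact fun x₀ w => (hβ x₀ w).sub (hγ x₀ w)

lemma IsFormOfClass.flowPullback (hΦ : IsSmoothFlow n Φ) {r : ℕ∞} {β : Form n k M}
    (hβ : IsFormOfClass r β) (t : ℝ) : IsFormOfClass r (flowPullback Φ t β) := by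
  rw [isFormOfClass_iff]
  intro x₀
  exact (contDiffOn_formLocal_flowPullback hΦ hβ x₀).comp
    (contDiffOn_const.prodMk contDiffOn_id) fun y hy => ⟨trivial, hy⟩

lemma IsFormOfClass.formComp {r : ℕ∞} {β : Form n k M} (hβ : IsFormOfClass r β)
    {P : (x : M) → TangentSpace (𝓡 n) x →L[ℝ] TangentSpace (𝓡 n) x}
    (hP : ∀ x₀, ContDiffOn ℝ r (fun y => localEnd P x₀ ((extChartAt (𝓡 n) x₀).symm y))
      (extChartAt (𝓡 n) x₀).target) : IsFormOfClass r (formComp P β) := by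
  rw [isFormOfClass_iff] at *
  intro x₀
  refine (contDiffOn_compContinuousLinearMap (hβ x₀) (hP x₀)).congr fun y hy => ?_
  ext w
  change β _ (fun i => P _ (frameAt x₀ _ (w i))) =
    β _ (fun i => frameAt x₀ _ (localEnd P x₀ _ (w i)))
  congr 1
  funext i
  exact (frameAt_localEnd P ((extChartAt (𝓡 n) x₀).map_target hy) _).symm

lemma continuous_flowPullback_apply (hΦ : IsSmoothFlow n Φ) {β : Form n k M}
    (hβ : IsFormOfClass 0 β) (x : M) (v : Fin k → TangentSpace (𝓡 n) x) :
    Continuous fun t => flowPullback Φ t β x v := by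
  have hx := mem_extChartAt_source (I := 𝓡 n) x
  have h1 := continuous_slice_of_continuousOn
    (contDiffOn_formLocal_flowPullback hΦ hβ x).continuousOn (mem_extChartAt_target (I := 𝓡 n) x)
  have h2 : ∀ t, flowPullback Φ t β x v =
      formLocal (flowPullback Φ t β) x ((extChartAt (𝓡 n) x).symm (extChartAt (𝓡 n) x x))
        (fun i => coordAt x x (v i)) := by
    intro t
    rw [(extChartAt (𝓡 n) x).left_inv hx]
    exact apply_eq_formLocal _ hx v
  simp only [h2]
  exact (ContinuousAlternatingMap.apply ℝ (Model n) ℝ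
    (fun i => coordAt x x (v i))).continuous.comp h1

/-- The integral of the pullbacks of a form by the maps `f_{σ s}`, for `s ∈ S`. -/
noncomputable def flowIntegral (Φ : Flow ℝ M) (σ : ℝ) (S : Set ℝ) (β : Form n k M) : Form n k M :=
  fun x => (∫ s in S, formLocal (flowPullback Φ (σ * s) β) x x).compContinuousLinearMap
    (coordAt x x)

/-- The integral is taken in a space of alternating maps, where evaluation is linear and continuous.
Integrability of the scalar values gives that of the map, so evaluation passes inside. -/
lemma flowIntegral_apply {σ : ℝ} {S : Set ℝ} {β : Form n k M} {x : M}
    (h : ∀ v, IntegrableOn (fun s => flowPullback Φ (σ * s) β x v) S)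
    (v : Fin k → TangentSpace (𝓡 n) x) :
    flowIntegral Φ σ S β x v = ∫ s in S, flowPullback Φ (σ * s) β x v := by
  have h1 : IntegrableOn (fun s => formLocal (flowPullback Φ (σ * s) β) x x) S :=
    integrable_alternating fun w => h _
  have h2 := (ContinuousAlternatingMap.apply ℝ (Model n) ℝ
    (fun i => coordAt x x (v i))).integral_comp_comm h1
  refine Eq.trans h2.symm (integral_congr_ae (Eventually.of_forall fun s => ?_))
  exact (apply_eq_formLocal (flowPullback Φ (σ * s) β) (mem_extChartAt_source x) v).symm

lemma integrableOn_flowPullback_Ioc (hΦ : IsSmoothFlow n Φ) {β : Form n k M}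
    (hβ : IsFormOfClass 0 β) (σ T : ℝ) (x : M) (v : Fin k → TangentSpace (𝓡 n) x) :
    IntegrableOn (fun s => flowPullback Φ (σ * s) β x v) (Set.Ioc 0 T) :=
  ((continuous_flowPullback_apply hΦ hβ x v).comp
    (continuous_const.mul continuous_id)).integrableOn_Ioc

lemma isFormOfClass_flowIntegral_Ioc (hΦ : IsSmoothFlow n Φ) {β : Form n k M} {r : ℕ∞}
    (hr : r = 0 ∨ r = 1) (hβ : IsFormOfClass r β) (σ : ℝ) {T : ℝ} (hT : 0 ≤ T) :
    IsFormOfClass r (flowIntegral Φ σ (Set.Ioc 0 T) β) := by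
  have hβ0 : IsFormOfClass 0 β := hβ.of_le bot_le
  rw [isFormOfClass_iff_apply]
  intro x₀ w
  set F : ℝ × Model n → ℝ := fun p =>
    formLocal (flowPullback Φ (σ * p.1) β) x₀ ((extChartAt (𝓡 n) x₀).symm p.2) w
  have h1 : ContDiffOn ℝ r F (Set.univ ×ˢ (extChartAt (𝓡 n) x₀).target) := by
    refine contDiffOn_alternating_apply (w := fun i _ => w i)
      ((contDiffOn_formLocal_flowPullback hΦ hβ x₀).comp
      (((contDiff_const.mul contDiff_fst).prodMk contDiff_snd).contDiffOn) fun p hp => ?_)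
      fun i => contDiffOn_const
    exact ⟨trivial, hp.2⟩
  have h2 : ContDiffOn ℝ r (fun y => ∫ t in (0 : ℝ)..T, F (t, y))
      (extChartAt (𝓡 n) x₀).target := by
    rcases hr with rfl | rfl
    · exact contDiffOn_zero.2 (continuousOn_parametric_integral h1.continuousOn 0 T)
    · exact contDiffOn_one_parametric_integral (isOpen_extChartAt_target x₀) h1 0 T
  refine h2.congr fun y hy => ?_
  rw [intervalIntegral.integral_of_le hT]
  exact flowIntegral_apply (fun v => integrableOn_flowPullback_Ioc hΦ hβ0 σ T _ v) _

/-- Since $f_t^*f_{\sigma s}^*=f_{\sigma s+t}^*$, pulling back the integral shifts its integrand in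
time, and only a scalar derivative remains. -/
lemma hasLieDeriv_flowIntegral (hΦ : IsSmoothFlow n Φ) {β γ : Form n k M} {σ : ℝ} {S : Set ℝ}
    (hint : ∀ x v, IntegrableOn (fun s => flowPullback Φ (σ * s) β x v) S)
    (h : ∀ x v, HasDerivAt (fun t => ∫ s in S, flowPullback Φ (σ * s + t) β x v) (γ x v) 0) :
    HasLieDeriv Φ (flowIntegral Φ σ S β) γ := by
  intro x v
  refine (h x v).congr_of_eventuallyEq (Eventually.of_forall fun t => ?_)
  change flowIntegral Φ σ S β (Φ t x) (fun i => tangentFlow Φ t x (v i)) = _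
  rw [flowIntegral_apply (hint _)]
  refine integral_congr_ae (Eventually.of_forall fun s => ?_)
  change flowPullback Φ t (flowPullback Φ (σ * s) β) x v = _
  rw [← flowPullback_add hΦ]

lemma hasLieDeriv_flowIntegral_Ioc (hΦ : IsSmoothFlow n Φ) {β : Form n k M}
    (hβ : IsFormOfClass 0 β) {σ : ℝ} (hσ : σ = 1 ∨ σ = -1) {T : ℝ} (hT : 0 ≤ T) :
    HasLieDeriv Φ (flowIntegral Φ σ (Set.Ioc 0 T) β) (σ • (flowPullback Φ (σ * T) β - β)) := by
  refine hasLieDeriv_flowIntegral hΦ (integrableOn_flowPullback_Ioc hΦ hβ σ T) fun x v => ?_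
  have h1 := hasDerivAt_integral_Ioc_comp_mul_add (continuous_flowPullback_apply hΦ hβ x v) hσ hT
  rw [flowPullback_zero] at h1
  exact h1

end FormClass

/-! ### Improper integrals of exponentially decaying pullbacks. -/

section Decay

variable {n : ℕ} {M : Type*} [TopologicalSpace M] [ChartedSpace (Model n) M]
  [RiemannianBundle (fun x : M => TangentSpace (𝓡 n) x)] {Φ : Flow ℝ M} {k : ℕ}

/-- The pullbacks of the form `β` by the maps `f_{σ t}` decay exponentially. -/
def HasExpDecay (Φ : Flow ℝ M) (σ C ν : ℝ) (β : Form n k M) : Prop :=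
  ∀ t ≥ 0, ∀ x v, |flowPullback Φ (σ * t) β x v| ≤ C * Real.exp (-ν * t) * ∏ i, ‖v i‖

variable {β : Form n k M} {σ C ν : ℝ}

lemma integrableOn_of_exp_decay {h : ℝ → ℝ} (hc : Continuous h) {B : ℝ} (hν : 0 < ν)
    (hb : ∀ t ≥ 0, |h t| ≤ B * Real.exp (-ν * t)) {a : ℝ} (ha : 0 ≤ a) :
    IntegrableOn h (Set.Ioi a) := by
  refine Integrable.mono' ((exp_neg_integrableOn_Ioi a hν).const_mul B)
    hc.aestronglyMeasurable ?_
  filter_upwards [ae_restrict_mem measurableSet_Ioi] with t ht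
  exact hb t (ha.trans (le_of_lt ht))

lemma HasExpDecay.abs_le (h : HasExpDecay Φ σ C ν β) (x : M) (v : Fin k → TangentSpace (𝓡 n) x) :
    ∀ t ≥ 0, |flowPullback Φ (σ * t) β x v| ≤ (C * ∏ i, ‖v i‖) * Real.exp (-ν * t) :=
  fun t ht => (h t ht x v).trans (le_of_eq (by ring))

variable [IsManifold (𝓡 n) ∞ M]

lemma HasExpDecay.integrableOn (hΦ : IsSmoothFlow n Φ) (hβ : IsFormOfClass 0 β) (hν : 0 < ν)
    (h : HasExpDecay Φ σ C ν β) {a : ℝ} (ha : 0 ≤ a) (x : M) (v : Fin k → TangentSpace (𝓡 n) x) :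
    IntegrableOn (fun s => flowPullback Φ (σ * s) β x v) (Set.Ioi a) :=
  integrableOn_of_exp_decay ((continuous_flowPullback_apply hΦ hβ x v).comp
    (continuous_const.mul continuous_id)) hν (h.abs_le x v) ha

lemma HasExpDecay.hasLieDeriv (hΦ : IsSmoothFlow n Φ) (hβ : IsFormOfClass 0 β) (hν : 0 < ν)
    (hσ : σ = 1 ∨ σ = -1) (h : HasExpDecay Φ σ C ν β) :
    HasLieDeriv Φ (flowIntegral Φ σ (Set.Ioi 0) β) (-σ • β) := by
  refine hasLieDeriv_flowIntegral hΦ (h.integrableOn hΦ hβ hν le_rfl) fun x v => ?_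
  have h1 := hasDerivAt_integral_Ioi_comp_mul_add (continuous_flowPullback_apply hΦ hβ x v) hσ
    (h.integrableOn hΦ hβ hν le_rfl x v)
  rw [flowPullback_zero] at h1
  exact h1

/-- The difference is the tail over $(T,\infty)$, and $\int_T^\infty Ce^{-\nu
s}\,ds=\frac{C}{\nu}e^{-\nu T}$. -/
lemma HasExpDecay.abs_flowIntegral_sub_le (hΦ : IsSmoothFlow n Φ) (hβ : IsFormOfClass 0 β)
    (hν : 0 < ν) (h : HasExpDecay Φ σ C ν β) {T : ℝ} (hT : 0 ≤ T) (x : M)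
    (v : Fin k → TangentSpace (𝓡 n) x) :
    |flowIntegral Φ σ (Set.Ioi 0) β x v - flowIntegral Φ σ (Set.Ioc 0 T) β x v| ≤
      C / ν * Real.exp (-ν * T) * ∏ i, ‖v i‖ := by
  rw [flowIntegral_apply (h.integrableOn hΦ hβ hν le_rfl x),
    flowIntegral_apply (integrableOn_flowPullback_Ioc hΦ hβ σ T x),
    ← intervalIntegral.integral_of_le hT, ← intervalIntegral.integral_Ioi_sub_Ioi
      (h.integrableOn hΦ hβ hν le_rfl x v) hT, sub_sub_cancel, ← Real.norm_eq_abs]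
  refine (norm_integral_le_of_norm_le ((exp_neg_integrableOn_Ioi T hν).const_mul
    (C * ∏ i, ‖v i‖)) ?_).trans (le_of_eq ?_)
  · filter_upwards [ae_restrict_mem measurableSet_Ioi] with t ht
    exact h.abs_le x v t (hT.trans (le_of_lt ht))
  · rw [integral_const_mul, integral_exp_mul_Ioi (by linarith)]
    field_simp

variable [IsContinuousRiemannianBundle (Model n) (fun x : M => TangentSpace (𝓡 n) x)]

lemma continuousOn_norm_snd {s : Set (Model n)} {F : Model n → TangentBundle (𝓡 n) M}
    (hF : ContinuousOn F s) : ContinuousOn (fun y => ‖(F y).2‖) s :=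
  continuous_norm_tangentBundle.comp_continuousOn hF

lemma continuousOn_norm_frameAt (x₀ : M) (w : Model n) :
    ContinuousOn (fun y : Model n => ‖frameAt x₀ ((extChartAt (𝓡 n) x₀).symm y) w‖)
      (extChartAt (𝓡 n) x₀).target := by
  have h1 : ContinuousOn (fun y => ((extChartAt (𝓡 n) x₀).symm y, w))
      (extChartAt (𝓡 n) x₀).target :=
    (continuousOn_extChartAt_symm x₀).prodMk continuousOn_const
  have h2 : ContinuousOn (fun y => (⟨(extChartAt (𝓡 n) x₀).symm y,
      frameAt x₀ ((extChartAt (𝓡 n) x₀).symm y) w⟩ : TangentBundle (𝓡 n) M))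
      (extChartAt (𝓡 n) x₀).target :=
    (continuousOn_mk_frameAt x₀).comp h1
      fun y hy => ⟨(extChartAt (𝓡 n) x₀).map_target hy, trivial⟩
  have h3 := continuousOn_norm_snd (F := fun y => (⟨(extChartAt (𝓡 n) x₀).symm y,
      frameAt x₀ ((extChartAt (𝓡 n) x₀).symm y) w⟩ : TangentBundle (𝓡 n) M)) h2
  exact h3

lemma HasExpDecay.isFormOfClass_flowIntegral (hΦ : IsSmoothFlow n Φ) (hβ : IsFormOfClass 0 β)
    (hν : 0 < ν) (h : HasExpDecay Φ σ C ν β) :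
    IsFormOfClass 0 (flowIntegral Φ σ (Set.Ioi 0) β) := by
  rw [isFormOfClass_iff_apply]
  intro x₀ w
  refine contDiffOn_zero.2 (continuousOn_of_abs_sub_le
    (F := fun T y => formLocal (flowIntegral Φ σ (Set.Ioc 0 T) β) x₀
      ((extChartAt (𝓡 n) x₀).symm y) w)
    (g := fun y => ∏ i, ‖frameAt x₀ ((extChartAt (𝓡 n) x₀).symm y) (w i)‖)
    (a := fun T => C / ν * Real.exp (-ν * T) * 1) (fun T hT => ?_) ?_
    (tendsto_const_mul_exp_neg _ hν 1) fun T hT y _ => ?_)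
  · exact ((isFormOfClass_iff_apply 0 _).1
      (isFormOfClass_flowIntegral_Ioc hΦ (Or.inl rfl) hβ σ hT) x₀ w).continuousOn
  · exact continuousOn_finsetProd _ fun i _ => continuousOn_norm_frameAt x₀ (w i)
  · rw [mul_one]
    exact h.abs_flowIntegral_sub_le hΦ hβ hν hT _ _

end Decay

end AnosovForms

namespace AnosovForms

open Bundle Filter MeasureTheory

/-! ### Regularity of the projections of a splitting. -/

section SmoothProjection

/-- A field of endomorphisms is of class `C^r` if so are its values on the members of a frame of
class `C^r`. -/
lemma contDiffAt_of_apply_frame {E V ι : Type*} [NormedAddCommGroup E] [NormedSpace ℝ E]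
    [NormedAddCommGroup V] [NormedSpace ℝ V] [FiniteDimensional ℝ V] [Fintype ι]
    {r : WithTop ℕ∞} {P : E → V →L[ℝ] V} {Z Q : ι → E → V} {y₀ : E}
    (hZ : ∀ i, ContDiffAt ℝ r (Z i) y₀) (hQ : ∀ i, ContDiffAt ℝ r (Q i) y₀)
    (hli : ∀ᶠ y in 𝓝 y₀, LinearIndependent ℝ fun i => Z i y)
    (hsp : ∀ᶠ y in 𝓝 y₀, ⊤ ≤ Submodule.span ℝ (Set.range fun i => Z i y))
    (hP : ∀ᶠ y in 𝓝 y₀, ∀ i, P y (Z i y) = Q i y) : ContDiffAt ℝ r P y₀ := by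
  have : CompleteSpace V := FiniteDimensional.complete ℝ V
  -- The map `A Z y` sends coefficients to combinations of the frame, so `P` is `A Q` composed with
  -- the inverse of `A Z`, and inversion is smooth at invertible maps.
  let A : (ι → E → V) → E → (ι → ℝ) →L[ℝ] V := fun Z y =>
    ∑ i, (ContinuousLinearMap.proj (R := ℝ) (φ := fun _ : ι => ℝ) i).smulRight (Z i y)
  have hAapp : ∀ Z y c, A Z y c = ∑ i, c i • Z i y := by
    intro Z y c
    simp [A]
  have hA : ∀ {Z : ι → E → V}, (∀ i, ContDiffAt ℝ r (Z i) y₀) → ContDiffAt ℝ r (A Z) y₀ :=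
    fun hZ => ContDiffAt.sum fun i _ => contDiffAt_const.smulRight (hZ i)
  have hbij : ∀ y, LinearIndependent ℝ (fun i => Z i y) →
      ⊤ ≤ Submodule.span ℝ (Set.range fun i => Z i y) →
      ∃ e : (ι → ℝ) ≃L[ℝ] V, (e : (ι → ℝ) →L[ℝ] V) = A Z y := by
    intro y hli hsp
    refine ⟨((Module.Basis.mk hli hsp).equivFun.symm).toContinuousLinearEquiv, ?_⟩
    ext c
    rw [hAapp]
    simp [Module.Basis.equivFun_symm_apply]
  obtain ⟨e, he⟩ := hbij y₀ hli.self_of_nhds hsp.self_of_nhds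
  have hinv : ContDiffAt ℝ r (fun y => (A Z y).inverse) y₀ := by
    have h1 : ContDiffAt ℝ r ContinuousLinearMap.inverse (A Z y₀) := by
      rw [← he]
      exact contDiffAt_map_inverse e
    exact h1.comp y₀ (hA hZ)
  refine ((hA hQ).clm_comp hinv).congr_of_eventuallyEq ?_
  filter_upwards [hli, hsp, hP] with y h1 h2 h3
  obtain ⟨e, he⟩ := hbij y h1 h2
  ext v
  rw [← he, ContinuousLinearMap.inverse_equiv]
  obtain ⟨c, rfl⟩ := e.surjective v
  have h4 : e c = ∑ i, c i • Z i y := by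
    rw [← hAapp, ← he]
    rfl
  have h5 : ((A Q y).comp (e.symm : V →L[ℝ] (ι → ℝ))) (e c) = A Q y c :=
    congrArg (A Q y) (e.symm_apply_apply c)
  rw [h5, h4, hAapp, map_sum]
  exact Finset.sum_congr rfl fun i _ => by rw [map_smul, h3 i]

variable {n : ℕ} {M : Type*} [TopologicalSpace M] [ChartedSpace (Model n) M]
  [IsManifold (𝓡 n) ∞ M]

/-- Local frames of `A` and `B` together form a frame of the tangent bundle; `P` fixes the first
part and annihilates the second. -/
lemma contDiffOn_localEnd {A B : Distribution n M} {r : ℕ∞}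
    (hA : IsDistributionOfClass r A) (hB : IsDistributionOfClass r B)
    (h : ∀ x, IsCompl (A x) (B x))
    {P : (x : M) → TangentSpace (𝓡 n) x →L[ℝ] TangentSpace (𝓡 n) x}
    (hPA : ∀ x v, v ∈ A x → P x v = v) (hPB : ∀ x v, v ∈ B x → P x v = 0) (x₀ : M) :
    ContDiffOn ℝ r (fun y => localEnd P x₀ ((extChartAt (𝓡 n) x₀).symm y))
      (extChartAt (𝓡 n) x₀).target := by
  intro y₀ hy₀
  obtain ⟨U, hU, hxU, d, Y, hY, hYU⟩ := hA ((extChartAt (𝓡 n) x₀).symm y₀)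
  obtain ⟨U', hU', hxU', d', Y', hY', hYU'⟩ := hB ((extChartAt (𝓡 n) x₀).symm y₀)
  have hopen : ∀ {U : Set M}, IsOpen U → (extChartAt (𝓡 n) x₀).symm y₀ ∈ U →
      (extChartAt (𝓡 n) x₀).target ∩ (extChartAt (𝓡 n) x₀).symm ⁻¹' U ∈ 𝓝 y₀ :=
    fun hU hxU => ((continuousOn_extChartAt_symm x₀).isOpen_inter_preimage
      (isOpen_extChartAt_target x₀) hU).mem_nhds ⟨hy₀, hxU⟩
  let coord : ((x : M) → TangentSpace (𝓡 n) x) → Model n → Model n := fun Y y =>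
    coordAt x₀ ((extChartAt (𝓡 n) x₀).symm y) (Y ((extChartAt (𝓡 n) x₀).symm y))
  have hcY : ∀ i, ContDiffAt ℝ r (coord (Y i)) y₀ := fun i =>
    (contDiffOn_coordAt hU (hY i) x₀).contDiffAt (hopen hU hxU)
  have hcY' : ∀ i, ContDiffAt ℝ r (coord (Y' i)) y₀ := fun i =>
    (contDiffOn_coordAt hU' (hY' i) x₀).contDiffAt (hopen hU' hxU')
  have hframe : ∀ y ∈ (extChartAt (𝓡 n) x₀).target, (extChartAt (𝓡 n) x₀).symm y ∈ U →
      (extChartAt (𝓡 n) x₀).symm y ∈ U' →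
      LinearIndependent ℝ (fun i => Sum.elim (fun i => coord (Y i)) (fun i => coord (Y' i)) i y) ∧
      ⊤ ≤ Submodule.span ℝ (Set.range fun i =>
        Sum.elim (fun i => coord (Y i)) (fun i => coord (Y' i)) i y) := by
    intro y hy hyU hyU'
    have hsrc := (extChartAt (𝓡 n) x₀).map_target hy
    set x := (extChartAt (𝓡 n) x₀).symm y with hx
    obtain ⟨h1, h2⟩ := hYU x hyU
    obtain ⟨h1', h2'⟩ := hYU' x hyU'
    have hfam : (fun i => Sum.elim (fun i => coord (Y i)) (fun i => coord (Y' i)) i y) =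
        (coordAt x₀ x).toLinearMap ∘ Sum.elim (fun i => Y i x) (fun i => Y' i x) := by
      funext i
      cases i <;> rfl
    rw [hfam]
    constructor
    · refine (h1.sum_type h1' ?_).map' _ ?_
      · rw [h2, h2']
        exact (h x).disjoint
      · rw [LinearMap.ker_eq_bot]
        exact Function.LeftInverse.injective (g := frameAt x₀ x) fun v => frameAt_coordAt hsrc v
    · rw [Set.range_comp, ← Submodule.map_span, Set.Sum.elim_range, Submodule.span_union, h2, h2',
        (h x).sup_eq_top]
      intro w _
      exact ⟨frameAt x₀ x w, trivial, coordAt_frameAt hsrc w⟩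
  have hev : ∀ᶠ y in 𝓝 y₀, y ∈ (extChartAt (𝓡 n) x₀).target ∧
      (extChartAt (𝓡 n) x₀).symm y ∈ U ∧ (extChartAt (𝓡 n) x₀).symm y ∈ U' := by
    filter_upwards [hopen hU hxU, hopen hU' hxU'] with y h1 h2 using ⟨h1.1, h1.2, h2.2⟩
  refine (contDiffAt_of_apply_frame
    (Z := Sum.elim (fun i => coord (Y i)) (fun i => coord (Y' i)))
    (Q := Sum.elim (fun i => coord (Y i)) (fun _ _ => 0)) ?_ ?_
    (hev.mono fun y hy => (hframe y hy.1 hy.2.1 hy.2.2).1)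
    (hev.mono fun y hy => (hframe y hy.1 hy.2.1 hy.2.2).2) ?_).contDiffWithinAt
  · rintro (i | i)
    · exact hcY i
    · exact hcY' i
  · rintro (i | i)
    · exact hcY i
    · exact contDiffAt_const
  · filter_upwards [hev] with y hy i
    have hsrc := (extChartAt (𝓡 n) x₀).map_target hy.1
    rcases i with i | i
    · change coordAt x₀ _ (P _ (frameAt x₀ _ (coordAt x₀ _ (Y i _)))) = coordAt x₀ _ (Y i _)
      rw [frameAt_coordAt hsrc, hPA]
      rw [← (hYU _ hy.2.1).2]
      exact Submodule.subset_span ⟨i, rfl⟩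
    · change coordAt x₀ _ (P _ (frameAt x₀ _ (coordAt x₀ _ (Y' i _)))) = 0
      rw [frameAt_coordAt hsrc, hPB, map_zero]
      rw [← (hYU' _ hy.2.2).2]
      exact Submodule.subset_span ⟨i, rfl⟩

end SmoothProjection

end AnosovForms

namespace AnosovForms

open Bundle Filter MeasureTheory

/-! ### Existence, uniqueness and approximation of the solution. -/

section Solution

lemma integral_Ioi_eq_neg_of_exp_decay {f f' : ℝ → ℝ} (hf : ∀ t, HasDerivAt f (f' t) t)
    (hf' : IntegrableOn f' (Set.Ioi 0)) {B ν : ℝ} (hν : 0 < ν)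
    (hb : ∀ t ≥ 0, |f t| ≤ B * Real.exp (-ν * t)) : ∫ t in Set.Ioi 0, f' t = -f 0 := by
  have hlim : Tendsto f atTop (𝓝 0) := by
    refine squeeze_zero_norm' ?_ (tendsto_const_mul_exp_neg B hν 1)
    filter_upwards [eventually_ge_atTop 0] with t ht
    rw [mul_one]
    exact hb t ht
  rw [integral_Ioi_of_hasDerivAt_of_tendsto (hf 0).continuousAt.continuousWithinAt
    (fun t _ => hf t) hf' hlim, zero_sub]

variable {n : ℕ} {M : Type*} [TopologicalSpace M] [ChartedSpace (Model n) M]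
  {Φ : Flow ℝ M} {X : (x : M) → TangentSpace (𝓡 n) x} {Euu Ess : Distribution n M} {k : ℕ}

lemma IsFormOfClass.const_smul [IsManifold (𝓡 n) ∞ M] {r : ℕ∞} {β : Form n k M}
    (hβ : IsFormOfClass r β) (c : ℝ) : IsFormOfClass r (c • β) := by
  rw [isFormOfClass_iff_apply] at *
  exact fun x₀ w => contDiffOn_const.mul (hβ x₀ w)

variable [RiemannianBundle (fun x : M => TangentSpace (𝓡 n) x)]

/-- Expand each `v i` as `P x (v i)` plus a vector of `U x`. Among the `2 ^ k` terms, the one with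
projections in all slots is `formComp P β`; every other one has a slot in `U x`. -/
lemma abs_sub_formComp_le {β : Form n k M} {U : Distribution n M}
    {P : (x : M) → TangentSpace (𝓡 n) x →L[ℝ] TangentSpace (𝓡 n) x}
    (hPU : ∀ x v, v - P x v ∈ U x) {K : ℝ} (hK : 0 ≤ K) (hPK : ∀ x v, ‖P x v‖ ≤ K * ‖v‖)
    {B : ℝ} (hB : 0 ≤ B) {x : M}
    (hβ : ∀ w : Fin k → TangentSpace (𝓡 n) x, (∃ i, w i ∈ U x) → |β x w| ≤ B * ∏ i, ‖w i‖)
    (v : Fin k → TangentSpace (𝓡 n) x) :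
    |β x v - formComp P β x v| ≤ 2 ^ k * (1 + K) ^ k * B * ∏ i, ‖v i‖ := by
  set a : Fin k → TangentSpace (𝓡 n) x := fun i => P x (v i)
  set b : Fin k → TangentSpace (𝓡 n) x := fun i => v i - P x (v i)
  have hv : v = a + b := by
    funext i
    exact (add_sub_cancel (P x (v i)) (v i)).symm
  have h1 : β x v = formComp P β x v +
      ∑ s ∈ Finset.univ.erase Finset.univ, β x (s.piecewise a b) := by
    conv_lhs => rw [hv, ContinuousAlternatingMap.map_add_univ]
    rw [← Finset.add_sum_erase _ _ (Finset.mem_univ Finset.univ), Finset.piecewise_univ]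
    rfl
  have hterm : ∀ s ∈ Finset.univ.erase (Finset.univ : Finset (Fin k)),
      |β x (s.piecewise a b)| ≤ (1 + K) ^ k * B * ∏ i, ‖v i‖ := by
    intro s hs
    obtain ⟨i, hi⟩ : ∃ i, i ∉ s := by
      by_contra! hcon
      exact (Finset.mem_erase.1 hs).1 (Finset.eq_univ_iff_forall.2 hcon)
    refine (hβ _ ⟨i, by rw [Finset.piecewise_eq_of_notMem _ _ _ hi]; exact hPU x _⟩).trans ?_
    rw [mul_comm ((1 + K) ^ k), mul_assoc]
    refine mul_le_mul_of_nonneg_left ?_ hB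
    calc ∏ i, ‖s.piecewise a b i‖ ≤ ∏ i, (1 + K) * ‖v i‖ := by
          refine Finset.prod_le_prod (fun _ _ => norm_nonneg _) fun i _ => ?_
          by_cases his : i ∈ s
          · rw [Finset.piecewise_eq_of_mem _ _ _ his]
            linarith [hPK x (v i), norm_nonneg (v i)]
          · rw [Finset.piecewise_eq_of_notMem _ _ _ his]
            linarith [hPK x (v i), norm_sub_le (v i) (P x (v i))]
      _ = (1 + K) ^ k * ∏ i, ‖v i‖ := by simp [Finset.prod_mul_distrib]
  rw [h1, add_sub_cancel_left]
  have hprod : 0 ≤ ∏ i, ‖v i‖ := Finset.prod_nonneg fun _ _ => norm_nonneg _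
  refine (Finset.abs_sum_le_sum_abs _ _).trans ((Finset.sum_le_card_nsmul _ _ _ hterm).trans ?_)
  rw [nsmul_eq_mul, mul_assoc (2 ^ k), mul_assoc (2 ^ k)]
  refine mul_le_mul_of_nonneg_right ?_ (by positivity)
  have h2 : (Finset.univ.erase (Finset.univ : Finset (Fin k))).card ≤ 2 ^ k :=
    (Finset.card_le_univ _).trans (by simp)
  exact_mod_cast h2

lemma HasExpDecay.mono {σ C C' ν ν' : ℝ} {β : Form n k M} (h : HasExpDecay Φ σ C ν β)
    (hC : C ≤ C') (hC' : 0 ≤ C') (hν : ν' ≤ ν) : HasExpDecay Φ σ C' ν' β := by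
  intro t ht x v
  refine (h t ht x v).trans (mul_le_mul_of_nonneg_right ?_
    (Finset.prod_nonneg fun _ _ => norm_nonneg _))
  exact mul_le_mul hC (Real.exp_le_exp.2 (by nlinarith)) (Real.exp_pos _).le hC'

variable [IsManifold (𝓡 n) ∞ M]
  [IsContinuousRiemannianBundle (Model n) (fun x : M => TangentSpace (𝓡 n) x)]
  [CompactSpace M]

/-- Decay applies to the continuous form `η` as well, so integrating the derivative of its pullbacks
leaves only the boundary value at time 0. -/
lemma IsAnosovNorm.integral_centerStable [Nonempty M]
    (h : IsAnosovNorm Φ X Euu Ess) (hk : 2 ≤ k)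
    {η ξ : Form n k M} (hη : IsFormOfClass 0 η) (hξ : IsFormOfClass 0 ξ)
    (hL : HasLieDeriv Φ η ξ) (x : M) (v : Fin k → TangentSpace (𝓡 n) x)
    (hv : ∀ i, v i ∈ centerStable X Ess x) :
    IntegrableOn (fun s => flowPullback Φ s ξ x v) (Set.Ioi 0) ∧
      η x v = -∫ s in Set.Ioi 0, flowPullback Φ s ξ x v := by
  obtain ⟨C, -, ν, hν, H⟩ := h.decay_centerStable hk hξ
  obtain ⟨C', -, ν', hν', H'⟩ := h.decay_centerStable hk hη
  have hint : IntegrableOn (fun s => flowPullback Φ s ξ x v) (Set.Ioi 0) :=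
    integrableOn_of_exp_decay (continuous_flowPullback_apply h.smooth hξ x v) hν
      (fun t ht => (H t ht x v hv).trans (le_of_eq (mul_right_comm _ _ _))) le_rfl
  refine ⟨hint, ?_⟩
  rw [integral_Ioi_eq_neg_of_exp_decay (fun t => hL.hasDerivAt h.smooth t x v) hint hν'
    (fun t ht => (H' t ht x v hv).trans (le_of_eq (mul_right_comm _ _ _))), neg_neg,
    flowPullback_zero]

variable [T2Space M] [ConnectedSpace M]

/-- A form is the sum of two forms whose pullbacks decay in positive time and in negative time,
respectively. -/
lemma IsAnosovNorm.exists_decaying_parts (h : IsAnosovNorm Φ X Euu Ess)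
    (ha : IsAsymmetricNorm Φ Euu) (hk : 2 ≤ k) (hkn : k + 2 ≤ n) :
    ∃ P : (x : M) → TangentSpace (𝓡 n) x →L[ℝ] TangentSpace (𝓡 n) x,
      (∀ x v, v ∈ centerStable X Ess x → P x v = v) ∧ (∀ x v, v ∈ Euu x → P x v = 0) ∧
      ∀ ξ : Form n k M, IsFormOfClass 0 ξ → IsFormOfClass 0 (formComp P ξ) ∧
        ∃ C > 0, ∃ ν > 0, HasExpDecay Φ 1 C ν (formComp P ξ) ∧
          HasExpDecay Φ (-1) C ν (ξ - formComp P ξ) := by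
  obtain ⟨P, hP1, hP2, hPc, hPid, hP0, hPT, K, hK, hPK⟩ := h.exists_unstable_projection
  refine ⟨P, hPid, hP0, fun ξ hξ => ⟨hξ.formComp fun x₀ => contDiffOn_zero.2 ((hPc x₀).comp
    (continuousOn_extChartAt_symm x₀) fun y hy => (extChartAt (𝓡 n) x₀).map_target hy), ?_⟩⟩
  obtain ⟨C, hC, ν, hν, H⟩ := h.decay_centerStable hk hξ
  obtain ⟨C', hC', μ, hμ, H'⟩ := h.decay_unstable ha
    (fun x => (h.finrank_unstable_lt ha x).le) hkn hξ
  have h1 : HasExpDecay Φ 1 (C * K ^ k) ν (formComp P ξ) := by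
    intro t ht x v
    rw [one_mul, flowPullback_formComp hPT]
    refine (H t ht x _ fun i => hP1 x (v i)).trans ?_
    calc C * Real.exp (-ν * t) * ∏ i, ‖P x (v i)‖
        ≤ C * Real.exp (-ν * t) * ∏ i, K * ‖v i‖ :=
          mul_le_mul_of_nonneg_left (Finset.prod_le_prod (fun _ _ => norm_nonneg _)
            fun i _ => hPK x (v i)) (by positivity)
      _ = C * K ^ k * Real.exp (-ν * t) * ∏ i, ‖v i‖ := by
          rw [Finset.prod_mul_distrib, Finset.prod_const, Finset.card_univ, Fintype.card_fin]
          ring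
  -- Pullback commutes with `formComp P`, so expanding $f_{-t}^*\xi$ leaves only terms with an
  -- unstable slot.
  have h2 : HasExpDecay Φ (-1) (2 ^ k * (1 + K) ^ k * C') μ (ξ - formComp P ξ) := by
    intro t ht x v
    rw [neg_one_mul]
    have h3 : flowPullback Φ (-t) (ξ - formComp P ξ) x v =
        flowPullback Φ (-t) ξ x v - formComp P (flowPullback Φ (-t) ξ) x v :=
      congrArg (flowPullback Φ (-t) ξ x v - ·) (flowPullback_formComp hPT (-t) ξ x v)
    rw [h3]
    refine (abs_sub_formComp_le hP2 hK.le hPK (B := C' * Real.exp (-μ * t)) (by positivity)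
      (H' t ht x) v).trans (le_of_eq (by ring))
  exact ⟨max (C * K ^ k) (2 ^ k * (1 + K) ^ k * C'), lt_max_of_lt_left (by positivity),
    min ν μ, lt_min hν hμ,
    h1.mono (le_max_left _ _) (le_max_of_le_left (by positivity)) (min_le_left _ _),
    h2.mono (le_max_right _ _) (le_max_of_le_left (by positivity)) (min_le_right _ _)⟩

lemma IsAnosovNorm.integral_unstable (h : IsAnosovNorm Φ X Euu Ess)
    (ha : IsAsymmetricNorm Φ Euu) (hkn : k + 2 ≤ n)
    {η ξ : Form n k M} (hη : IsFormOfClass 0 η) (hξ : IsFormOfClass 0 ξ)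
    (hL : HasLieDeriv Φ η ξ) (x : M) (v : Fin k → TangentSpace (𝓡 n) x)
    (hv : ∃ i, v i ∈ Euu x) :
    IntegrableOn (fun s => flowPullback Φ (-s) ξ x v) (Set.Ioi 0) ∧
      η x v = ∫ s in Set.Ioi 0, flowPullback Φ (-s) ξ x v := by
  have hdim := fun x => (h.finrank_unstable_lt ha x).le
  obtain ⟨C, -, ν, hν, H⟩ := h.decay_unstable ha hdim hkn hξ
  obtain ⟨C', -, ν', hν', H'⟩ := h.decay_unstable ha hdim hkn hη
  have hint : IntegrableOn (fun s => flowPullback Φ (-s) ξ x v) (Set.Ioi 0) :=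
    integrableOn_of_exp_decay ((continuous_flowPullback_apply h.smooth hξ x v).comp
      continuous_neg) hν
      (fun t ht => (H t ht x v hv).trans (le_of_eq (mul_right_comm _ _ _))) le_rfl
  refine ⟨hint, ?_⟩
  have hd : ∀ t, HasDerivAt (fun s => flowPullback Φ (-s) η x v) (-flowPullback Φ (-t) ξ x v) t :=
    fun t => by
      have := (hL.hasDerivAt h.smooth (-t) x v).comp t (hasDerivAt_neg t)
      rw [mul_neg_one] at this
      exact this
  have h1 := integral_Ioi_eq_neg_of_exp_decay hd hint.neg hν'
    (fun t ht => (H' t ht x v hv).trans (le_of_eq (mul_right_comm _ _ _)))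
  rw [integral_neg, neg_inj, neg_zero, flowPullback_zero] at h1
  exact h1.symm

/-- The integral formulas give `η` and `η'` the same values on center stable tuples and on tuples
with an unstable slot. The expansion along `P`, used with the bound 0, covers all other tuples. -/
lemma IsAnosovNorm.eq_of_hasLieDeriv (h : IsAnosovNorm Φ X Euu Ess)
    (ha : IsAsymmetricNorm Φ Euu) (hk : 2 ≤ k) (hkn : k + 2 ≤ n) {η η' ξ : Form n k M}
    (hη : IsFormOfClass 0 η) (hη' : IsFormOfClass 0 η') (hξ : IsFormOfClass 0 ξ)
    (hL : HasLieDeriv Φ η ξ) (hL' : HasLieDeriv Φ η' ξ) : η = η' := by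
  obtain ⟨P, hP1, hP2, -, -, -, -, K, hK, hPK⟩ := h.exists_unstable_projection
  funext x
  ext v
  have h1 : formComp P (η - η') x v = 0 := by
    change η x (fun i => P x (v i)) - η' x (fun i => P x (v i)) = 0
    have hv : ∀ i, P x (v i) ∈ centerStable X Ess x := fun i => hP1 x (v i)
    rw [(h.integral_centerStable hk hη hξ hL x (fun i => P x (v i)) hv).2,
      (h.integral_centerStable hk hη' hξ hL' x (fun i => P x (v i)) hv).2, sub_self]
  have h2 := abs_sub_formComp_le (β := η - η') hP2 hK.le hPK le_rfl (x := x) (fun w hw => by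
    change |η x w - η' x w| ≤ _
    rw [(h.integral_unstable ha hkn hη hξ hL x w hw).2,
      (h.integral_unstable ha hkn hη' hξ hL' x w hw).2, sub_self, abs_zero, zero_mul]) v
  rw [h1, sub_zero, mul_zero, zero_mul] at h2
  exact sub_eq_zero.1 (abs_nonpos_iff.1 h2)

lemma IsAnosovNorm.exists_hasLieDeriv (h : IsAnosovNorm Φ X Euu Ess)
    (ha : IsAsymmetricNorm Φ Euu) (hk : 2 ≤ k) (hkn : k + 2 ≤ n) {ξ : Form n k M}
    (hξ : IsFormOfClass 0 ξ) :
    ∃ η : Form n k M, IsFormOfClass 0 η ∧ HasLieDeriv Φ η ξ ∧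
      (IsFormOfClass 1 ξ → IsDistributionOfClass 1 Euu →
        IsDistributionOfClass 1 (centerStable X Ess) → ∃ ηt ζt : NNReal → Form n k M,
          (∀ t, IsFormOfClass 1 (ηt t) ∧ IsFormOfClass 1 (ζt t) ∧ HasLieDeriv Φ (ηt t) (ζt t)) ∧
          ∃ B, ∃ ν > 0, ∀ (t : NNReal) x v,
            |(ηt t - η) x v| ≤ B * Real.exp (-ν * t) * ∏ i, ‖v i‖ ∧
            |(ζt t - ξ) x v| ≤ B * Real.exp (-ν * t) * ∏ i, ‖v i‖) := by
  obtain ⟨P, hPid, hP0, HP⟩ := h.exists_decaying_parts (k := k) ha hk hkn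
  obtain ⟨hα, C, hC, ν, hν, hdα, hdβ⟩ := HP ξ hξ
  set α := formComp P ξ
  have hβ : IsFormOfClass 0 (ξ - α) := hξ.sub hα
  -- The backward integral of $\xi-\alpha$ has Lie derivative $\xi-\alpha$, the forward integral of
  -- $\alpha$ has $-\alpha$; hence the difference.
  refine ⟨flowIntegral Φ (-1) (Set.Ioi 0) (ξ - α) - flowIntegral Φ 1 (Set.Ioi 0) α,
    (hdβ.isFormOfClass_flowIntegral h.smooth hβ hν).sub
      (hdα.isFormOfClass_flowIntegral h.smooth hα hν), ?_, fun hξ1 hEu hEcs => ?_⟩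
  · have h1 := (hdβ.hasLieDeriv h.smooth hβ hν (Or.inr rfl)).sub
      (hdα.hasLieDeriv h.smooth hα hν (Or.inl rfl))
    have h2 : -(-1 : ℝ) • (ξ - α) - -(1 : ℝ) • α = ξ := by
      funext x
      ext v
      change -(-1 : ℝ) * (ξ x v - α x v) - -(1 : ℝ) * α x v = ξ x v
      ring
    rwa [h2] at h1
  · have hα1 : IsFormOfClass 1 α := hξ1.formComp
      (contDiffOn_localEnd hEcs hEu (fun x => (h.isCompl_unstable x).symm) hPid hP0)
    have hβ1 : IsFormOfClass 1 (ξ - α) := hξ1.sub hα1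
    -- Truncation at `t` makes the Lie derivative $\xi-f_{-t}^*(\xi-\alpha)-f_t^*\alpha$. One
    -- constant covers both the tails, at most `C / ν` each, and the boundary terms, at most `C`
    -- each.
    refine ⟨fun t => flowIntegral Φ (-1) (Set.Ioc 0 t) (ξ - α) - flowIntegral Φ 1 (Set.Ioc 0 t) α,
      fun t => (-1 : ℝ) • (flowPullback Φ (-1 * t) (ξ - α) - (ξ - α)) -
        (1 : ℝ) • (flowPullback Φ (1 * t) α - α), fun t => ⟨?_, ?_, ?_⟩,
      2 * (C / ν + C), ν, hν, fun t x v => ⟨?_, ?_⟩⟩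
    · exact (isFormOfClass_flowIntegral_Ioc h.smooth (Or.inr rfl) hβ1 (-1) t.coe_nonneg).sub
        (isFormOfClass_flowIntegral_Ioc h.smooth (Or.inr rfl) hα1 1 t.coe_nonneg)
    · exact (((hβ1.flowPullback h.smooth _).sub hβ1).const_smul _).sub
        (((hα1.flowPullback h.smooth _).sub hα1).const_smul _)
    · exact (hasLieDeriv_flowIntegral_Ioc h.smooth hβ (Or.inr rfl) t.coe_nonneg).sub
        (hasLieDeriv_flowIntegral_Ioc h.smooth hα (Or.inl rfl) t.coe_nonneg)
    · have h1 := hdβ.abs_flowIntegral_sub_le h.smooth hβ hν t.coe_nonneg x v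
      have h2 := hdα.abs_flowIntegral_sub_le h.smooth hα hν t.coe_nonneg x v
      have h3 : 0 ≤ C * Real.exp (-ν * t) * ∏ i, ‖v i‖ :=
        mul_nonneg (by positivity) (Finset.prod_nonneg fun _ _ => norm_nonneg _)
      change |(flowIntegral Φ (-1) (Set.Ioc 0 t) (ξ - α) x v -
        flowIntegral Φ 1 (Set.Ioc 0 t) α x v) - (flowIntegral Φ (-1) (Set.Ioi 0) (ξ - α) x v -
        flowIntegral Φ 1 (Set.Ioi 0) α x v)| ≤ _
      have h4 : 2 * (C / ν + C) * Real.exp (-ν * t) * ∏ i, ‖v i‖ =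
          2 * (C / ν * Real.exp (-ν * t) * ∏ i, ‖v i‖) +
            2 * (C * Real.exp (-ν * t) * ∏ i, ‖v i‖) := by ring
      rw [h4]
      rw [abs_le] at h1 h2 ⊢
      constructor <;> linarith
    · have h1 := hdβ t t.coe_nonneg x v
      have h2 := hdα t t.coe_nonneg x v
      have h3 : 0 ≤ C / ν * Real.exp (-ν * t) * ∏ i, ‖v i‖ :=
        mul_nonneg (by positivity) (Finset.prod_nonneg fun _ _ => norm_nonneg _)
      change |((-1 : ℝ) * (flowPullback Φ (-1 * t) (ξ - α) x v - (ξ x v - α x v)) -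
        (1 : ℝ) * (flowPullback Φ (1 * t) α x v - α x v)) - ξ x v| ≤ _
      have h4 : 2 * (C / ν + C) * Real.exp (-ν * t) * ∏ i, ‖v i‖ =
          2 * (C / ν * Real.exp (-ν * t) * ∏ i, ‖v i‖) +
            2 * (C * Real.exp (-ν * t) * ∏ i, ‖v i‖) := by ring
      rw [h4]
      rw [abs_le] at h1 h2 ⊢
      constructor <;> linarith

end Solution

end AnosovForms

namespace AnosovForms

open Bundle Filter MeasureTheory

/-! ### Transfer from the metric to norms on the tangent spaces. -/

section Riemannian

variable {n : ℕ} {M : Type*} [TopologicalSpace M] [ChartedSpace (Model n) M]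

lemma isAnosov_splitting {X : (x : M) → TangentSpace (𝓡 n) x} {Euu Ess : Distribution n M} {x : M}
    (h : DirectSum.IsInternal ![Euu x, centerBundle X x, Ess x]) :
    Disjoint (centerBundle X x) (Ess x) ∧ Disjoint (Euu x) (centerBundle X x) ∧
      IsCompl (Euu x) (centerStable X Ess x) ∧ IsCompl (Ess x) (Euu x ⊔ centerBundle X x) := by
  have hi := h.submodule_iSupIndep
  have ht := h.submodule_iSup_eq_top
  have hsup : Euu x ⊔ (centerBundle X x ⊔ Ess x) = ⊤ := by
    rw [← ht, iSup_fin_three]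
    simp [sup_assoc]
  have h0 := hi 0
  have h2 := hi 2
  have e0 : (⨆ j, ⨆ (_ : j ≠ (0 : Fin 3)), ![Euu x, centerBundle X x, Ess x] j) =
      centerBundle X x ⊔ Ess x := by
    rw [iSup_fin_three]
    simp
  have e2 : (⨆ j, ⨆ (_ : j ≠ (2 : Fin 3)), ![Euu x, centerBundle X x, Ess x] j) =
      Euu x ⊔ centerBundle X x := by
    rw [iSup_fin_three]
    simp
  rw [e0] at h0
  rw [e2] at h2
  refine ⟨(hi.pairwiseDisjoint (show (1 : Fin 3) ≠ 2 by decide)),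
    (hi.pairwiseDisjoint (show (0 : Fin 3) ≠ 1 by decide)),
    ⟨h0, codisjoint_iff.2 hsup⟩, ⟨h2, codisjoint_iff.2 ?_⟩⟩
  change Ess x ⊔ (Euu x ⊔ centerBundle X x) = ⊤
  rw [sup_comm, sup_assoc]
  exact hsup

variable [IsManifold (𝓡 n) ∞ M]

/-- The Riemannian structure on the tangent bundle that is given by a metric. -/
@[reducible] noncomputable def Metric.riemannianBundle (g : Metric n M) :
    RiemannianBundle (fun x : M => TangentSpace (𝓡 n) x) :=
  ⟨g.toRiemannianMetric⟩

lemma Metric.isContinuousRiemannianBundle (g : Metric n M) :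
    letI := g.riemannianBundle
    IsContinuousRiemannianBundle (Model n) (fun x : M => TangentSpace (𝓡 n) x) := by
  let : RiemannianBundle (fun x : M => TangentSpace (𝓡 n) x) := ⟨g.toRiemannianMetric⟩
  exact ⟨⟨g.inner, g.contMDiff.continuous, fun _ _ _ => rfl⟩⟩

lemma IsAnosov.isAnosovNorm {g : Metric n M} {Φ : Flow ℝ M} {X : (x : M) → TangentSpace (𝓡 n) x}
    {Euu Ess : Distribution n M} (h : IsAnosov g Φ X Euu Ess) :
    letI := g.riemannianBundle
    IsAnosovNorm Φ X Euu Ess := by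
  let := g.riemannianBundle
  exact
    { smooth := h.smooth
      generator := h.generator
      nonsingular := h.nonsingular
      unstable_invariant := fun t x v hv => h.unstable_invariant t x ▸ ⟨v, hv, rfl⟩
      stable_invariant := fun t x v hv => h.stable_invariant t x ▸ ⟨v, hv, rfl⟩
      disjoint_center_stable := fun x => (isAnosov_splitting (h.splitting x)).1
      disjoint_unstable_center := fun x => (isAnosov_splitting (h.splitting x)).2.1
      isCompl_unstable := fun x => (isAnosov_splitting (h.splitting x)).2.2.1
      isCompl_stable := fun x => (isAnosov_splitting (h.splitting x)).2.2.2
      stable_contracts := h.stable_contracts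
      unstable_expands := h.unstable_expands }

lemma IsAsymmetric.isAsymmetricNorm {g : Metric n M} {Φ : Flow ℝ M} {Euu : Distribution n M}
    (h : IsAsymmetric g Φ Euu) :
    letI := g.riemannianBundle
    IsAsymmetricNorm Φ Euu := by
  let := g.riemannianBundle
  obtain ⟨C, hC, lam, hlam, H⟩ := h
  refine ⟨C, hC, lam, hlam, fun m hm t ht x v hv => ?_⟩
  obtain rfl : m = n - 2 := by omega
  exact H t ht x v hv

lemma formSupNorm_le (g : Metric n M) {k : ℕ} {β : Form n k M} {B : ℝ}
    (h : ∀ (x : M) (v : Fin k → TangentSpace (𝓡 n) x), |β x v| ≤ B * ∏ i, tangentLength g (v i)) :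
    formSupNorm g β ≤ ENNReal.ofReal B := by
  refine iSup_le fun x => iSup_le fun v => iSup_le fun hv => ENNReal.ofReal_le_ofReal ?_
  refine (h x v).trans (le_of_eq ?_)
  simp [hv]

lemma tendsto_formSupNorm (g : Metric n M) {k : ℕ} {β : NNReal → Form n k M} {B ν : ℝ}
    (hν : 0 < ν) (h : ∀ (t : NNReal) (x : M) (v : Fin k → TangentSpace (𝓡 n) x),
      |β t x v| ≤ B * Real.exp (-ν * t) * ∏ i, tangentLength g (v i)) :
    Tendsto (fun t => formSupNorm g (β t)) atTop (𝓝 0) := by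
  have h1 : Tendsto (fun t : NNReal => ENNReal.ofReal (B * Real.exp (-ν * t) * 1)) atTop
      (𝓝 (ENNReal.ofReal 0)) :=
    ENNReal.tendsto_ofReal ((tendsto_const_mul_exp_neg B hν 1).comp
      (NNReal.tendsto_coe_atTop.2 tendsto_id))
  rw [ENNReal.ofReal_zero] at h1
  refine tendsto_of_tendsto_of_tendsto_of_le_of_le tendsto_const_nhds h1 (fun _ => zero_le)
    fun t => formSupNorm_le g fun x v => ?_
  rw [mul_one]
  exact h t x v

end Riemannian

end AnosovForms

theorem mainTheorem2 {n : ℕ} {M : Type*} [TopologicalSpace M] [T2Space M] [CompactSpace M]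
    [ConnectedSpace M] [ChartedSpace (AnosovForms.Model n) M] [IsManifold (𝓡 n) ∞ M]
    (g : AnosovForms.Metric n M) (Φ : Flow ℝ M) (X : (x : M) → TangentSpace (𝓡 n) x)
    (Euu Ess : AnosovForms.Distribution n M)
    (hΦ : AnosovForms.IsAnosov g Φ X Euu Ess) (hasym : AnosovForms.IsAsymmetric g Φ Euu)
    {k : ℕ} (hk : 2 ≤ k) (hkn : k + 2 ≤ n)
    (ξ : AnosovForms.Form n k M) (hξ : AnosovForms.IsFormOfClass 0 ξ) :
    (∃! η : AnosovForms.Form n k M, AnosovForms.IsFormOfClass 0 η ∧ AnosovForms.HasLieDeriv Φ η ξ) ∧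
    ∀ η : AnosovForms.Form n k M, AnosovForms.IsFormOfClass 0 η → AnosovForms.HasLieDeriv Φ η ξ →
      (∀ (x : M) (v : Fin k → TangentSpace (𝓡 n) x),
        (∀ i, v i ∈ AnosovForms.centerStable X Ess x) →
          MeasureTheory.IntegrableOn (fun s : ℝ => AnosovForms.flowPullback Φ s ξ x v)
            (Set.Ioi 0) ∧
          η x v = - ∫ s in Set.Ioi (0 : ℝ), AnosovForms.flowPullback Φ s ξ x v) ∧
      (∀ (x : M) (v : Fin k → TangentSpace (𝓡 n) x),
        (∃ i, v i ∈ Euu x) →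
          MeasureTheory.IntegrableOn (fun s : ℝ => AnosovForms.flowPullback Φ (-s) ξ x v)
            (Set.Ioi 0) ∧
          η x v = ∫ s in Set.Ioi (0 : ℝ), AnosovForms.flowPullback Φ (-s) ξ x v) ∧
      (AnosovForms.IsFormOfClass 1 ξ → AnosovForms.IsDistributionOfClass 1 Euu → AnosovForms.IsDistributionOfClass 1 (AnosovForms.centerStable X Ess) →
        ∃ ηt ζt : NNReal → AnosovForms.Form n k M,
          (∀ t, AnosovForms.IsFormOfClass 1 (ηt t) ∧ AnosovForms.IsFormOfClass 1 (ζt t) ∧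
            AnosovForms.HasLieDeriv Φ (ηt t) (ζt t)) ∧
          Filter.Tendsto (fun t => AnosovForms.formSupNorm g (ηt t - η)) Filter.atTop (𝓝 0) ∧
          Filter.Tendsto (fun t => AnosovForms.formSupNorm g (ζt t - ξ)) Filter.atTop (𝓝 0)) := by
  let := g.riemannianBundle
  have := g.isContinuousRiemannianBundle
  have h := hΦ.isAnosovNorm
  have ha := hasym.isAsymmetricNorm
  obtain ⟨η₀, hη₀, hL₀, happrox⟩ := h.exists_hasLieDeriv ha hk hkn hξ
  refine ⟨⟨η₀, ⟨hη₀, hL₀⟩, fun η hη => h.eq_of_hasLieDeriv ha hk hkn hη.1 hη₀ hξ hη.2 hL₀⟩,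
    fun η hη hL => ⟨h.integral_centerStable hk hη hξ hL, h.integral_unstable ha hkn hη hξ hL,
      fun hξ1 hEu hEcs => ?_⟩⟩
  -- The approximations were built for the constructed solution; uniqueness identifies the given one
  -- with it.
  obtain rfl := h.eq_of_hasLieDeriv ha hk hkn hη hη₀ hξ hL hL₀
  obtain ⟨ηt, ζt, hclass, B, ν, hν, hB⟩ := happrox hξ1 hEu hEcs
  exact ⟨ηt, ζt, hclass, AnosovForms.tendsto_formSupNorm g hν fun t x v => (hB t x v).1,
    AnosovForms.tendsto_formSupNorm g hν fun t x v => (hB t x v).2⟩
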